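/- **Rank ordering of hitting probabilities.** Fix $p\in(0,1)$, $\beta>1/p$ and $0<h<p\,\chi(\beta p)$, where $\chi(\lambda)=\sqrt{1-\tfrac1\lambda}-\tfrac1{2\lambda}\log\big[\lambda\big(1+\sqrt{1-\tfrac1\lambda}\big)^2\big]$, and fix $\epsilon>0$. For $n\in\mathbb N$ let $S_n=\{-1,+1\}^{V}$ with $|V|=n$. For $\sigma\in S_n$ let $|\sigma|=\#\{v:\sigma(v)=+1\}$, and let $A_k=\{\sigma\in S_n:|\sigma|=k\}$. For a Hamiltonian $H$ on $S_n$, the Glauber dynamics is the continuous-time Markov process $(\xi_t)_{t\ge0}$ on $S_n$ that jumps from $\sigma$ to $\sigma'$ at rate $e^{-\beta[H(\sigma')-H(\sigma)]_+}$ if $\sigma,\sigma'$ differ in exactly one vertex, and at rate $0$ otherwise. For $A\subset S_n$ let $\tau_A=\inf\{t\ge0:\xi_t\in A,\ \xi_{t-}\notin A\}$, with $\xi_{0-}=\xi_0$ and $\inf\emptyset=\infty$. Let $\mathrm{ER}_n(p)=(V,E)$ be the random graph on $V$ in which each pair of distinct vertices is an edge with probability $p$, independently. Given the graph, let $\mathbb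 P_\nu$ be the law of the Glauber dynamics with initial law $\nu$ for $H_n(\sigma)=-\frac1n\sum_{\{v,w\}\in E}\sigma(v)\sigma(w)-h\sum_{v}\sigma(v)$, and let $\mu_A$ be the Gibbs measure $\mu(\sigma)\propto e^{-\beta H_n(\sigma)}$ conditioned on $A$. Let $$h_n^{u}=h+\frac{(1+\epsilon)\log(n^{11/6})}{n},\qquad h_n^{l}=h-\frac{(1+\epsilon)\log(n^{11/6})}{n},$$ and for $\sigma\in S_n$ let $\mathbb P^{u}_\sigma$, $\mathbb P^{l}_\sigma$ be the laws of the Glauber dynamics started at $\sigma$ for the Curie–Weiss Hamiltonians $-\frac p{2n}\sum_{v,w\in V}\sigma(v)\sigma(w)-h'\sum_v\sigma(v)$ with $h'=h_n^u$, respectively $h'=h_n^l$. For a field $h'$ let $\Gamma_n=\{-1,-1+\frac2n,\dots,1\}$, $I_n(a)=-\frac1n\log\binom{n}{\frac{1+a}2n}$ (the binomial coefficient being extended to real arguments by the Gamma function), $J_n(a)=2\beta(pa+h')-2I_n'(a)$, and $$\mathbf m_n=\min\{a\in\Gamma_n:J_n(a)\le0\},\quad \mathbf t_n=\min\{a\in\Gamma_n:a>\mathbf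 m_n,\,J_n(a)\ge0\},\quad \mathbf s_n=\min\{a\in\Gamma_n:a>\mathbf t_n,\,J_n(a)\le0\},$$ $\mathbf M_n=\frac n2(\mathbf m_n+1)$, $\mathbf S_n=\frac n2(\mathbf s_n+1)$. Write $\mathbf M,\mathbf S$ for these volumes when $h'=h$, $\mathbf M^l,\mathbf S^l$ when $h'=h_n^l$, and $\mathbf M^u,\mathbf S^u$ when $h'=h_n^u$; write $\tau_{\mathbf M}$ for $\tau_{A_{\mathbf M}}$, and so on. Then, for all sufficiently large $n$, the minima that define $\mathbf m_n,\mathbf t_n,\mathbf s_n$ exist for each of the three fields $h$, $h_n^l$, $h_n^u$, and, with $\mathbb P_{\mathrm{ER}_n(p)}$-probability tending to $1$ as $n\to\infty$, $$\max_{\xi\in A_{\mathbf M^l}}\mathbb P^{l}_\xi\big[\tau_{\mathbf S^l}<\tau_{\mathbf M^l}\big]\ \le\ \mathbb P_{\mu_{A_{\mathbf M}}}\big[\tau_{\mathbf S}<\tau_{\mathbf M}\big]\ \le\ \min_{\sigma\in A_{\mathbf M^u}}\mathbb P^{u}_\sigma\big[\tau_{\mathbf S^u}<\tau_{\mathbf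 M^u}\big].$$ -/

import Mathlib

open MeasureTheory ProbabilityTheory Filter Topology
open scoped NNReal ENNReal

namespace ERGlauber

noncomputable section

/-! ### Continuous-time Markov jump processes on a finite state space

A trajectory is coded by `ω : ℕ → S × ℝ`: `(ω k).1` is the state after the `k`-th jump and
`(ω (k + 1)).2` is the time that elapses between the `k`-th and the `(k + 1)`-st jump. -/

section JumpProcess

variable {S : Type*} [Fintype S] [MeasurableSpace S] [DiscreteMeasurableSpace S]

/-- The total rate at which the process leaves `x`. -/
def exitRate (r : S → S → ℝ≥0) (x : S) : ℝ≥0 := ∑ y, r x y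

/-- The law of the state chosen at a jump from `x`: `y` with probability `r x y / exitRate r x`.
A state with exit rate zero is absorbing (the process "jumps" from `x` to `x`). -/
def jumpLaw (r : S → S → ℝ≥0) (x : S) : Measure S :=
  if exitRate r x = 0 then Measure.dirac x
  else ∑ y, ((r x y / exitRate r x : ℝ≥0) : ℝ≥0∞) • Measure.dirac y

/-- The law of the waiting time in `x`: exponential with parameter `exitRate r x` (for an
absorbing state the parameter is irrelevant, and `1` is used). -/
def waitLaw (r : S → S → ℝ≥0) (x : S) : Measure ℝ :=
  expMeasure (if exitRate r x = 0 then 1 else (exitRate r x : ℝ))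

instance jumpLaw_isProbabilityMeasure (r : S → S → ℝ≥0) (x : S) :
    IsProbabilityMeasure (jumpLaw r x) := by
  unfold jumpLaw
  split_ifs with h
  · infer_instance
  · constructor
    simp only [Measure.coe_finsetSum, Finset.sum_apply, Measure.smul_apply, measure_univ,
      smul_eq_mul, mul_one]
    rw [← ENNReal.ofNNReal_finsetSum, ← Finset.sum_div]
    change ((exitRate r x / exitRate r x : ℝ≥0) : ℝ≥0∞) = 1
    rw [div_self h, ENNReal.coe_one]

instance waitLaw_isProbabilityMeasure (r : S → S → ℝ≥0) (x : S) :
    IsProbabilityMeasure (waitLaw r x) := by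
  unfold waitLaw
  split_ifs with h
  · exact isProbabilityMeasure_expMeasure one_pos
  · exact isProbabilityMeasure_expMeasure (by exact_mod_cast pos_iff_ne_zero.mpr h)

/-- Given the current state `x`: the waiting time in `x` and the next state, independent. -/
def stepKernel (r : S → S → ℝ≥0) : Kernel S (S × ℝ) where
  toFun x := (jumpLaw r x).prod (waitLaw r x)
  measurable' := Measurable.of_discrete

instance stepKernel_isMarkovKernel (r : S → S → ℝ≥0) : IsMarkovKernel (stepKernel r) :=
  ⟨fun x => by
    change IsProbabilityMeasure ((jumpLaw r x).prod (waitLaw r x))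
    infer_instance⟩

/-- The step kernel as a function of the whole past: only the current state matters. -/
def pastKernel (r : S → S → ℝ≥0) (k : ℕ) :
    Kernel (∀ _ : Finset.Iic k, S × ℝ) (S × ℝ) :=
  (stepKernel r).comap
    (fun x : (∀ _ : Finset.Iic k, S × ℝ) => (x ⟨k, Finset.mem_Iic.mpr le_rfl⟩).1)
    (measurable_fst.comp (measurable_pi_apply _))

instance pastKernel_isMarkovKernel (r : S → S → ℝ≥0) (k : ℕ) :
    IsMarkovKernel (pastKernel r k) := by
  unfold pastKernel
  infer_instance

/-- The law of the continuous-time Markov jump process with rates `r` and initial law `ν`.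
(The coordinate `(ω 0).2` is a dummy, set to `0`.) -/
def processLaw (r : S → S → ℝ≥0) (ν : Measure S) : Measure (ℕ → S × ℝ) :=
  Kernel.trajMeasure (X := fun _ => S × ℝ) (ν.prod (Measure.dirac (0 : ℝ))) (pastKernel r)

/-- The time of the `k`-th jump. -/
def jumpTime (ω : ℕ → S × ℝ) (k : ℕ) : ℝ := ∑ i ∈ Finset.range k, (ω (i + 1)).2

/-- The state `ξ_t` at time `t`: the state after the last jump up to time `t`. -/
def stateAt (ω : ℕ → S × ℝ) (t : ℝ≥0) : S := (ω (sSup {k : ℕ | jumpTime ω k ≤ t})).1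

/-- The first hitting/return time `inf {t ≥ 0 : ξ_t ∈ A, ξ_{t-} ∉ A}`. The left limit at time `0`
is the initial state, so that for a process started in `A` this is a return time. -/
def hitTime [TopologicalSpace S] (A : Set S) (ω : ℕ → S × ℝ) : ℝ≥0∞ :=
  sInf ((fun t : ℝ≥0 => (t : ℝ≥0∞)) ''
    {t : ℝ≥0 | stateAt ω t ∈ A ∧ Function.leftLim (stateAt ω) t ∉ A})

end JumpProcess

/-! ### Spin configurations and Glauber dynamics -/

/-- Spin configurations in `{-1, +1}^V` with `V = {0, …, n - 1}`. -/
abbrev Config (n : ℕ) : Type := Fin n → ℤˣ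

instance spin_measurableSingletonClass : MeasurableSingletonClass ℤˣ where
  measurableSet_singleton u := by
    refine ⟨{(u : ℤ)}, MeasurableSet.of_discrete, ?_⟩
    ext x
    simp [Units.ext_iff]

/-- The spin value as a real number. -/
def spin {n : ℕ} (σ : Config n) (v : Fin n) : ℝ := ((σ v : ℤ) : ℝ)

/-- The volume `|σ|`: the number of vertices with spin `+1`. -/
def vol {n : ℕ} (σ : Config n) : ℕ := (Finset.univ.filter fun v => σ v = 1).card

/-- The set `A_k` of configurations with volume `k`. -/
def level (n : ℕ) (k : ℝ) : Set (Config n) := {σ | (vol σ : ℝ) = k}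

/-- Metropolis rates for the Hamiltonian `H` at inverse temperature `β`:
`exp (-β [H σ' - H σ]₊)` if `σ, σ'` differ in exactly one vertex (that is, have `ℓ¹`-distance `2`),
and `0` otherwise. -/
def glauberRate {n : ℕ} (H : Config n → ℝ) (β : ℝ) (σ σ' : Config n) : ℝ≥0 :=
  if hammingDist σ σ' = 1 then Real.toNNReal (Real.exp (-β * max (H σ' - H σ) 0)) else 0

/-- The Gibbs measure with weights `exp (-β H σ) / Z`. -/
def gibbs {n : ℕ} (H : Config n → ℝ) (β : ℝ) : Measure (Config n) :=
  ∑ σ, ENNReal.ofReal (Real.exp (-β * H σ) / ∑ τ, Real.exp (-β * H τ)) • Measure.dirac σ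

/-- The probability, for the Glauber dynamics with initial law `ν`, that `B` is hit before `A` is
hit (or returned to): `P_ν[τ_B < τ_A]`. -/
def hitBefore {n : ℕ} (H : Config n → ℝ) (β : ℝ) (ν : Measure (Config n))
    (B A : Set (Config n)) : ℝ :=
  (processLaw (glauberRate H β) ν).real {ω | hitTime B ω < hitTime A ω}

/-- The Ising Hamiltonian on the graph `G`:
`-(1/n) ∑_{vw ∈ E} σ(v) σ(w) - h ∑_v σ(v)`, each edge counted once. -/
def erHamiltonian {n : ℕ} (G : SimpleGraph (Fin n)) (h : ℝ) (σ : Config n) : ℝ :=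
  open Classical in
  -(1 / (n : ℝ)) * ∑ e ∈ G.edgeFinset, (e.map (spin σ)).mul - h * ∑ v, spin σ v

/-- The Curie-Weiss Hamiltonian with coupling strength `p / n` and field `h`. -/
def cwHamiltonian {n : ℕ} (p h : ℝ) (σ : Config n) : ℝ :=
  -(p / (2 * n)) * ∑ v, ∑ w, spin σ v * spin σ w - h * ∑ v, spin σ v

/-! ### The metastable, top and stable magnetizations -/

/-- The threshold function `χ`. -/
def threshold (l : ℝ) : ℝ :=
  √(1 - 1 / l) - 1 / (2 * l) * Real.log (l * (1 + √(1 - 1 / l)) ^ 2)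

/-- The possible magnetizations `-1, -1 + 2/n, …, 1 - 2/n, 1`. -/
def magSet (n : ℕ) : Set ℝ := {a | ∃ k : ℕ, k ≤ n ∧ a = -1 + 2 * k / n}

/-- `I_n(a) = -(1/n) log (n choose (1+a)n/2)`, with the binomial coefficient extended to real
arguments by means of the Gamma function. -/
def entropyFn (n : ℕ) (a : ℝ) : ℝ :=
  -(1 / (n : ℝ)) * Real.log (Real.Gamma (n + 1) /
    (Real.Gamma ((1 + a) / 2 * n + 1) * Real.Gamma ((1 - a) / 2 * n + 1)))

/-- `J_n(a) = 2β(pa + h) - 2 I_n'(a)`. -/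
def driftFn (p β h : ℝ) (n : ℕ) (a : ℝ) : ℝ :=
  2 * β * (p * a + h) - 2 * deriv (entropyFn n) a

/-- The set whose minimum is `m_n`. -/
def metaSet (p β h : ℝ) (n : ℕ) : Set ℝ := {a | a ∈ magSet n ∧ driftFn p β h n a ≤ 0}

/-- The metastable magnetization `m_n`. -/
def metaMag (p β h : ℝ) (n : ℕ) : ℝ := sInf (metaSet p β h n)

/-- The set whose minimum is `t_n`. -/
def topSet (p β h : ℝ) (n : ℕ) : Set ℝ :=
  {a | a ∈ magSet n ∧ metaMag p β h n < a ∧ 0 ≤ driftFn p β h n a}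

/-- The top magnetization `t_n`. -/
def topMag (p β h : ℝ) (n : ℕ) : ℝ := sInf (topSet p β h n)

/-- The set whose minimum is `s_n`. -/
def stableSet (p β h : ℝ) (n : ℕ) : Set ℝ :=
  {a | a ∈ magSet n ∧ topMag p β h n < a ∧ driftFn p β h n a ≤ 0}

/-- The stable magnetization `s_n`. -/
def stableMag (p β h : ℝ) (n : ℕ) : ℝ := sInf (stableSet p β h n)

/-- The minima that define `m_n`, `t_n`, `s_n` exist. -/
def WellDefined (p β h : ℝ) (n : ℕ) : Prop :=
  IsLeast (metaSet p β h n) (metaMag p β h n) ∧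
  IsLeast (topSet p β h n) (topMag p β h n) ∧
  IsLeast (stableSet p β h n) (stableMag p β h n)

/-- The metastable set `A_{M_n}`, where `M_n = (n/2)(m_n + 1)`. -/
def setM (p β h : ℝ) (n : ℕ) : Set (Config n) := level n (n / 2 * (metaMag p β h n + 1))

/-- The stable set `A_{S_n}`, where `S_n = (n/2)(s_n + 1)`. -/
def setS (p β h : ℝ) (n : ℕ) : Set (Config n) := level n (n / 2 * (stableMag p β h n + 1))

/-- The raised field `h_n^u`. -/
def fieldU (h ε : ℝ) (n : ℕ) : ℝ := h + (1 + ε) * Real.log ((n : ℝ) ^ (11 / 6 : ℝ)) / n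

/-- The lowered field `h_n^l`. -/
def fieldL (h ε : ℝ) (n : ℕ) : ℝ := h - (1 + ε) * Real.log ((n : ℝ) ^ (11 / 6 : ℝ)) / n

/-! ### The three escape probabilities -/

/-- `P_{μ_{A_M}}[τ_S < τ_M]` for the Glauber dynamics on the graph `G`, started from its Gibbs
measure conditioned on `A_M`. -/
def erEscape (p β h : ℝ) {n : ℕ} (G : SimpleGraph (Fin n)) : ℝ :=
  hitBefore (erHamiltonian G h) β ((gibbs (erHamiltonian G h) β)[|setM p β h n])
    (setS p β h n) (setM p β h n)

/-- `P_ξ[τ_S < τ_M]` for the Curie-Weiss dynamics with coupling strength `p / n` and field `h`,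
started from `ξ`, with `M` and `S` those of the field `h`. -/
def cwEscape (p β h : ℝ) {n : ℕ} (ξ : Config n) : ℝ :=
  hitBefore (cwHamiltonian p h) β (Measure.dirac ξ) (setS p β h n) (setM p β h n)

end

end ERGlauber

/-! Each escape probability is a capacity divided by a level weight, and capacities between levels
can be bounded through level weights alone. First moments over the graph then suffice, because a
field shift of order log n / n moves the answer by a power of n.

Harmonicity turns the probability of reaching the level S before returning to the level M into a
one-step average of the equilibrium potential over the starting law (`measure_hitTime_lt`,
`IsEquilibrium.hitBefore`). One spin flip changes either Hamiltonian by at most a constant, so the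
flip rates are bounded above and below. For the Gibbs measure conditioned on the level M, the
probability is therefore, up to constants, the capacity divided by n W_M, where W_k is the weight of
level k. The Dirichlet principle with functions of the volume gives the upper bound
`hitBefore_gibbs_le`. Cauchy-Schwarz against the flow that is uniform on every level gives the lower
bound `le_hitBefore_gibbs`, which involves the weights at inverse temperature -β. In the Curie-Weiss
model the two bounds match, the starting point in the level is irrelevant, and the probability is
comparable to the inverse of `escapeSum`, that is, of W_M ∑ 1 / W_k (`cw_hitBefore_bounds`).

By independence of the edges, the mean weight of a configuration, at β and at -β, is at most a
constant times its Curie-Weiss weight with the same field (`integral_exp_erHamiltonian_le`).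
Markov's inequality with a factor A, together with Cauchy-Schwarz to turn upper bounds into lower
ones, shows that outside an event of probability at most 4 / A the escape probability on the graph
agrees with 1 / `escapeSum` up to a constant times A ^ 2 (`measure_hitBefore_bounds`).

Raising the field by Δ multiplies W_M / W_k by exp(-2βΔ(k - M)). The terms of `escapeSum` that
matter have k - M of order n, so for Δ of order log n / n the sum shrinks by a factor n ^ (-δ) up to
constants, even though M and S move too (`escapeSum_le_of_field_le`). With A = n ^ (δ / 4) this gain
beats A ^ 2 while 4 / A tends to 0. Only δ > 0 matters: any positive multiple of log n / n would do.

The geometry rests on the drift J_n: it is strictly convex in the volume below n / 2, it sums to log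
W_k up to a bounded error, and the threshold χ is what makes its macroscopic limit negative
somewhere below 1 / 2. Its signs at a few macroscopic points locate M, T and S
(`exists_driftProfile`, `IsMetastable.location`). -/

namespace ERGlauber

/-! ### Hitting times read off from the jump chain. -/

section HittingTimes

variable {S : Type*}

lemma jumpTime_zero (ω : ℕ → S × ℝ) : jumpTime ω 0 = 0 := by simp [jumpTime]

lemma jumpTime_strictMono {ω : ℕ → S × ℝ} (hω : ∀ k, 0 < (ω (k + 1)).2) :
    StrictMono (jumpTime ω) :=
  strictMono_nat_of_lt_succ fun k => by simp [jumpTime, Finset.sum_range_succ, hω k]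

/-- Strict monotonicity of the jump times makes the set under the supremum an initial segment, so
the supremum is attained and is not a default value. -/
lemma stateAt_eq {ω : ℕ → S × ℝ} (hω : ∀ k, 0 < (ω (k + 1)).2) {k : ℕ} {t : ℝ≥0}
    (h1 : jumpTime ω k ≤ t) (h2 : (t : ℝ) < jumpTime ω (k + 1)) : stateAt ω t = (ω k).1 := by
  have hm := jumpTime_strictMono hω
  have hset : {j : ℕ | jumpTime ω j ≤ t} = Set.Iic k := by
    ext j
    simp only [Set.mem_ofPred_eq, Set.mem_Iic]
    constructor
    · intro hj
      exact Nat.lt_succ_iff.mp (hm.lt_iff_lt.mp (hj.trans_lt h2))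
    · intro hj
      exact (hm.monotone hj).trans h1
  rw [stateAt, hset, csSup_Iic]

lemma exists_jumpTime_interval {ω : ℕ → S × ℝ} {K : ℕ} {t : ℝ≥0}
    (h : (t : ℝ) < jumpTime ω (K + 1)) :
    ∃ j ≤ K, jumpTime ω j ≤ t ∧ (t : ℝ) < jumpTime ω (j + 1) := by
  induction K with
  | zero => exact ⟨0, le_rfl, by rw [jumpTime_zero]; exact t.2, h⟩
  | succ K ih =>
    by_cases hK : (t : ℝ) < jumpTime ω (K + 1)
    · obtain ⟨j, hj, h'⟩ := ih hK
      exact ⟨j, hj.trans (Nat.le_succ K), h'⟩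
    · exact ⟨K + 1, le_rfl, not_lt.mp hK, h⟩

variable [TopologicalSpace S] [DiscreteTopology S]

omit [DiscreteTopology S] in
lemma leftLim_stateAt_zero (ω : ℕ → S × ℝ) :
    Function.leftLim (stateAt ω) 0 = stateAt ω 0 :=
  leftLim_eq_of_isBot fun _ => zero_le

/-- The path is constant just to the left of `t`. Equality is allowed in `h2`, so that at a jump
time the left limit is the state before the jump. -/
lemma leftLim_stateAt {ω : ℕ → S × ℝ} (hω : ∀ k, 0 < (ω (k + 1)).2) {k : ℕ} {t : ℝ≥0}
    (h1 : jumpTime ω k < t) (h2 : (t : ℝ) ≤ jumpTime ω (k + 1)) :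
    Function.leftLim (stateAt ω) t = (ω k).1 := by
  have h0 : (0 : ℝ) ≤ jumpTime ω k := by
    rw [← jumpTime_zero ω]; exact (jumpTime_strictMono hω).monotone (Nat.zero_le k)
  have hlt : (⟨jumpTime ω k, h0⟩ : ℝ≥0) < t := by exact_mod_cast h1
  have : (𝓝[<] t).NeBot := nhdsLT_neBot_of_exists_lt ⟨_, hlt⟩
  apply leftLim_eq_of_tendsto
  refine Tendsto.congr' ?_ tendsto_const_nhds
  filter_upwards [Ioo_mem_nhdsLT hlt] with s hs
  refine (stateAt_eq hω (k := k) ?_ ?_).symm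
  · exact (show (⟨jumpTime ω k, h0⟩ : ℝ≥0) < s from hs.1).le
  · exact lt_of_lt_of_le (by exact_mod_cast hs.2) h2

/-- If a path enters `C` at its `K`-th jump and has not visited `D` after time `0`, then `C` is
hit before `D`. -/
lemma hitTime_lt_hitTime {ω : ℕ → S × ℝ} (hω : ∀ k, 0 < (ω (k + 1)).2) {C D : Set S} {K : ℕ}
    (hC : (ω (K + 1)).1 ∈ C) (hC' : (ω K).1 ∉ C)
    (hD : ∀ j ≤ K + 1, (ω j).1 ∈ D → j = 0) : hitTime C ω < hitTime D ω := by
  have hm := jumpTime_strictMono hω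
  have h0 : ∀ k, (0 : ℝ) ≤ jumpTime ω k := fun k => by
    rw [← jumpTime_zero ω]; exact hm.monotone (Nat.zero_le k)
  set T : ℝ≥0 := ⟨jumpTime ω (K + 1), h0 _⟩ with hT
  set T' : ℝ≥0 := ⟨jumpTime ω (K + 1 + 1), h0 _⟩ with hT'
  have hTT' : T < T' := hm (Nat.lt_succ_self _)
  have hle : hitTime C ω ≤ T := by
    apply sInf_le
    refine ⟨T, ⟨?_, ?_⟩, rfl⟩
    · rw [stateAt_eq hω (t := T) (k := K + 1) le_rfl (hm (Nat.lt_succ_self _))]; exact hC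
    · rw [leftLim_stateAt hω (t := T) (k := K) (hm (Nat.lt_succ_self _)) le_rfl]; exact hC'
  have hge : (T' : ℝ≥0∞) ≤ hitTime D ω := by
    apply le_sInf
    rintro _ ⟨t, ⟨ht1, ht2⟩, rfl⟩
    by_contra! hlt
    have hlt' : t < T' := by exact_mod_cast hlt
    obtain ⟨j, hjK, hj1, hj2⟩ := exists_jumpTime_interval (ω := ω) (K := K + 1) (t := t) hlt'
    have hst := stateAt_eq hω hj1 hj2
    -- A visit to `D` during the initial sojourn does not count as a hit: there the left limit is
    -- the initial state, which lies in `D` as well.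
    have hj0 : j = 0 := hD j hjK (hst ▸ ht1)
    subst hj0
    apply ht2
    rcases eq_or_lt_of_le (zero_le : 0 ≤ t) with h | h
    · rw [← h, leftLim_stateAt_zero, h]; exact ht1
    · rw [leftLim_stateAt hω (k := 0) (by rw [jumpTime_zero]; exact_mod_cast h) hj2.le, ← hst]
      exact ht1
  exact hle.trans_lt (lt_of_lt_of_le (by exact_mod_cast hTT') hge)

end HittingTimes

/-! ### The Markov property of the jump chain. -/

section OneStep

variable {S : Type*} [Fintype S] [MeasurableSpace S] [DiscreteMeasurableSpace S]

/-- The mean of `u` at the state reached by the next jump from `x`. -/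
noncomputable def jumpMean (r : S → S → ℝ≥0) (u : S → ℝ) (x : S) : ℝ :=
  ∑ y, ((r x y / exitRate r x : ℝ≥0) : ℝ) * u y

instance processLaw_isProbabilityMeasure (r : S → S → ℝ≥0) (ν : Measure S)
    [IsProbabilityMeasure ν] : IsProbabilityMeasure (processLaw r ν) := by
  unfold processLaw; infer_instance

lemma integral_jumpLaw {r : S → S → ℝ≥0} {x : S} (hx : exitRate r x ≠ 0) (u : S → ℝ) :
    ∫ y, u y ∂jumpLaw r x = jumpMean r u x := by
  rw [jumpLaw, if_neg hx, integral_finsetSum_measure (fun _ _ =>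
    (Integrable.of_finite (μ := Measure.dirac _)).smul_measure ENNReal.coe_ne_top)]
  refine Finset.sum_congr rfl fun y _ => ?_
  rw [integral_smul_measure, integral_dirac]
  simp

lemma ae_jumpLaw {r : S → S → ℝ≥0} {x : S} (hx : exitRate r x ≠ 0) :
    ∀ᵐ y ∂jumpLaw r x, r x y ≠ 0 := by
  rw [ae_iff, jumpLaw, if_neg hx]
  simp only [ne_eq, not_not, Measure.coe_finsetSum, Finset.sum_apply, Measure.smul_apply,
    smul_eq_mul]
  refine Finset.sum_eq_zero fun y _ => ?_
  by_cases h : r x y = 0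
  · simp [h]
  · rw [Measure.dirac_apply' _ (MeasurableSet.of_discrete)]
    simp [h]

omit [MeasurableSpace S] [DiscreteMeasurableSpace S] in
-- The exponential density vanishes on the negative half-line, and the point 0 is Lebesgue-null.
lemma ae_waitLaw (r : S → S → ℝ≥0) (x : S) : ∀ᵐ t ∂waitLaw r x, 0 < t := by
  have key : ∀ c : ℝ, 0 < c → ∀ᵐ t ∂expMeasure c, 0 < t := by
    intro c hc
    have hmeas : Measurable (gammaPDF 1 c) := (measurable_gammaPDFReal 1 c).ennreal_ofReal
    rw [expMeasure, gammaMeasure, ae_withDensity_iff hmeas]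
    have : ∀ᵐ t : ℝ, t ≠ 0 := by simp [ae_iff, measure_singleton]
    filter_upwards [this] with t ht hne
    by_contra hcon
    exact hne (gammaPDF_of_neg (lt_of_le_of_ne (not_lt.mp hcon) ht))
  unfold waitLaw
  split_ifs with h
  · exact key 1 one_pos
  · exact key _ (by exact_mod_cast pos_iff_ne_zero.mpr h)

/-- The joint law of the past and the next step is the composition product with the step kernel, so
a property that holds almost surely for one step from every state holds along the path. -/
lemma ae_processLaw_step (r : S → S → ℝ≥0) (ν : Measure S) [IsProbabilityMeasure ν] (k : ℕ)
    {E : Set (S × (S × ℝ))} (hE : MeasurableSet E)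
    (h : ∀ x, ∀ᵐ z ∂stepKernel r x, (x, z) ∈ E) :
    ∀ᵐ ω ∂processLaw r ν, ((ω k).1, ω (k + 1)) ∈ E := by
  have hmap := Kernel.map_frestrictLe_trajMeasure_compProd_eq_map_trajMeasure
    (X := fun _ => S × ℝ) (μ₀ := ν.prod (Measure.dirac (0 : ℝ))) (κ := pastKernel r) (a := k)
  have hf : Measurable fun q : (∀ _ : Finset.Iic k, S × ℝ) × (S × ℝ) =>
      ((q.1 ⟨k, Finset.mem_Iic.mpr le_rfl⟩).1, q.2) := by fun_prop
  have h1 : ∀ᵐ q ∂(processLaw r ν).map (fun ω => (Preorder.frestrictLe k ω, ω (k + 1))),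
      ((q.1 ⟨k, Finset.mem_Iic.mpr le_rfl⟩).1, q.2) ∈ E := by
    unfold processLaw
    rw [← hmap]
    refine Measure.ae_compProd_of_ae_ae (hf hE) ?_
    refine ae_of_all _ fun x => ?_
    exact h _
  exact ae_of_ae_map (f := fun ω => (Preorder.frestrictLe k ω, ω (k + 1))) (by fun_prop) h1

/-- The Markov property, tested against a bounded function `F` of the past. It is needed with `F`
the indicator of not having visited a set. -/
lemma integral_processLaw_step {r : S → S → ℝ≥0} (hr : ∀ x, exitRate r x ≠ 0) (ν : Measure S)
    [IsProbabilityMeasure ν] (k : ℕ) {F : (∀ _ : Finset.Iic k, S × ℝ) → ℝ} (hF : Measurable F)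
    {C : ℝ} (hC : ∀ x, ‖F x‖ ≤ C) (u : S → ℝ) :
    ∫ ω, F (Preorder.frestrictLe k ω) * u (ω (k + 1)).1 ∂processLaw r ν =
      ∫ ω, F (Preorder.frestrictLe k ω) * jumpMean r u (ω k).1 ∂processLaw r ν := by
  have hmap := Kernel.map_frestrictLe_trajMeasure_compProd_eq_map_trajMeasure
    (X := fun _ => S × ℝ) (μ₀ := ν.prod (Measure.dirac (0 : ℝ))) (κ := pastKernel r) (a := k)
  have hu : Measurable u := Measurable.of_discrete
  have hG : Measurable fun q : (∀ _ : Finset.Iic k, S × ℝ) × (S × ℝ) => F q.1 * u q.2.1 := by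
    fun_prop
  obtain ⟨D, hD⟩ : ∃ D, ∀ x, ‖u x‖ ≤ D := by
    obtain ⟨D, hD⟩ := (Set.finite_range fun x => ‖u x‖).bddAbove
    exact ⟨D, fun x => hD ⟨x, rfl⟩⟩
  have e1 : ∫ ω, F (Preorder.frestrictLe k ω) * u (ω (k + 1)).1 ∂processLaw r ν =
      ∫ q, F q.1 * u q.2.1
        ∂(processLaw r ν).map (fun ω => (Preorder.frestrictLe k ω, ω (k + 1))) := by
    rw [integral_map (by fun_prop) hG.aestronglyMeasurable]
  have e2 : ∫ ω, F (Preorder.frestrictLe k ω) * jumpMean r u (ω k).1 ∂processLaw r ν =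
      ∫ x, F x * jumpMean r u (x ⟨k, Finset.mem_Iic.mpr le_rfl⟩).1
        ∂(processLaw r ν).map (Preorder.frestrictLe k) := by
    have hj : Measurable (jumpMean r u) := Measurable.of_discrete
    rw [integral_map (by fun_prop) (Measurable.aestronglyMeasurable (by fun_prop))]
    rfl
  have : IsProbabilityMeasure
      ((processLaw r ν).map (Preorder.frestrictLe (π := fun _ => S × ℝ) k)) :=
    Measure.isProbabilityMeasure_map (by fun_prop)
  rw [e1, e2]
  unfold processLaw at this ⊢
  rw [← hmap, Measure.integral_compProd]
  · refine integral_congr_ae (ae_of_all _ fun x => ?_)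
    simp only
    rw [integral_const_mul]
    congr 1
    change ∫ z, u z.1 ∂((jumpLaw r _).prod (waitLaw r _)) = _
    rw [integral_fun_fst (fun y => u y), integral_jumpLaw (hr _)]
    simp
  · refine Integrable.of_bound hG.aestronglyMeasurable (C * D) (ae_of_all _ fun q => ?_)
    rw [norm_mul]
    exact mul_le_mul (hC _) (hD _) (norm_nonneg _) ((norm_nonneg _).trans (hC q.1))

end OneStep

end ERGlauber

namespace ERGlauber

/-! ### Superharmonic functions and the Dirichlet problem on a finite state space. -/

section MinimumPrinciple

variable {S : Type*} [Fintype S]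

/-- Minimum principle: a function that is superharmonic off `D`, from which `D` can be reached, is
nonnegative as soon as it is nonnegative on `D`. -/
lemma nonneg_of_superharmonic {r : S → S → ℝ≥0} {D : Set S} {d : S → ℕ}
    (hd : ∀ x ∉ D, ∃ y, r x y ≠ 0 ∧ d y < d x) {u : S → ℝ}
    (hu : ∀ x ∉ D, 0 ≤ ∑ y, (r x y : ℝ) * (u x - u y)) (hD : ∀ x ∈ D, 0 ≤ u x) (x : S) :
    0 ≤ u x := by
  obtain ⟨x₀, -, hx₀⟩ := Finset.exists_min_image Finset.univ u ⟨x, Finset.mem_univ x⟩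
  -- Among the minimisers of `u`, take one of least `d`. Off `D`, superharmonicity would force every
  -- neighbour to be a minimiser as well, including one with smaller `d`.
  obtain ⟨x₁, hx₁, hmin⟩ := Finset.exists_min_image (Finset.univ.filter fun z => u z = u x₀) d
    ⟨x₀, by simp⟩
  simp only [Finset.mem_filter, Finset.mem_univ, true_and] at hx₁ hmin
  have hle : ∀ y, u x₁ ≤ u y := fun y => hx₁ ▸ hx₀ y (Finset.mem_univ y)
  by_cases hxD : x₁ ∈ D
  · exact (hD x₁ hxD).trans (hle x)
  · exfalso
    obtain ⟨y, hy, hdy⟩ := hd x₁ hxD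
    have hterm : ∀ z ∈ Finset.univ, (r x₁ z : ℝ) * (u x₁ - u z) ≤ 0 := fun z _ =>
      mul_nonpos_of_nonneg_of_nonpos (r x₁ z).2 (sub_nonpos.mpr (hle z))
    have hsum : ∑ z, (r x₁ z : ℝ) * (u x₁ - u z) = 0 :=
      le_antisymm (Finset.sum_nonpos hterm) (hu x₁ hxD)
    have hz := (Finset.sum_eq_zero_iff_of_nonpos hterm).mp hsum y (Finset.mem_univ y)
    rcases mul_eq_zero.mp hz with h | h
    · exact hy (by exact_mod_cast h)
    · have := hmin y (by linarith)
      omega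

/-- Solvability of the Dirichlet problem. -/
lemma exists_dirichlet_solution {r : S → S → ℝ≥0} {D : Set S} {d : S → ℕ}
    (hd : ∀ x ∉ D, ∃ y, r x y ≠ 0 ∧ d y < d x) (f : S → ℝ) :
    ∃ u : S → ℝ, (∀ x ∈ D, u x = f x) ∧
      ∀ x ∉ D, ∑ y, (r x y : ℝ) * (u x - u y) = f x := by
  classical
  let Λ : (S → ℝ) →ₗ[ℝ] (S → ℝ) :=
    { toFun := fun u x => if x ∈ D then u x else ∑ y, (r x y : ℝ) * (u x - u y)
      map_add' := fun u v => by
        ext x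
        simp only [Pi.add_apply]
        split_ifs
        · rfl
        · rw [← Finset.sum_add_distrib]
          exact Finset.sum_congr rfl fun y _ => by ring
      map_smul' := fun c u => by
        ext x
        simp only [Pi.smul_apply, smul_eq_mul, RingHom.id_apply]
        split_ifs
        · rfl
        · rw [Finset.mul_sum]
          exact Finset.sum_congr rfl fun y _ => by ring }
  have hΛ : ∀ u x, Λ u x = if x ∈ D then u x else ∑ y, (r x y : ℝ) * (u x - u y) :=
    fun _ _ => rfl
  have hnonneg : ∀ u, Λ u = 0 → ∀ x, 0 ≤ u x := by
    intro u hu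
    refine nonneg_of_superharmonic hd (fun x hx => ?_) (fun x hx => ?_)
    · have := congrFun hu x
      rw [hΛ, if_neg hx] at this
      exact this.ge
    · have := congrFun hu x
      rw [hΛ, if_pos hx] at this
      exact this.ge
  -- Uniqueness gives existence in finite dimension; uniqueness is the minimum principle applied to
  -- `u` and to `-u`.
  have hinj : Function.Injective Λ := by
    rw [injective_iff_map_eq_zero]
    intro u hu
    ext x
    have h1 := hnonneg u hu x
    have h2 := hnonneg (-u) (by rw [map_neg, hu, neg_zero]) x
    simp only [Pi.neg_apply, Pi.zero_apply] at h2 ⊢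
    linarith
  obtain ⟨u, hu⟩ := (LinearMap.injective_iff_surjective.mp hinj) f
  refine ⟨u, fun x hx => ?_, fun x hx => ?_⟩
  · have := congrFun hu x
    rwa [hΛ, if_pos hx] at this
  · have := congrFun hu x
    rwa [hΛ, if_neg hx] at this

lemma jumpMean_eq {r : S → S → ℝ≥0} {x : S} (hx : exitRate r x ≠ 0) (u : S → ℝ) :
    jumpMean r u x = u x - (∑ y, (r x y : ℝ) * (u x - u y)) / exitRate r x := by
  have hx' : (exitRate r x : ℝ) ≠ 0 := by exact_mod_cast hx
  have hsum : ∑ y, (r x y : ℝ) = exitRate r x := by simp [exitRate]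
  simp only [mul_sub, Finset.sum_sub_distrib, ← Finset.sum_mul, hsum, jumpMean, NNReal.coe_div]
  rw [sub_div, mul_div_cancel_left₀ _ hx', sub_sub_cancel, Finset.sum_div]
  exact Finset.sum_congr rfl fun y _ => by ring

lemma jumpMean_eq_div {r : S → S → ℝ≥0} (x : S) (u : S → ℝ) :
    jumpMean r u x = (∑ y, (r x y : ℝ) * u y) / exitRate r x := by
  simp only [jumpMean, NNReal.coe_div, Finset.sum_div]
  exact Finset.sum_congr rfl fun y _ => by ring

end MinimumPrinciple

/-! ### Escape probabilities through harmonic functions. -/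

section HittingProbability

variable {S : Type*}

/-- The paths that do not visit `D` at their first `N` jumps. -/
def avoid (D : Set S) (N : ℕ) : Set (ℕ → S × ℝ) := {ω | ∀ j, 1 ≤ j → j ≤ N → (ω j).1 ∉ D}

lemma avoid_zero (D : Set S) : avoid D 0 = Set.univ := by
  ext ω
  simp only [avoid, Set.mem_ofPred_eq, Set.mem_univ, iff_true]
  omega

lemma avoid_succ (D : Set S) (N : ℕ) : avoid D (N + 1) = avoid D N ∩ {ω | (ω (N + 1)).1 ∉ D} := by
  ext ω
  simp only [avoid, Set.mem_ofPred_eq, Set.mem_inter_iff]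
  constructor
  · intro h
    exact ⟨fun j h1 h2 => h j h1 (by omega), h (N + 1) (by omega) le_rfl⟩
  · rintro ⟨h, h'⟩ j h1 h2
    rcases Nat.lt_or_ge N j with hj | hj
    · obtain rfl : j = N + 1 := by omega
      exact h'
    · exact h j h1 hj

variable [Fintype S] [MeasurableSpace S] [DiscreteMeasurableSpace S]

omit [Fintype S] [DiscreteMeasurableSpace S] in
lemma measurable_state (k : ℕ) : Measurable fun ω : ℕ → S × ℝ => (ω k).1 := by fun_prop

omit [Fintype S] in
lemma measurableSet_state (D : Set S) (k : ℕ) :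
    MeasurableSet {ω : ℕ → S × ℝ | (ω k).1 ∈ D} := by
  exact measurable_state k (MeasurableSet.of_discrete : MeasurableSet D)

omit [Fintype S] in
lemma measurableSet_avoid (D : Set S) (N : ℕ) : MeasurableSet (avoid D N) := by
  induction N with
  | zero => rw [avoid_zero]; exact MeasurableSet.univ
  | succ N ih => rw [avoid_succ]; exact ih.inter (measurableSet_state Dᶜ (N + 1))

lemma integrable_state (P : Measure (ℕ → S × ℝ)) [IsFiniteMeasure P] (u : S → ℝ) (k : ℕ) :
    Integrable (fun ω => u (ω k).1) P := by
  obtain ⟨C, hC⟩ := (Set.finite_range fun x => ‖u x‖).bddAbove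
  have hu : Measurable u := Measurable.of_discrete
  exact Integrable.of_bound (hu.comp (measurable_state k)).aestronglyMeasurable C (ae_of_all _ fun ω => hC ⟨_, rfl⟩)

variable {r : S → S → ℝ≥0} (hr : ∀ x, exitRate r x ≠ 0) (ν : Measure S) [IsProbabilityMeasure ν]

include hr

/-- The event `avoid D N` is determined by the first `N` jumps, so the Markov property applies on
it. -/
lemma setIntegral_avoid_step (D : Set S) (N : ℕ) (u : S → ℝ) :
    ∫ ω in avoid D N, u (ω (N + 1)).1 ∂processLaw r ν =
      ∫ ω in avoid D N, jumpMean r u (ω N).1 ∂processLaw r ν := by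
  classical
  set E : Set (∀ _ : Finset.Iic N, S × ℝ) :=
    ⋂ j : Finset.Iic N, {x | 1 ≤ j.1 → (x j).1 ∉ D} with hE
  have hEm : MeasurableSet E := by
    refine MeasurableSet.iInter fun j => ?_
    by_cases hj : 1 ≤ j.1
    · have hm : Measurable fun x : (∀ _ : Finset.Iic N, S × ℝ) => (x j).1 := by fun_prop
      simp only [hj, forall_const]
      exact hm (MeasurableSet.of_discrete : MeasurableSet Dᶜ)
    · simp [hj]
  have hpre : ∀ ω, Preorder.frestrictLe (π := fun _ => S × ℝ) N ω ∈ E ↔ ω ∈ avoid D N := by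
    intro ω
    simp only [hE, Set.mem_iInter, avoid, Set.mem_ofPred_eq]
    constructor
    · intro h j h1 h2
      exact h ⟨j, Finset.mem_Iic.mpr h2⟩ h1
    · rintro h ⟨j, hj⟩ h1
      exact h j h1 (Finset.mem_Iic.mp hj)
  have key := integral_processLaw_step hr ν N (F := E.indicator 1)
    (measurable_one.indicator hEm) (C := 1) (fun x => by
      by_cases hx : x ∈ E <;> simp [hx]) u
  have hind : ∀ v : (ℕ → S × ℝ) → ℝ, ∫ ω in avoid D N, v ω ∂processLaw r ν =
      ∫ ω, E.indicator 1 (Preorder.frestrictLe N ω) * v ω ∂processLaw r ν := by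
    intro v
    rw [← integral_indicator (measurableSet_avoid D N)]
    refine integral_congr_ae (ae_of_all _ fun ω => ?_)
    by_cases hω : ω ∈ avoid D N
    · simp [hω, (hpre ω).mpr hω]
    · have hω' := mt (hpre ω).mp hω
      simp [hω, hω']
  rw [hind, hind, key]

/-- Split according to whether the next state lies in `D`. If it does not, the equation for `u`
trades its value there for the mean after one more jump plus `f`. Iterating makes the integrals
telescope. -/
lemma setIntegral_avoid_succ (D : Set S) (N : ℕ) {u f : S → ℝ}
    (hu : ∀ x ∉ D, jumpMean r u x = u x - f x) :
    ∫ ω in avoid D N, u (ω (N + 1)).1 ∂processLaw r ν =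
      ∫ ω in avoid D N ∩ {ω | (ω (N + 1)).1 ∈ D}, u (ω (N + 1)).1 ∂processLaw r ν +
      ∫ ω in avoid D (N + 1), u (ω (N + 1 + 1)).1 ∂processLaw r ν +
      ∫ ω in avoid D (N + 1), f (ω (N + 1)).1 ∂processLaw r ν := by
  have hDm := measurableSet_state D (N + 1)
  rw [setIntegral_avoid_step hr ν D (N + 1), add_assoc, ← integral_add
    (integrable_state _ _ _).integrableOn (integrable_state _ _ _).integrableOn,
    ← integral_inter_add_sdiff hDm (integrable_state _ _ _).integrableOn]
  congr 1
  have hset : avoid D N \ {ω | (ω (N + 1)).1 ∈ D} = avoid D (N + 1) := by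
    rw [avoid_succ]; rfl
  rw [hset]
  refine setIntegral_congr_fun (measurableSet_avoid D (N + 1)) fun ω hω => ?_
  have := hu _ (hω (N + 1) (by omega) le_rfl)
  simp only [this]
  ring

lemma tendsto_avoid {D : Set S} {d : S → ℕ} (hd : ∀ x ∉ D, ∃ y, r x y ≠ 0 ∧ d y < d x) :
    Tendsto (fun N => (processLaw r ν).real (avoid D N)) atTop (𝓝 0) := by
  classical
  -- `T` plays the role of the expected number of jumps needed to reach `D`: off `D` it drops by 1
  -- on average at each jump. Telescoping makes the avoidance probabilities summable, hence they
  -- tend to 0.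
  obtain ⟨T, hT0, hT⟩ := exists_dirichlet_solution hd
    (fun x => if x ∈ D then 0 else (exitRate r x : ℝ))
  have hT0' : ∀ x ∈ D, T x = 0 := fun x hx => by rw [hT0 x hx, if_pos hx]
  have hTnn : ∀ x, 0 ≤ T x := by
    refine nonneg_of_superharmonic hd (fun x hx => ?_) (fun x hx => (hT0' x hx).ge)
    rw [hT x hx, if_neg hx]
    exact (exitRate r x).2
  have hstep : ∀ N, (processLaw r ν).real (avoid D (N + 1)) =
      (∫ ω in avoid D N, T (ω (N + 1)).1 ∂processLaw r ν) -
      ∫ ω in avoid D (N + 1), T (ω (N + 1 + 1)).1 ∂processLaw r ν := by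
    intro N
    have h := setIntegral_avoid_succ hr ν D N (u := T) (f := fun _ => 1) (fun x hx => by
      have : (exitRate r x : ℝ) ≠ 0 := by exact_mod_cast hr x
      rw [jumpMean_eq (hr x), hT x hx, if_neg hx, div_self this])
    rw [setIntegral_congr_fun (g := fun _ => (0 : ℝ))
      ((measurableSet_avoid D N).inter (measurableSet_state D (N + 1)))
      (fun ω hω => hT0' _ hω.2)] at h
    simp only [integral_zero, zero_add, integral_const, smul_eq_mul, mul_one,
      measureReal_restrict_apply_univ] at h
    linarith
  have hsum : Summable fun N => (processLaw r ν).real (avoid D (N + 1)) := by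
    refine summable_of_sum_range_le (c := ∫ ω in avoid D 0, T (ω (0 + 1)).1 ∂processLaw r ν)
      (fun _ => measureReal_nonneg) fun N => ?_
    have htel : ∑ i ∈ Finset.range N, (processLaw r ν).real (avoid D (i + 1)) =
        (∫ ω in avoid D 0, T (ω (0 + 1)).1 ∂processLaw r ν) -
        ∫ ω in avoid D N, T (ω (N + 1)).1 ∂processLaw r ν := by
      rw [Finset.sum_congr rfl fun i _ => hstep i]
      exact Finset.sum_range_sub' (fun i => ∫ ω in avoid D i, T (ω (i + 1)).1 ∂processLaw r ν) N
    rw [htel]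
    have : 0 ≤ ∫ ω in avoid D N, T (ω (N + 1)).1 ∂processLaw r ν :=
      setIntegral_nonneg (measurableSet_avoid D N) fun ω _ => hTnn _
    linarith
  exact (tendsto_add_atTop_iff_nat 1).mp hsum.tendsto_atTop_zero

/-- The probability that `B` is hit before the chain, started in `A`, returns to `A`. -/
theorem measure_hitTime_lt [TopologicalSpace S] [DiscreteTopology S] {A B : Set S}
    (hAB : Disjoint A B) (hν : ∀ᵐ x ∂ν, x ∈ A) (hA : ∀ x ∈ A, ∀ y ∈ A, r x y = 0) {d : S → ℕ}
    (hd : ∀ x ∉ A ∪ B, ∃ y, r x y ≠ 0 ∧ d y < d x) {g : S → ℝ} (hgA : ∀ x ∈ A, g x = 0)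
    (hgB : ∀ x ∈ B, g x = 1) (hg : ∀ x ∉ A ∪ B, ∑ y, (r x y : ℝ) * (g x - g y) = 0) :
    (processLaw r ν).real {ω | hitTime B ω < hitTime A ω} = ∫ x, jumpMean r g x ∂ν := by
  classical
  set P := processLaw r ν with hP
  set D := A ∪ B with hD
  -- Decomposition by the jump at which the path first visits `D` after time 0, when this visit is
  -- to `B`.
  let E : ℕ → Set (ℕ → S × ℝ) := fun N => avoid D N ∩ {ω | (ω (N + 1)).1 ∈ B}
  have hEm : ∀ N, MeasurableSet (E N) := fun N =>
    (measurableSet_avoid D N).inter (measurableSet_state B (N + 1))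
  have hEd : Pairwise (Function.onFun Disjoint E) := by
    have key : ∀ i j, i < j → Disjoint (E i) (E j) := by
      intro i j hij
      rw [Set.disjoint_left]
      rintro ω ⟨-, h2⟩ ⟨h3, -⟩
      exact h3 (i + 1) (by omega) (by omega) (Or.inr h2)
    intro i j hij
    rcases lt_or_gt_of_ne hij with h | h
    · exact key i j h
    · exact (key j i h).symm
  -- almost sure properties of the path
  have hw : ∀ᵐ ω ∂P, ∀ k, 0 < (ω (k + 1)).2 := by
    rw [ae_all_iff]
    intro k
    refine ae_processLaw_step r ν k (E := {z | 0 < z.2.2})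
      (measurableSet_lt measurable_const (by fun_prop)) fun x => ?_
    exact Measure.quasiMeasurePreserving_snd.ae (ae_waitLaw r x)
  have hj : ∀ᵐ ω ∂P, r (ω 0).1 (ω 1).1 ≠ 0 := by
    have hm : Measurable fun z : S × (S × ℝ) => (z.1, z.2.1) := by fun_prop
    refine ae_processLaw_step r ν 0 (E := {z | r z.1 z.2.1 ≠ 0})
      (hm (MeasurableSet.of_discrete : MeasurableSet {z : S × S | r z.1 z.2 ≠ 0})) fun x => ?_
    exact Measure.quasiMeasurePreserving_fst.ae (ae_jumpLaw (hr x))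
  have hzero : P.map (fun ω => (ω 0).1) = ν := by
    have h := Kernel.traj_map_frestrictLe (X := fun _ => S × ℝ) (κ := pastKernel r) 0 0
    rw [Kernel.partialTraj_self] at h
    have hfun : (fun ω : ℕ → S × ℝ => (ω 0).1) =
        (fun x : (∀ _ : Finset.Iic 0, S × ℝ) => (x ⟨0, Finset.mem_Iic.mpr le_rfl⟩).1) ∘
          Preorder.frestrictLe 0 := rfl
    have hmr : Measurable (Preorder.frestrictLe (π := fun _ => S × ℝ) 0) := by fun_prop
    rw [hfun, ← Measure.map_map (by fun_prop) hmr, hP, processLaw, Kernel.trajMeasure,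
      Measure.map_comp _ _ hmr, h, Measure.id_comp,
      Measure.map_map (by fun_prop) (by fun_prop)]
    change ((ν.prod (Measure.dirac (0 : ℝ))).map Prod.fst) = ν
    rw [Measure.map_fst_prod]
    simp
  have h0 : ∀ᵐ ω ∂P, (ω 0).1 ∈ A := by
    rw [← hzero] at hν
    exact ae_of_ae_map (measurable_state 0).aemeasurable hν
  have hev : ∀ᵐ ω ∂P, ∃ N, ω ∉ avoid D N := by
    have hinter : P.real (⋂ N, avoid D N) = 0 := by
      refine le_antisymm (ge_of_tendsto' (tendsto_avoid hr ν hd) fun N => ?_) measureReal_nonneg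
      exact measureReal_mono (Set.iInter_subset _ N)
    rw [measureReal_eq_zero_iff] at hinter
    rw [ae_iff]
    convert hinter using 2
    ext ω
    simp
  have hEq : {ω | hitTime B ω < hitTime A ω} =ᵐ[P] ⋃ N, E N := by
    filter_upwards [hw, hj, h0, hev] with ω hω hω1 hω0 hωN
    have hfind := Nat.find_spec hωN
    have hmin := fun m => Nat.find_min hωN (m := m)
    obtain ⟨K, hK⟩ : ∃ K, Nat.find hωN = K + 1 := by
      refine Nat.exists_eq_succ_of_ne_zero fun h => ?_
      rw [h, avoid_zero] at hfind
      exact hfind (Set.mem_univ _)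
    rw [hK] at hfind
    have hKa : ω ∈ avoid D K := not_not.mp (hmin K (by omega))
    have hKD : (ω (K + 1)).1 ∈ D := by
      by_contra hcon
      exact hfind (by rw [avoid_succ]; exact ⟨hKa, hcon⟩)
    have hpast : ∀ j ≤ K, (ω j).1 ∈ D → j = 0 := by
      intro j hj hjD
      by_contra hj0
      exact hKa j (by omega) hj hjD
    have h0B : (ω 0).1 ∉ B := Set.disjoint_left.mp hAB hω0
    apply propext
    change hitTime B ω < hitTime A ω ↔ ω ∈ ⋃ N, E N
    rw [Set.mem_iUnion]
    by_cases hKB : (ω (K + 1)).1 ∈ B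
    · refine ⟨fun _ => ⟨K, hKa, hKB⟩, fun _ => hitTime_lt_hitTime hω hKB ?_ ?_⟩
      · intro hB
        have := hpast K le_rfl (Or.inr hB)
        rw [this] at hB
        exact h0B hB
      · intro j hj hjA
        rcases Nat.lt_or_ge K j with h | h
        · obtain rfl : j = K + 1 := by omega
          exact absurd hKB (Set.disjoint_left.mp hAB hjA)
        · exact hpast j h (Or.inl hjA)
    · have hKA : (ω (K + 1)).1 ∈ A := hKD.resolve_right hKB
      have hlt : hitTime A ω < hitTime B ω := by
        refine hitTime_lt_hitTime hω hKA ?_ ?_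
        -- The hitting time requires the left limit to be outside `A`. This could fail only if the
        -- very first jump stayed in `A`, and such a jump has rate zero.
        · intro hAK
          have := hpast K le_rfl (Or.inl hAK)
          subst this
          exact hω1 (hA _ hω0 _ hKA)
        · intro j hj hjB
          rcases Nat.lt_or_ge K j with h | h
          · obtain rfl : j = K + 1 := by omega
            exact absurd hjB hKB
          · exact hpast j h (Or.inr hjB)
      refine ⟨fun h => absurd h hlt.le.not_gt, ?_⟩
      rintro ⟨N, hN1, hN2⟩
      exfalso
      rcases lt_trichotomy N K with h | h | h
      · have := hpast (N + 1) (by omega) (Or.inr hN2)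
        omega
      · rw [h] at hN2
        exact hKB hN2
      · exact hN1 (K + 1) (by omega) (by omega) hKD
  have hsumE : HasSum (fun N => P.real (E N)) (P.real (⋃ N, E N)) := by
    have hU := measure_iUnion (μ := P) hEd hEm
    rw [measureReal_def, hU, ENNReal.tsum_toReal_eq fun N => measure_ne_top P (E N)]
    exact (ENNReal.summable_toReal (hU ▸ measure_ne_top P _)).hasSum
  -- Since `g` is harmonic off `D`, equal to 1 on `B` and to 0 on `A`, the mass that `g` loses at a
  -- step is the probability of entering `B` at that step.
  have hstep : ∀ N, P.real (E N) = (∫ ω in avoid D N, g (ω (N + 1)).1 ∂P) -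
      ∫ ω in avoid D (N + 1), g (ω (N + 1 + 1)).1 ∂P := by
    intro N
    have h := setIntegral_avoid_succ hr ν D N (u := g) (f := fun _ => 0) (fun x hx => by
      rw [jumpMean_eq (hr x), hg x hx, zero_div])
    have h1 : ∫ ω in avoid D N ∩ {ω | (ω (N + 1)).1 ∈ D}, g (ω (N + 1)).1 ∂P = P.real (E N) := by
      rw [setIntegral_congr_fun (g := {ω : ℕ → S × ℝ | (ω (N + 1)).1 ∈ B}.indicator 1)
        ((measurableSet_avoid D N).inter (measurableSet_state D (N + 1)))]
      · rw [setIntegral_indicator (measurableSet_state B (N + 1))]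
        have : avoid D N ∩ {ω : ℕ → S × ℝ | (ω (N + 1)).1 ∈ D} ∩ {ω | (ω (N + 1)).1 ∈ B} = E N := by
          ext ω
          constructor
          · rintro ⟨⟨h1, -⟩, h3⟩
            exact ⟨h1, h3⟩
          · rintro ⟨h1, h3⟩
            exact ⟨⟨h1, Or.inr h3⟩, h3⟩
        rw [this]
        simp
      · intro ω hω
        by_cases hB : (ω (N + 1)).1 ∈ B
        · simp [hB, hgB _ hB]
        · simp [hB, hgA _ (hω.2.resolve_right hB)]
    rw [← hP, h1] at h
    simp only [integral_zero, add_zero] at h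
    linarith
  have hlim : Tendsto (fun N => ∫ ω in avoid D N, g (ω (N + 1)).1 ∂P) atTop (𝓝 0) := by
    obtain ⟨C, hC⟩ := (Set.finite_range fun x => ‖g x‖).bddAbove
    refine squeeze_zero_norm (a := fun N => C * P.real (avoid D N)) (fun N => ?_) ?_
    · exact norm_setIntegral_le_of_norm_le_const (measure_lt_top _ _) fun ω _ => hC ⟨_, rfl⟩
    · simpa using (tendsto_avoid hr ν hd).const_mul C
  have htel : Tendsto (fun N => ∑ i ∈ Finset.range N, P.real (E i)) atTop
      (𝓝 ((∫ ω in avoid D 0, g (ω (0 + 1)).1 ∂P) - 0)) := by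
    have : ∀ N, ∑ i ∈ Finset.range N, P.real (E i) = (∫ ω in avoid D 0, g (ω (0 + 1)).1 ∂P) -
        ∫ ω in avoid D N, g (ω (N + 1)).1 ∂P := by
      intro N
      rw [Finset.sum_congr rfl fun i _ => hstep i]
      exact Finset.sum_range_sub' (fun i => ∫ ω in avoid D i, g (ω (i + 1)).1 ∂P) N
    simp only [this]
    exact hlim.const_sub _
  rw [measureReal_congr hEq, tendsto_nhds_unique hsumE.tendsto_sum_nat htel, sub_zero,
    setIntegral_avoid_step hr ν D 0, avoid_zero, Measure.restrict_univ, ← hP]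
  conv_rhs => rw [← hzero]
  rw [integral_map (measurable_state 0).aemeasurable (Measurable.of_discrete.aestronglyMeasurable)]

end HittingProbability

end ERGlauber

namespace ERGlauber

/-! ### Spin flips and levels of the hypercube. -/

section Flips

variable {n : ℕ}

/-- The configuration with the spin at `v` flipped. -/
def flip (σ : Config n) (v : Fin n) : Config n := Function.update σ v (-σ v)

lemma flip_flip (σ : Config n) (v : Fin n) : flip (flip σ v) v = σ := by
  simp [flip]

lemma flip_same (σ : Config n) (v : Fin n) : flip σ v v = -σ v := by simp [flip]

lemma flip_involutive (v : Fin n) : Function.Involutive fun σ : Config n => flip σ v :=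
  fun σ => flip_flip σ v

lemma neg_spin_ne (u : ℤˣ) : -u ≠ u := by
  rcases Int.units_eq_one_or u with h | h <;> subst h <;> decide

lemma flip_injective (σ : Config n) : Function.Injective (flip σ) := by
  intro v w h
  by_contra hvw
  have h1 := congrFun h v
  rw [flip_same, flip, Function.update_of_ne hvw] at h1
  exact neg_spin_ne _ h1

lemma hammingDist_eq_one_iff {σ τ : Config n} : hammingDist σ τ = 1 ↔ ∃ v, τ = flip σ v := by
  constructor
  · intro h
    obtain ⟨v, hv⟩ := Finset.card_eq_one.mp h
    refine ⟨v, funext fun w => ?_⟩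
    have hw : σ w ≠ τ w ↔ w = v := by
      rw [← Finset.mem_singleton, ← hv]; simp
    by_cases hwv : w = v
    · subst hwv
      rw [flip_same]
      have := hw.mpr rfl
      rcases Int.units_eq_one_or (σ w) with h1 | h1 <;>
        rcases Int.units_eq_one_or (τ w) with h2 | h2 <;> simp_all
    · rw [flip, Function.update_of_ne hwv]
      by_contra hne
      exact hwv (hw.mp (Ne.symm hne))
  · rintro ⟨v, rfl⟩
    refine Finset.card_eq_one.mpr ⟨v, ?_⟩
    ext w
    simp only [Finset.mem_filter, Finset.mem_univ, true_and, Finset.mem_singleton]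
    by_cases hwv : w = v
    · subst hwv
      simp [flip_same, (neg_spin_ne (σ w)).symm]
    · simp [flip, hwv]

lemma hammingDist_flip_lt {σ τ : Config n} {v : Fin n} (hv : σ v ≠ τ v) :
    hammingDist (flip σ v) τ < hammingDist σ τ := by
  apply Finset.card_lt_card
  rw [Finset.ssubset_iff_of_subset]
  · refine ⟨v, by simpa using hv, ?_⟩
    simp only [Finset.mem_filter, Finset.mem_univ, true_and, not_not, flip_same]
    rcases Int.units_eq_one_or (σ v) with h1 | h1 <;>
      rcases Int.units_eq_one_or (τ v) with h2 | h2 <;> simp_all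
  · intro w
    simp only [Finset.mem_filter, Finset.mem_univ, true_and]
    by_cases hwv : w = v
    · subst hwv; exact fun _ => hv
    · rw [flip, Function.update_of_ne hwv]; exact id

/-- The vertices with spin `-1`. -/
def minusSet (σ : Config n) : Finset (Fin n) := Finset.univ.filter fun v => σ v = -1

/-- The vertices with spin `+1`. -/
def plusSet (σ : Config n) : Finset (Fin n) := Finset.univ.filter fun v => σ v = 1

lemma mem_minusSet {σ : Config n} {v : Fin n} : v ∈ minusSet σ ↔ σ v = -1 := by simp [minusSet]

lemma mem_plusSet {σ : Config n} {v : Fin n} : v ∈ plusSet σ ↔ σ v = 1 := by simp [plusSet]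

lemma card_plusSet (σ : Config n) : (plusSet σ).card = vol σ := rfl

lemma plusSet_compl (σ : Config n) : (plusSet σ)ᶜ = minusSet σ := by
  ext v
  rw [Finset.mem_compl, mem_plusSet, mem_minusSet]
  rcases Int.units_eq_one_or (σ v) with h | h <;> simp [h]

lemma vol_le (σ : Config n) : vol σ ≤ n := by
  simpa [card_plusSet] using (plusSet σ).card_le_univ

lemma card_minusSet (σ : Config n) : (minusSet σ).card = n - vol σ := by
  rw [← plusSet_compl, Finset.card_compl, card_plusSet, Fintype.card_fin]

lemma card_minusSet_real (σ : Config n) : ((minusSet σ).card : ℝ) = n - vol σ := by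
  rw [card_minusSet, Nat.cast_sub (vol_le σ)]

lemma vol_flip_of_minus {σ : Config n} {v : Fin n} (h : σ v = -1) :
    vol (flip σ v) = vol σ + 1 := by
  have : plusSet (flip σ v) = insert v (plusSet σ) := by
    ext w
    rw [Finset.mem_insert, mem_plusSet, mem_plusSet]
    by_cases hwv : w = v
    · subst hwv; simp [flip_same, h]
    · simp [flip, hwv]
  rw [← card_plusSet, this, Finset.card_insert_of_notMem (by simp [mem_plusSet, h]), card_plusSet]

lemma vol_flip_of_plus {σ : Config n} {v : Fin n} (h : σ v = 1) :
    vol σ = vol (flip σ v) + 1 := by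
  rw [← vol_flip_of_minus (σ := flip σ v) (v := v) (by rw [flip_same, h]), flip_flip]

lemma vol_flip_ne (σ : Config n) (v : Fin n) : vol (flip σ v) ≠ vol σ := by
  rcases Int.units_eq_one_or (σ v) with h | h
  · have := vol_flip_of_plus h; omega
  · have := vol_flip_of_minus h; omega

/-- The configurations of volume `k`, as a finite set. -/
def levelFinset (n k : ℕ) : Finset (Config n) := Finset.univ.filter fun σ => vol σ = k

lemma mem_levelFinset {k : ℕ} {σ : Config n} : σ ∈ levelFinset n k ↔ vol σ = k := by
  simp [levelFinset]

lemma mem_level {k : ℕ} {σ : Config n} : σ ∈ level n k ↔ vol σ = k := by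
  simp [level]

lemma sum_vertices (σ : Config n) (f : Fin n → ℝ) :
    ∑ v, f v = ∑ v ∈ minusSet σ, f v + ∑ v ∈ plusSet σ, f v := by
  rw [← plusSet_compl, Finset.sum_compl_add_sum]

/-- Reversing the edges of the hypercube. -/
lemma sum_plusSet_eq (F : Config n → Fin n → ℝ) :
    ∑ σ, ∑ v ∈ plusSet σ, F σ v = ∑ σ, ∑ v ∈ minusSet σ, F (flip σ v) v := by
  simp only [plusSet, minusSet, Finset.sum_filter]
  rw [Finset.sum_comm]
  conv_rhs => rw [Finset.sum_comm]
  refine Finset.sum_congr rfl fun v _ => ?_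
  refine Fintype.sum_equiv (flip_involutive v).toPerm _ _ fun σ => ?_
  change (if σ v = 1 then F σ v else 0) =
    if flip σ v v = -1 then F (flip (flip σ v) v) v else 0
  simp only [flip_flip, flip_same, neg_inj]

lemma sum_level (G : Config n → ℝ) (F : ℕ → ℝ) :
    ∑ σ, F (vol σ) * G σ = ∑ k ∈ Finset.range (n + 1), F k * ∑ σ ∈ levelFinset n k, G σ := by
  rw [← Finset.sum_fiberwise_of_maps_to (g := fun σ : Config n => vol σ)
    (t := Finset.range (n + 1)) (fun σ _ => Finset.mem_range.mpr (Nat.lt_succ_of_le (vol_le σ)))]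
  refine Finset.sum_congr rfl fun k _ => ?_
  rw [Finset.mul_sum]
  refine Finset.sum_congr rfl fun σ hσ => ?_
  rw [(Finset.mem_filter.mp hσ).2]

/-- Double counting of the edges between two consecutive levels: a configuration of volume k + 1 has
k + 1 neighbours below it. -/
lemma sum_level_flip (g : Config n → ℝ) (k : ℕ) :
    ∑ σ ∈ levelFinset n k, ∑ v ∈ minusSet σ, g (flip σ v) =
      (k + 1) * ∑ σ ∈ levelFinset n (k + 1), g σ := by
  have h := sum_plusSet_eq (n := n) fun σ _ => if vol σ = k + 1 then g σ else 0
  have h1 : ∀ σ : Config n, (∑ v ∈ plusSet σ, if vol σ = k + 1 then g σ else 0) =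
      if vol σ = k + 1 then ((k : ℝ) + 1) * g σ else 0 := by
    intro σ
    rw [Finset.sum_const, card_plusSet]
    split_ifs with hσ
    · rw [hσ]; simp
    · simp
  have h2 : ∀ σ : Config n, (∑ v ∈ minusSet σ, if vol (flip σ v) = k + 1 then g (flip σ v) else 0) =
      if vol σ = k then ∑ v ∈ minusSet σ, g (flip σ v) else 0 := by
    intro σ
    split_ifs with hσ
    · refine Finset.sum_congr rfl fun v hv => ?_
      rw [if_pos]
      rw [vol_flip_of_minus (mem_minusSet.mp hv), hσ]
    · refine Finset.sum_eq_zero fun v hv => ?_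
      rw [if_neg]
      rw [vol_flip_of_minus (mem_minusSet.mp hv)]
      omega
  simp only [h1, h2] at h
  rw [Finset.mul_sum, levelFinset, levelFinset, Finset.sum_filter, Finset.sum_filter, h]

/-- Double counting of edges yields the recursion for binomial coefficients. -/
lemma card_levelFinset (n k : ℕ) : (levelFinset n k).card = n.choose k := by
  induction k with
  | zero =>
    rw [Nat.choose_zero_right, Finset.card_eq_one]
    refine ⟨fun _ => -1, ?_⟩
    ext σ
    rw [mem_levelFinset, Finset.mem_singleton, ← card_plusSet, Finset.card_eq_zero,
      ← Finset.compl_eq_univ_iff, plusSet_compl]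
    constructor
    · intro h
      funext v
      exact mem_minusSet.mp (h ▸ Finset.mem_univ v)
    · rintro rfl
      ext v
      simp [minusSet]
  | succ k ih =>
    have h := sum_level_flip (n := n) (fun _ => 1) k
    have h1 : ∀ σ ∈ levelFinset n k, ∑ v ∈ minusSet σ, (1 : ℝ) = ((n - k : ℕ) : ℝ) := by
      intro σ hσ
      rw [Finset.sum_const, card_minusSet, mem_levelFinset.mp hσ, nsmul_eq_mul, mul_one]
    rw [Finset.sum_congr rfl h1, Finset.sum_const, Finset.sum_const, ih, nsmul_eq_mul,
      nsmul_eq_mul, mul_one] at h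
    have h' : n.choose k * (n - k) = (k + 1) * (levelFinset n (k + 1)).card := by exact_mod_cast h
    rw [← Nat.choose_succ_right_eq] at h'
    exact (Nat.eq_of_mul_eq_mul_left (Nat.succ_pos k) (by rw [← h', mul_comm])).symm

end Flips

/-! ### Conductances, the Dirichlet form and the equilibrium potential. -/

section Dirichlet

variable {n : ℕ}

/-- The rate at which the spin at `v` flips. -/
noncomputable def flipRate (H : Config n → ℝ) (β : ℝ) (σ : Config n) (v : Fin n) : ℝ :=
  Real.exp (-β * max (H (flip σ v) - H σ) 0)

lemma flipRate_pos (H : Config n → ℝ) (β : ℝ) (σ : Config n) (v : Fin n) :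
    0 < flipRate H β σ v := Real.exp_pos _

lemma glauberRate_flip (H : Config n → ℝ) (β : ℝ) (σ : Config n) (v : Fin n) :
    (glauberRate H β σ (flip σ v) : ℝ) = flipRate H β σ v := by
  rw [glauberRate, if_pos (hammingDist_eq_one_iff.mpr ⟨v, rfl⟩),
    Real.coe_toNNReal _ (Real.exp_pos _).le, flipRate]

lemma sum_glauberRate (H : Config n → ℝ) (β : ℝ) (σ : Config n) (F : Config n → ℝ) :
    ∑ τ, (glauberRate H β σ τ : ℝ) * F τ = ∑ v, flipRate H β σ v * F (flip σ v) := by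
  have h : ∑ τ ∈ Finset.univ.map ⟨flip σ, flip_injective σ⟩, (glauberRate H β σ τ : ℝ) * F τ =
      ∑ τ, (glauberRate H β σ τ : ℝ) * F τ := by
    refine Finset.sum_subset (Finset.subset_univ _) fun τ _ hτ => ?_
    rw [glauberRate, if_neg]
    · simp
    · rw [hammingDist_eq_one_iff]
      rintro ⟨v, rfl⟩
      exact hτ (Finset.mem_map_of_mem _ (Finset.mem_univ v))
  rw [← h, Finset.sum_map]
  exact Finset.sum_congr rfl fun v _ => by rw [← glauberRate_flip]; rfl

lemma exitRate_glauberRate (H : Config n → ℝ) (β : ℝ) (σ : Config n) :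
    (exitRate (glauberRate H β) σ : ℝ) = ∑ v, flipRate H β σ v := by
  have := sum_glauberRate H β σ fun _ => 1
  simp only [mul_one] at this
  rw [← this]
  simp [exitRate]

/-- The conductance of the edge between `σ` and `flip σ v`. -/
noncomputable def conductance (H : Config n → ℝ) (β : ℝ) (σ : Config n) (v : Fin n) : ℝ :=
  Real.exp (-β * H σ) * flipRate H β σ v

lemma conductance_eq (H : Config n → ℝ) (β : ℝ) (σ : Config n) (v : Fin n) :
    conductance H β σ v = Real.exp (-β * max (H (flip σ v)) (H σ)) := by
  rw [conductance, flipRate, ← Real.exp_add, ← mul_add]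
  congr 2
  rw [← max_add_add_left]
  simp

lemma conductance_pos (H : Config n → ℝ) (β : ℝ) (σ : Config n) (v : Fin n) :
    0 < conductance H β σ v := by rw [conductance_eq]; exact Real.exp_pos _

lemma conductance_flip (H : Config n → ℝ) (β : ℝ) (σ : Config n) (v : Fin n) :
    conductance H β (flip σ v) v = conductance H β σ v := by
  rw [conductance_eq, conductance_eq, flip_flip, max_comm]

/-- The Dirichlet form. -/
noncomputable def dirichletForm (H : Config n → ℝ) (β : ℝ) (g φ : Config n → ℝ) : ℝ :=
  ∑ σ, ∑ v ∈ minusSet σ, conductance H β σ v * ((g (flip σ v) - g σ) * (φ (flip σ v) - φ σ))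

/-- Summation by parts. Each edge is indexed by its lower endpoint, and reversibility, in the form
`conductance_flip`, merges the contributions of its two ends. -/
lemma dirichletForm_eq (H : Config n → ℝ) (β : ℝ) (g φ : Config n → ℝ) :
    ∑ σ, φ σ * (Real.exp (-β * H σ) * ∑ v, flipRate H β σ v * (g σ - g (flip σ v))) =
      dirichletForm H β g φ := by
  have h1 : ∀ σ, φ σ * (Real.exp (-β * H σ) * ∑ v, flipRate H β σ v * (g σ - g (flip σ v))) =
      ∑ v, conductance H β σ v * (φ σ * (g σ - g (flip σ v))) := by
    intro σ
    rw [Finset.mul_sum, Finset.mul_sum]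
    exact Finset.sum_congr rfl fun v _ => by rw [conductance]; ring
  simp only [h1]
  rw [Finset.sum_congr rfl fun σ _ => sum_vertices σ _, Finset.sum_add_distrib, sum_plusSet_eq,
    ← Finset.sum_add_distrib, dirichletForm]
  refine Finset.sum_congr rfl fun σ _ => ?_
  rw [← Finset.sum_add_distrib]
  refine Finset.sum_congr rfl fun v _ => ?_
  rw [conductance_flip, flip_flip]
  ring

/-- The equilibrium potential of the levels `S` and `M`. -/
structure IsEquilibrium (H : Config n → ℝ) (β : ℝ) (M S : ℕ) (g : Config n → ℝ) : Prop where
  eq_zero : ∀ σ, vol σ = M → g σ = 0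
  eq_one : ∀ σ, vol σ = S → g σ = 1
  harmonic : ∀ σ, vol σ ≠ M → vol σ ≠ S → ∑ v, flipRate H β σ v * (g σ - g (flip σ v)) = 0

lemma exists_vol_eq {k : ℕ} (hk : k ≤ n) : ∃ σ : Config n, vol σ = k := by
  have : (levelFinset n k).Nonempty := by
    rw [← Finset.card_pos, card_levelFinset]
    exact Nat.choose_pos hk
  obtain ⟨σ, hσ⟩ := this
  exact ⟨σ, mem_levelFinset.mp hσ⟩

/-- All flip rates are positive, so the Hamming distance to any fixed point of `D` can serve as the
decreasing function `d` of the minimum principle. -/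
lemma exists_flip_closer (H : Config n → ℝ) (β : ℝ) {D : Set (Config n)} {a : Config n}
    (ha : a ∈ D) (σ : Config n) (hσ : σ ∉ D) :
    ∃ τ, glauberRate H β σ τ ≠ 0 ∧ hammingDist τ a < hammingDist σ a := by
  have hne : σ ≠ a := fun h => hσ (h ▸ ha)
  obtain ⟨v, hv⟩ := Function.ne_iff.mp hne
  refine ⟨flip σ v, fun h => ?_, hammingDist_flip_lt hv⟩
  have := glauberRate_flip H β σ v
  rw [h] at this
  exact (flipRate_pos H β σ v).ne this

lemma sum_glauberRate_sub (H : Config n → ℝ) (β : ℝ) (σ : Config n) (g : Config n → ℝ) :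
    ∑ τ, (glauberRate H β σ τ : ℝ) * (g σ - g τ) =
      ∑ v, flipRate H β σ v * (g σ - g (flip σ v)) :=
  sum_glauberRate H β σ fun τ => g σ - g τ

lemma not_mem_levels {M S : ℕ} {σ : Config n} :
    σ ∉ level n M ∪ level n S ↔ vol σ ≠ M ∧ vol σ ≠ S := by
  rw [Set.mem_union, mem_level, mem_level, not_or]

lemma exists_isEquilibrium (H : Config n → ℝ) (β : ℝ) {M S : ℕ} (hMS : M < S) (hS : S ≤ n) :
    ∃ g, IsEquilibrium H β M S g := by
  obtain ⟨a, ha⟩ := exists_vol_eq (n := n) hS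
  obtain ⟨u, hu1, hu2⟩ := exists_dirichlet_solution (r := glauberRate H β)
    (D := level n M ∪ level n S) (d := fun σ => hammingDist σ a)
    (exists_flip_closer H β (Or.inr (mem_level.mpr ha))) (fun σ => if vol σ = S then 1 else 0)
  refine ⟨u, fun σ hσ => ?_, fun σ hσ => ?_, fun σ h1 h2 => ?_⟩
  · rw [hu1 σ (Or.inl (mem_level.mpr hσ)), if_neg (by omega)]
  · rw [hu1 σ (Or.inr (mem_level.mpr hσ)), if_pos hσ]
  · rw [← sum_glauberRate_sub, hu2 σ (not_mem_levels.mpr ⟨h1, h2⟩), if_neg h2]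

lemma IsEquilibrium.nonneg {H : Config n → ℝ} {β : ℝ} {M S : ℕ} (hS : S ≤ n)
    {g : Config n → ℝ} (hg : IsEquilibrium H β M S g) (σ : Config n) : 0 ≤ g σ := by
  obtain ⟨a, ha⟩ := exists_vol_eq (n := n) hS
  refine nonneg_of_superharmonic (r := glauberRate H β) (D := level n M ∪ level n S)
    (d := fun σ => hammingDist σ a)
    (exists_flip_closer H β (Or.inr (mem_level.mpr ha))) (fun σ hσ => ?_) (fun σ hσ => ?_) σ
  · rw [not_mem_levels] at hσ
    rw [sum_glauberRate_sub, hg.harmonic σ hσ.1 hσ.2]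
  · rcases hσ with h | h
    · rw [hg.eq_zero σ (mem_level.mp h)]
    · rw [hg.eq_one σ (mem_level.mp h)]; exact zero_le_one

/-- The flow out of the level `M`. -/
noncomputable def levelFlow (H : Config n → ℝ) (β : ℝ) (M : ℕ) (g : Config n → ℝ) : ℝ :=
  ∑ σ ∈ levelFinset n M, Real.exp (-β * H σ) * ∑ v, flipRate H β σ v * g (flip σ v)

/-- Pairing with the constant 1 gives zero, so φ may be replaced by φ - 1. This vanishes on the
level S, harmonicity removes all other levels, and only the flow out of M is left. Hence the pairing
does not depend on φ; this drives both capacity bounds. -/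
lemma IsEquilibrium.dirichletForm {H : Config n → ℝ} {β : ℝ} {M S : ℕ}
    {g : Config n → ℝ} (hg : IsEquilibrium H β M S g) {φ : Config n → ℝ}
    (h0 : ∀ σ, vol σ = M → φ σ = 0) (h1 : ∀ σ, vol σ = S → φ σ = 1) :
    dirichletForm H β g φ = levelFlow H β M g := by
  have hconst : ERGlauber.dirichletForm H β g (fun _ => 1) = 0 := by
    simp [ERGlauber.dirichletForm]
  rw [← sub_zero (ERGlauber.dirichletForm H β g φ), ← hconst, ← dirichletForm_eq,
    ← dirichletForm_eq, ← Finset.sum_sub_distrib, levelFlow, levelFinset, Finset.sum_filter]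
  refine Finset.sum_congr rfl fun σ _ => ?_
  split_ifs with hM
  · simp only [h0 σ hM, hg.eq_zero σ hM, zero_mul, zero_sub, one_mul, mul_neg,
      Finset.sum_neg_distrib, neg_zero, sub_neg_eq_add, zero_add]
  · by_cases hS : vol σ = S
    · rw [h1 σ hS, sub_self]
    · rw [hg.harmonic σ hM hS]; ring

/-- The probability to hit the level `S` before returning to the level `M`. -/
lemma IsEquilibrium.hitBefore {H : Config n → ℝ} {β : ℝ} {M S : ℕ} (hMS : M < S) (hS : S ≤ n)
    {g : Config n → ℝ} (hg : IsEquilibrium H β M S g) (ν : Measure (Config n))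
    [IsProbabilityMeasure ν] (hν : ∀ᵐ σ ∂ν, σ ∈ level n M) :
    hitBefore H β ν (level n S) (level n M) =
      ∫ σ, (∑ v, flipRate H β σ v * g (flip σ v)) / ∑ v, flipRate H β σ v ∂ν := by
  obtain ⟨a, ha⟩ := exists_vol_eq (n := n) hS
  have hne : (Finset.univ : Finset (Fin n)).Nonempty := ⟨⟨0, by omega⟩, Finset.mem_univ _⟩
  have hrate : ∀ σ, exitRate (glauberRate H β) σ ≠ 0 := by
    intro σ h
    have h' := exitRate_glauberRate H β σ
    rw [h] at h'
    exact (Finset.sum_pos (fun v _ => flipRate_pos H β σ v) hne).ne h'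
  rw [ERGlauber.hitBefore, measure_hitTime_lt hrate ν (A := level n M) (B := level n S) ?_ hν ?_
    (exists_flip_closer H β (a := a) (Or.inr (mem_level.mpr ha)))
    (fun σ hσ => hg.eq_zero σ (mem_level.mp hσ)) (fun σ hσ => hg.eq_one σ (mem_level.mp hσ))
    ?_]
  · refine integral_congr_ae (ae_of_all _ fun σ => ?_)
    simp only
    rw [jumpMean_eq_div, sum_glauberRate, exitRate_glauberRate]
  · rw [Set.disjoint_left]
    intro σ h1 h2
    rw [mem_level] at h1 h2
    omega
  · intro σ hσ τ hτ
    rw [glauberRate, if_neg]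
    rw [hammingDist_eq_one_iff]
    rintro ⟨v, rfl⟩
    rw [mem_level] at hσ hτ
    exact vol_flip_ne σ v (hτ.trans hσ.symm)
  · intro σ hσ
    rw [not_mem_levels] at hσ
    rw [sum_glauberRate_sub, hg.harmonic σ hσ.1 hσ.2]

end Dirichlet

end ERGlauber

namespace ERGlauber

/-! ### Capacity bounds in terms of level weights. -/

section EscapeBounds

variable {n : ℕ}

/-- The total Boltzmann weight of the configurations of volume `k`. -/
noncomputable def levelWeight (H : Config n → ℝ) (β : ℝ) (k : ℕ) : ℝ :=
  ∑ σ ∈ levelFinset n k, Real.exp (-β * H σ)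

lemma levelWeight_pos (H : Config n → ℝ) (β : ℝ) {k : ℕ} (hk : k ≤ n) :
    0 < levelWeight H β k := by
  refine Finset.sum_pos (fun σ _ => Real.exp_pos _) ?_
  rw [← Finset.card_pos, card_levelFinset]
  exact Nat.choose_pos hk

lemma flipRate_le_one (H : Config n → ℝ) {β : ℝ} (hβ : 0 ≤ β) (σ : Config n) (v : Fin n) :
    flipRate H β σ v ≤ 1 := by
  rw [flipRate, Real.exp_le_one_iff, neg_mul, neg_nonpos]
  exact mul_nonneg hβ (le_max_right _ _)

lemma le_flipRate {H : Config n → ℝ} {β L : ℝ} (hβ : 0 ≤ β)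
    (hL : ∀ σ v, |H (flip σ v) - H σ| ≤ L) (σ : Config n) (v : Fin n) :
    Real.exp (-(β * L)) ≤ flipRate H β σ v := by
  rw [flipRate, Real.exp_le_exp, neg_mul, neg_le_neg_iff]
  refine mul_le_mul_of_nonneg_left (max_le ((le_abs_self _).trans (hL σ v)) ?_) hβ
  exact (abs_nonneg _).trans (hL σ v)

lemma sum_flipRate_le (H : Config n → ℝ) {β : ℝ} (hβ : 0 ≤ β) (σ : Config n) :
    ∑ v, flipRate H β σ v ≤ n := by
  simpa using Finset.sum_le_card_nsmul Finset.univ _ 1 fun v _ => flipRate_le_one H hβ σ v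

lemma le_sum_flipRate {H : Config n → ℝ} {β L : ℝ} (hβ : 0 ≤ β)
    (hL : ∀ σ v, |H (flip σ v) - H σ| ≤ L) (σ : Config n) :
    n * Real.exp (-(β * L)) ≤ ∑ v, flipRate H β σ v := by
  simpa using Finset.card_nsmul_le_sum Finset.univ _ _ fun v _ => le_flipRate hβ hL σ v

lemma conductance_le (H : Config n → ℝ) {β : ℝ} (hβ : 0 ≤ β) (σ : Config n) (v : Fin n) :
    conductance H β σ v ≤ Real.exp (-β * H σ) :=
  mul_le_of_le_one_right (Real.exp_pos _).le (flipRate_le_one H hβ σ v)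

lemma inv_conductance_le {H : Config n → ℝ} {β L : ℝ} (hβ : 0 ≤ β)
    (hL : ∀ σ v, |H (flip σ v) - H σ| ≤ L) (σ : Config n) (v : Fin n) :
    (conductance H β σ v)⁻¹ ≤ Real.exp (β * L) * Real.exp (β * H σ) := by
  have h : Real.exp (-β * H σ) * Real.exp (-(β * L)) ≤ conductance H β σ v :=
    mul_le_mul_of_nonneg_left (le_flipRate hβ hL σ v) (Real.exp_pos _).le
  refine (inv_anti₀ (by positivity) h).trans_eq ?_
  rw [← Real.exp_add, ← Real.exp_neg, ← Real.exp_add]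
  congr 1
  ring

lemma gibbs_apply (H : Config n → ℝ) (β : ℝ) (s : Finset (Config n)) :
    gibbs H β s = ENNReal.ofReal
      ((∑ σ ∈ s, Real.exp (-β * H σ)) / ∑ τ, Real.exp (-β * H τ)) := by
  classical
  have hZ : 0 ≤ ∑ τ, Real.exp (-β * H τ) := Finset.sum_nonneg fun _ _ => (Real.exp_pos _).le
  rw [gibbs, Finset.sum_div, ENNReal.ofReal_sum_of_nonneg
    fun σ _ => div_nonneg (Real.exp_pos _).le hZ]
  simp only [Measure.coe_finsetSum, Finset.sum_apply, Measure.smul_apply, smul_eq_mul,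
    Measure.dirac_apply' _ (MeasurableSet.of_discrete (s := (s : Set (Config n))))]
  rw [← Finset.sum_filter_add_sum_filter_not _ (· ∈ s)]
  rw [Finset.sum_eq_zero (s := Finset.univ.filter (· ∉ s)), add_zero, Finset.filter_univ_mem]
  · exact Finset.sum_congr rfl fun σ hσ => by simp [hσ]
  · intro σ hσ
    have := (Finset.mem_filter.mp hσ).2
    simp [this]

lemma partition_pos (H : Config n → ℝ) (β : ℝ) : 0 < ∑ τ, Real.exp (-β * H τ) :=
  Finset.sum_pos (fun _ _ => Real.exp_pos _) ⟨fun _ => 1, Finset.mem_univ _⟩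

lemma coe_levelFinset (n k : ℕ) : (levelFinset n k : Set (Config n)) = level n k := by
  ext σ
  rw [Finset.mem_coe, mem_levelFinset, mem_level]

lemma gibbs_level_ne_zero (H : Config n → ℝ) (β : ℝ) {k : ℕ} (hk : k ≤ n) :
    gibbs H β (level n k) ≠ 0 := by
  rw [← coe_levelFinset, gibbs_apply, ne_eq, ENNReal.ofReal_eq_zero, not_le]
  exact div_pos (levelWeight_pos H β hk) (partition_pos H β)

instance isFiniteMeasure_gibbs (H : Config n → ℝ) (β : ℝ) : IsFiniteMeasure (gibbs H β) := by
  constructor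
  rw [← Finset.coe_univ, gibbs_apply]
  exact ENNReal.ofReal_lt_top

lemma integral_gibbs_cond (H : Config n → ℝ) (β : ℝ) {k : ℕ} (hk : k ≤ n) (f : Config n → ℝ) :
    ∫ σ, f σ ∂((gibbs H β)[|level n k]) =
      (∑ σ ∈ levelFinset n k, Real.exp (-β * H σ) * f σ) / levelWeight H β k := by
  classical
  have := cond_isProbabilityMeasure (gibbs_level_ne_zero H β hk)
  have hW := levelWeight_pos H β hk
  have hZ := partition_pos H β
  rw [integral_fintype Integrable.of_finite, Finset.sum_div, levelFinset, Finset.sum_filter]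
  refine Finset.sum_congr rfl fun σ _ => ?_
  rw [measureReal_def, cond_apply MeasurableSet.of_discrete]
  split_ifs with hσ
  · have h1 : level n k ∩ {σ} = (({σ} : Finset (Config n)) : Set (Config n)) := by
      rw [Finset.coe_singleton]
      exact Set.inter_eq_right.mpr (by simpa [mem_level] using hσ)
    rw [h1, gibbs_apply, ← coe_levelFinset, gibbs_apply, ENNReal.toReal_mul, ENNReal.toReal_inv,
      ENNReal.toReal_ofReal (div_nonneg (Finset.sum_nonneg fun _ _ => (Real.exp_pos _).le) hZ.le),
      ENNReal.toReal_ofReal (div_nonneg (Finset.sum_nonneg fun _ _ => (Real.exp_pos _).le) hZ.le),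
      Finset.sum_singleton, smul_eq_mul]
    change (levelWeight H β k / _)⁻¹ * _ * _ = _
    field_simp
  · have h1 : level n k ∩ {σ} = ∅ := by
      rw [Set.inter_singleton_eq_empty, mem_level]
      exact hσ
    rw [h1]
    simp

lemma ae_gibbs_cond (H : Config n → ℝ) (β : ℝ) (k : ℕ) :
    ∀ᵐ σ ∂((gibbs H β)[|level n k]), σ ∈ level n k :=
  ae_cond_mem MeasurableSet.of_discrete

lemma IsEquilibrium.levelFlow_nonneg {H : Config n → ℝ} {β : ℝ} {M S : ℕ} {g : Config n → ℝ}
    (hg : IsEquilibrium H β M S g) : 0 ≤ levelFlow H β M g := by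
  rw [← hg.dirichletForm hg.eq_zero hg.eq_one]
  exact Finset.sum_nonneg fun σ _ => Finset.sum_nonneg fun v _ =>
    mul_nonneg (conductance_pos _ _ _ _).le (mul_self_nonneg _)

/-- The Dirichlet principle. -/
lemma IsEquilibrium.levelFlow_le {H : Config n → ℝ} {β : ℝ} {M S : ℕ} {g : Config n → ℝ}
    (hg : IsEquilibrium H β M S g) {φ : Config n → ℝ}
    (h0 : ∀ σ, vol σ = M → φ σ = 0) (h1 : ∀ σ, vol σ = S → φ σ = 1) :
    levelFlow H β M g ≤ ERGlauber.dirichletForm H β φ φ := by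
  have hgg := hg.dirichletForm hg.eq_zero hg.eq_one
  have hgφ := hg.dirichletForm h0 h1
  have key : 0 ≤ ERGlauber.dirichletForm H β φ φ - 2 * ERGlauber.dirichletForm H β g φ +
      ERGlauber.dirichletForm H β g g := by
    simp only [ERGlauber.dirichletForm, Finset.mul_sum, ← Finset.sum_sub_distrib,
      ← Finset.sum_add_distrib]
    refine Finset.sum_nonneg fun σ _ => Finset.sum_nonneg fun v _ => ?_
    have := mul_nonneg (conductance_pos H β σ v).le
      (mul_self_nonneg ((φ (flip σ v) - φ σ) - (g (flip σ v) - g σ)))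
    linarith
  rw [hgg, hgφ] at key
  linarith

/-- Upper bound on the energy of a function of the volume. -/
lemma dirichletForm_vol_le (H : Config n → ℝ) {β : ℝ} (hβ : 0 ≤ β) (φ : ℕ → ℝ) :
    dirichletForm H β (fun σ => φ (vol σ)) (fun σ => φ (vol σ)) ≤
      n * ∑ k ∈ Finset.range (n + 1), (φ (k + 1) - φ k) ^ 2 * levelWeight H β k := by
  rw [dirichletForm]
  simp only [levelWeight]
  rw [← sum_level (fun σ => Real.exp (-β * H σ)) (fun k => (φ (k + 1) - φ k) ^ 2), Finset.mul_sum]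
  refine Finset.sum_le_sum fun σ _ => ?_
  have hb : ∀ v ∈ minusSet σ, conductance H β σ v *
      ((φ (vol (flip σ v)) - φ (vol σ)) * (φ (vol (flip σ v)) - φ (vol σ))) ≤
      (φ (vol σ + 1) - φ (vol σ)) ^ 2 * Real.exp (-β * H σ) := by
    intro v hv
    rw [vol_flip_of_minus (mem_minusSet.mp hv), ← sq, mul_comm]
    exact mul_le_mul_of_nonneg_left (conductance_le H hβ σ v) (sq_nonneg _)
  refine (Finset.sum_le_card_nsmul _ _ _ hb).trans ?_
  rw [nsmul_eq_mul]
  refine mul_le_mul_of_nonneg_right ?_ (by positivity)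
  rw [card_minusSet_real]
  have : (0 : ℝ) ≤ vol σ := Nat.cast_nonneg _
  linarith

lemma sum_range_ite_Ico {M S N : ℕ} (hS : S ≤ N) (f : ℕ → ℝ) :
    ∑ k ∈ Finset.range N, (if k ∈ Finset.Ico M S then f k else 0) = ∑ k ∈ Finset.Ico M S, f k := by
  rw [← Finset.sum_filter]
  congr 1
  ext k
  simp only [Finset.mem_filter, Finset.mem_range, Finset.mem_Ico]
  omega

/-- The best test function of the volume for the bound `dirichletForm_vol_le` has increments
proportional to the inverse weights, like the potential of resistors in series. -/
lemma IsEquilibrium.levelFlow_le_inv_sum {H : Config n → ℝ} {β : ℝ} (hβ : 0 ≤ β) {M S : ℕ}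
    (hMS : M < S) (hS : S ≤ n) {g : Config n → ℝ} (hg : IsEquilibrium H β M S g) :
    levelFlow H β M g ≤ n / ∑ k ∈ Finset.Ico M S, (levelWeight H β k)⁻¹ := by
  set R := ∑ k ∈ Finset.Ico M S, (levelWeight H β k)⁻¹ with hR
  have hWpos : ∀ k ∈ Finset.Ico M S, 0 < levelWeight H β k := fun k hk =>
    levelWeight_pos H β (by have := Finset.mem_Ico.mp hk; omega)
  have hRpos : 0 < R := Finset.sum_pos (fun k hk => inv_pos.mpr (hWpos k hk))
    (Finset.nonempty_Ico.mpr hMS)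
  let δ : ℕ → ℝ := fun k => if k ∈ Finset.Ico M S then (levelWeight H β k)⁻¹ / R else 0
  let φ : ℕ → ℝ := fun k => ∑ j ∈ Finset.range k, δ j
  have hφ : ∀ k, φ (k + 1) - φ k = δ k := fun k => by
    simp only [φ, Finset.sum_range_succ, add_sub_cancel_left]
  have h0 : φ M = 0 := Finset.sum_eq_zero fun j hj => by
    have := Finset.mem_range.mp hj
    simp only [δ]
    rw [if_neg]
    rw [Finset.mem_Ico]; omega
  have h1 : φ S = 1 := by
    simp only [φ, δ]
    rw [sum_range_ite_Ico le_rfl, ← Finset.sum_div, div_self hRpos.ne']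
  refine (hg.levelFlow_le (φ := fun σ => φ (vol σ)) (fun σ hσ => by simp only [hσ, h0])
    (fun σ hσ => by simp only [hσ, h1])).trans ((dirichletForm_vol_le H hβ φ).trans_eq ?_)
  rw [div_eq_mul_inv]
  congr 1
  have : ∀ k ∈ Finset.range (n + 1), (φ (k + 1) - φ k) ^ 2 * levelWeight H β k =
      if k ∈ Finset.Ico M S then (levelWeight H β k)⁻¹ / R ^ 2 else 0 := by
    intro k _
    rw [hφ]
    simp only [δ]
    split_ifs with hk
    · have := (hWpos k hk).ne'
      field_simp
    · simp
  rw [Finset.sum_congr rfl this, sum_range_ite_Ico (by omega), ← Finset.sum_div, ← hR]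
  field_simp

/-- Lower bound on the capacity by the flow that is uniform on every level. -/
lemma IsEquilibrium.one_le_levelFlow_mul {H : Config n → ℝ} {β L η : ℝ} (hβ : 0 ≤ β)
    (hL : ∀ σ v, |H (flip σ v) - H σ| ≤ L) {M S : ℕ} (hMS : M < S) (hη : 0 < η)
    (hS : (S : ℝ) ≤ (1 - η) * n) {g : Config n → ℝ} (hg : IsEquilibrium H β M S g) :
    η * n * Real.exp (-(β * L)) ≤ levelFlow H β M g *
      ∑ k ∈ Finset.Ico M S, levelWeight H (-β) k / (n.choose k : ℝ) ^ 2 := by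
  have hn : 0 < n := by
    rcases Nat.eq_zero_or_pos n with h | h
    · subst h
      simp only [CharP.cast_eq_zero, mul_zero] at hS
      have : (0 : ℝ) < S := by exact_mod_cast (by omega : 0 < S)
      linarith
    · exact h
  have hnR : (0 : ℝ) < n := by exact_mod_cast hn
  have hkn : ∀ k ∈ Finset.Ico M S, η * n ≤ (n : ℝ) - k := by
    intro k hk
    have : (k : ℝ) ≤ S := by exact_mod_cast (Finset.mem_Ico.mp hk).2.le
    linarith
  have hSn : S ≤ n := by
    have : (S : ℝ) ≤ n := by nlinarith
    exact_mod_cast this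
  -- There are binom(n, k) (n - k) edges from level k to level k + 1, so `θ` spreads one unit of
  -- flow evenly over them. Paired with the gradient of `g`, it telescopes the level averages of `g`
  -- from 0 to 1.
  let θ : ℕ → ℝ := fun k => if k ∈ Finset.Ico M S then ((n.choose k : ℝ) * (n - k))⁻¹ else 0
  let I : Finset (Σ _ : Config n, Fin n) := Finset.univ.sigma fun σ => minusSet σ
  -- the flow has strength one
  have hunit : ∑ e ∈ I, θ (vol e.1) * (g (flip e.1 e.2) - g e.1) = 1 := by
    rw [Finset.sum_sigma]
    simp only [← Finset.mul_sum]
    rw [sum_level (fun σ => ∑ v ∈ minusSet σ, (g (flip σ v) - g σ)) θ]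
    let a : ℕ → ℝ := fun k => (∑ σ ∈ levelFinset n k, g σ) / n.choose k
    have hterm : ∀ k ∈ Finset.range (n + 1),
        θ k * ∑ σ ∈ levelFinset n k, ∑ v ∈ minusSet σ, (g (flip σ v) - g σ) =
        if k ∈ Finset.Ico M S then a (k + 1) - a k else 0 := by
      intro k _
      simp only [θ]
      split_ifs with hk
      · have hk' := Finset.mem_Ico.mp hk
        have hc : (0 : ℝ) < n.choose k := by exact_mod_cast Nat.choose_pos (by omega)
        have hc' : (0 : ℝ) < n.choose (k + 1) := by exact_mod_cast Nat.choose_pos (by omega)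
        have hnk : (0 : ℝ) < n - k := lt_of_lt_of_le (by positivity) (hkn k hk)
        have hrel : (n.choose (k + 1) : ℝ) * (k + 1) = n.choose k * (n - k) := by
          have h := Nat.choose_succ_right_eq n k
          have h' : ((n.choose (k + 1) * (k + 1) : ℕ) : ℝ) = ((n.choose k * (n - k) : ℕ) : ℝ) := by
            rw [h]
          push_cast [Nat.cast_sub (show k ≤ n by omega)] at h'
          exact h'
        simp only [Finset.sum_sub_distrib]
        rw [sum_level_flip]
        have hself : ∑ σ ∈ levelFinset n k, ∑ _v ∈ minusSet σ, g σ =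
            (n - k) * ∑ σ ∈ levelFinset n k, g σ := by
          rw [Finset.mul_sum]
          refine Finset.sum_congr rfl fun σ hσ => ?_
          rw [Finset.sum_const, nsmul_eq_mul, card_minusSet_real, mem_levelFinset.mp hσ]
        rw [hself]
        have hk1 : (0 : ℝ) < k + 1 := by positivity
        simp only [a]
        rw [mul_sub, ← hrel]
        congr 1
        · field_simp
        · rw [hrel]; field_simp
      · simp
    rw [Finset.sum_congr rfl hterm, sum_range_ite_Ico (by omega), Finset.sum_Ico_sub a hMS.le]
    have haS : a S = 1 := by
      simp only [a]
      rw [Finset.sum_congr rfl fun σ hσ => hg.eq_one σ (mem_levelFinset.mp hσ), Finset.sum_const,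
        card_levelFinset, nsmul_eq_mul, mul_one, div_self]
      exact_mod_cast (Nat.choose_pos hSn).ne'
    have haM : a M = 0 := by
      simp only [a]
      rw [Finset.sum_congr rfl fun σ hσ => hg.eq_zero σ (mem_levelFinset.mp hσ),
        Finset.sum_const_zero, zero_div]
    rw [haS, haM, sub_zero]
  have hcap : ∑ e ∈ I, conductance H β e.1 e.2 * (g (flip e.1 e.2) - g e.1) ^ 2 =
      levelFlow H β M g := by
    rw [← hg.dirichletForm hg.eq_zero hg.eq_one, Finset.sum_sigma, ERGlauber.dirichletForm]
    simp only [sq]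
  have henergy : ∑ e ∈ I, θ (vol e.1) ^ 2 * (conductance H β e.1 e.2)⁻¹ ≤
      Real.exp (β * L) / (η * n) *
        ∑ k ∈ Finset.Ico M S, levelWeight H (-β) k / (n.choose k : ℝ) ^ 2 := by
    rw [Finset.sum_sigma]
    have h1 : ∀ σ : Config n, ∑ v ∈ minusSet σ, θ (vol σ) ^ 2 * (conductance H β σ v)⁻¹ ≤
        (θ (vol σ) ^ 2 * (n - vol σ) * Real.exp (β * L)) * Real.exp (β * H σ) := by
      intro σ
      refine (Finset.sum_le_card_nsmul _ _ _ fun v _ => mul_le_mul_of_nonneg_left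
        (inv_conductance_le hβ hL σ v) (sq_nonneg _)).trans_eq ?_
      rw [nsmul_eq_mul, card_minusSet_real]
      ring
    refine (Finset.sum_le_sum fun σ _ => h1 σ).trans ?_
    rw [sum_level (fun σ => Real.exp (β * H σ))
      (fun k => θ k ^ 2 * (n - k) * Real.exp (β * L)), Finset.mul_sum,
      ← sum_range_ite_Ico (N := n + 1) (by omega)]
    refine Finset.sum_le_sum fun k _ => ?_
    simp only [θ]
    split_ifs with hk
    · have hk' := Finset.mem_Ico.mp hk
      have hc : (0 : ℝ) < n.choose k := by exact_mod_cast Nat.choose_pos (by omega)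
      have hnk : (0 : ℝ) < n - k := lt_of_lt_of_le (by positivity) (hkn k hk)
      have hw : ∑ σ ∈ levelFinset n k, Real.exp (β * H σ) = levelWeight H (-β) k := by
        simp only [levelWeight, neg_neg]
      have hwp := levelWeight_pos H (-β) (k := k) (by omega)
      rw [hw]
      have e1 : ((n.choose k : ℝ) * (n - k))⁻¹ ^ 2 * (n - k) * Real.exp (β * L) *
          levelWeight H (-β) k =
          Real.exp (β * L) * (levelWeight H (-β) k / (n.choose k : ℝ) ^ 2) / (n - k) := by
        field_simp
      rw [e1, div_mul_eq_mul_div]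
      exact div_le_div_of_nonneg_left (by positivity) (by positivity) (hkn k hk)
    · simp
  -- Thomson's principle by Cauchy-Schwarz: the squared strength of the flow is at most the capacity
  -- times the energy of the flow.
  have hCS := Finset.sum_sq_le_sum_mul_sum_of_sq_le_mul I
    (r := fun e => θ (vol e.1) * (g (flip e.1 e.2) - g e.1))
    (f := fun e => conductance H β e.1 e.2 * (g (flip e.1 e.2) - g e.1) ^ 2)
    (g := fun e => θ (vol e.1) ^ 2 * (conductance H β e.1 e.2)⁻¹)
    (fun e _ => mul_nonneg (conductance_pos _ _ _ _).le (sq_nonneg _))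
    (fun e _ => mul_nonneg (sq_nonneg _) (inv_nonneg.mpr (conductance_pos _ _ _ _).le))
    (fun e _ => le_of_eq (by
      have := (conductance_pos H β e.1 e.2).ne'
      field_simp))
  rw [hunit, hcap, one_pow] at hCS
  have h2 := hCS.trans (mul_le_mul_of_nonneg_left henergy hg.levelFlow_nonneg)
  have h3 : η * n * Real.exp (-(β * L)) * 1 ≤ _ :=
    mul_le_mul_of_nonneg_left h2 (by positivity)
  rw [mul_one] at h3
  refine h3.trans_eq ?_
  rw [Real.exp_neg]
  field_simp

lemma IsEquilibrium.hitBefore_gibbs {H : Config n → ℝ} {β : ℝ} {M S : ℕ} (hMS : M < S)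
    (hS : S ≤ n) {g : Config n → ℝ} (hg : IsEquilibrium H β M S g) :
    ERGlauber.hitBefore H β ((gibbs H β)[|level n M]) (level n S) (level n M) =
      (∑ σ ∈ levelFinset n M, Real.exp (-β * H σ) *
        ((∑ v, flipRate H β σ v * g (flip σ v)) / ∑ v, flipRate H β σ v)) / levelWeight H β M := by
  have := cond_isProbabilityMeasure (gibbs_level_ne_zero H β (k := M) (by omega))
  rw [hg.hitBefore hMS hS _ (ae_gibbs_cond H β M), integral_gibbs_cond H β (by omega)]

/-- The jump probabilities divide by the exit rate, which is at least n exp(-βL). Its factor n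
cancels the n in the capacity bound. -/
theorem hitBefore_gibbs_le {H : Config n → ℝ} {β L : ℝ} (hβ : 0 ≤ β)
    (hL : ∀ σ v, |H (flip σ v) - H σ| ≤ L) {M S : ℕ} (hMS : M < S) (hS : S ≤ n) :
    hitBefore H β ((gibbs H β)[|level n M]) (level n S) (level n M) ≤
      Real.exp (β * L) /
        (levelWeight H β M * ∑ k ∈ Finset.Ico M S, (levelWeight H β k)⁻¹) := by
  obtain ⟨g, hg⟩ := exists_isEquilibrium H β hMS hS
  have hn : (0 : ℝ) < n := by exact_mod_cast (by omega : 0 < n)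
  have hW := levelWeight_pos H β (k := M) (by omega)
  have h1 : ∑ σ ∈ levelFinset n M, Real.exp (-β * H σ) *
      ((∑ v, flipRate H β σ v * g (flip σ v)) / ∑ v, flipRate H β σ v) ≤
      levelFlow H β M g / (n * Real.exp (-(β * L))) := by
    rw [levelFlow, Finset.sum_div]
    refine Finset.sum_le_sum fun σ _ => ?_
    rw [mul_div_assoc]
    refine mul_le_mul_of_nonneg_left ?_ (Real.exp_pos _).le
    exact div_le_div_of_nonneg_left (Finset.sum_nonneg fun v _ =>
      mul_nonneg (flipRate_pos _ _ _ _).le (hg.nonneg hS _)) (by positivity)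
      (le_sum_flipRate hβ hL σ)
  rw [hg.hitBefore_gibbs hMS hS]
  refine (div_le_div_of_nonneg_right (h1.trans (div_le_div_of_nonneg_right
    (hg.levelFlow_le_inv_sum hβ hMS hS) (by positivity))) hW.le).trans_eq ?_
  rw [Real.exp_neg]
  field_simp

/-- Exit rates are at most n, and the capacity is bounded below by the uniform flow. The sum
contains weights at -β divided by squared binomials instead of inverse weights: unlike inverses,
these are averages of exponentials, whose means over the graph can be computed. -/
theorem le_hitBefore_gibbs {H : Config n → ℝ} {β L η : ℝ} (hβ : 0 ≤ β)
    (hL : ∀ σ v, |H (flip σ v) - H σ| ≤ L) {M S : ℕ} (hMS : M < S) (hη : 0 < η)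
    (hS' : S ≤ n) (hS : (S : ℝ) ≤ (1 - η) * n) :
    η * Real.exp (-(β * L)) /
      (levelWeight H β M * ∑ k ∈ Finset.Ico M S, levelWeight H (-β) k / (n.choose k : ℝ) ^ 2) ≤
    hitBefore H β ((gibbs H β)[|level n M]) (level n S) (level n M) := by
  obtain ⟨g, hg⟩ := exists_isEquilibrium H β hMS hS'
  have hn : (0 : ℝ) < n := by exact_mod_cast (by omega : 0 < n)
  have hW := levelWeight_pos H β (k := M) (by omega)
  have hV : 0 < ∑ k ∈ Finset.Ico M S, levelWeight H (-β) k / (n.choose k : ℝ) ^ 2 := by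
    refine Finset.sum_pos (fun k hk => ?_) (Finset.nonempty_Ico.mpr hMS)
    have hk' := Finset.mem_Ico.mp hk
    have hc : (0 : ℝ) < n.choose k := by exact_mod_cast Nat.choose_pos (by omega)
    have := levelWeight_pos H (-β) (k := k) (by omega)
    positivity
  have h1 : levelFlow H β M g / n ≤ ∑ σ ∈ levelFinset n M, Real.exp (-β * H σ) *
      ((∑ v, flipRate H β σ v * g (flip σ v)) / ∑ v, flipRate H β σ v) := by
    rw [levelFlow, Finset.sum_div]
    refine Finset.sum_le_sum fun σ _ => ?_
    rw [mul_div_assoc]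
    refine mul_le_mul_of_nonneg_left ?_ (Real.exp_pos _).le
    exact div_le_div_of_nonneg_left (Finset.sum_nonneg fun v _ =>
      mul_nonneg (flipRate_pos _ _ _ _).le (hg.nonneg hS' _))
      (lt_of_lt_of_le (by positivity) (le_sum_flipRate hβ hL σ)) (sum_flipRate_le H hβ σ)
  rw [hg.hitBefore_gibbs hMS hS']
  refine le_trans ?_ (div_le_div_of_nonneg_right h1 hW.le)
  have h2 := hg.one_le_levelFlow_mul hβ hL hMS hη hS
  rw [div_le_iff₀ (by positivity)]
  have h3 : levelFlow H β M g / n / levelWeight H β M * (levelWeight H β M *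
      ∑ k ∈ Finset.Ico M S, levelWeight H (-β) k / (n.choose k : ℝ) ^ 2) =
      (levelFlow H β M g * ∑ k ∈ Finset.Ico M S, levelWeight H (-β) k / (n.choose k : ℝ) ^ 2) /
        n := by field_simp
  rw [h3, le_div_iff₀ hn]
  linarith

end EscapeBounds

end ERGlauber

namespace ERGlauber

/-! ### Hamiltonians of the volume, and bounds on the energy of one flip. -/

section MeanField

variable {n : ℕ}

lemma flipRate_of_vol {H : Config n → ℝ} {e : ℕ → ℝ} (hH : ∀ σ, H σ = e (vol σ)) (β : ℝ)
    (σ : Config n) (v : Fin n) :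
    flipRate H β σ v = Real.exp (-β * max (e (vol (flip σ v)) - e (vol σ)) 0) := by
  rw [flipRate, hH, hH]

/-- If the Hamiltonian depends on the volume only, so does the equilibrium potential. -/
lemma exists_isEquilibrium_vol {H : Config n → ℝ} {e : ℕ → ℝ} (hH : ∀ σ, H σ = e (vol σ))
    (β : ℝ) {M S : ℕ} (hMS : M < S) (hS : S ≤ n) :
    ∃ φ : ℕ → ℝ, IsEquilibrium H β M S fun σ => φ (vol σ) := by
  let c : ℕ → ℝ := fun k => Real.exp (-β * max (e (k + 1)) (e k))
  -- The total conductance between levels k and k + 1. The volume is a birth-death chain, and `φ` is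
  -- its potential with constant current `R⁻¹` from M to S.
  let C : ℕ → ℝ := fun k => n.choose k * (n - k) * c k
  have hC : ∀ k, k < n → 0 < C k := fun k hk => by
    have h1 : (0 : ℝ) < n.choose k := by exact_mod_cast Nat.choose_pos hk.le
    have h2 : (0 : ℝ) < n - k := by
      have : (k : ℝ) < n := by exact_mod_cast hk
      linarith
    have h3 : 0 < c k := Real.exp_pos _
    positivity
  set R := ∑ k ∈ Finset.Ico M S, (C k)⁻¹ with hR
  have hRpos : 0 < R := Finset.sum_pos (fun k hk => inv_pos.mpr (hC k (by
    have := Finset.mem_Ico.mp hk; omega))) (Finset.nonempty_Ico.mpr hMS)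
  let δ : ℕ → ℝ := fun k => if k ∈ Finset.Ico M S then (C k)⁻¹ / R else 0
  let φ : ℕ → ℝ := fun k => ∑ j ∈ Finset.range k, δ j
  have hφ : ∀ k, φ (k + 1) - φ k = δ k := fun k => by
    simp only [φ, Finset.sum_range_succ, add_sub_cancel_left]
  have hCδ : ∀ k, C k * δ k = if k ∈ Finset.Ico M S then R⁻¹ else 0 := by
    intro k
    simp only [δ]
    split_ifs with hk
    · have := (hC k (by have := Finset.mem_Ico.mp hk; omega)).ne'
      field_simp
    · simp
  refine ⟨φ, fun σ hσ => ?_, fun σ hσ => ?_, fun σ hM hS' => ?_⟩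
  · refine Finset.sum_eq_zero fun j hj => ?_
    have := Finset.mem_range.mp hj
    simp only [δ]
    rw [if_neg]
    rw [Finset.mem_Ico]; omega
  · simp only [φ, δ]
    rw [hσ, sum_range_ite_Ico le_rfl, ← Finset.sum_div, div_self hRpos.ne']
  · have hch : (0 : ℝ) < n.choose (vol σ) := by exact_mod_cast Nat.choose_pos (vol_le σ)
    have hcond : ∀ v, conductance H β σ v =
        Real.exp (-β * max (e (vol (flip σ v))) (e (vol σ))) := fun v => by
      rw [conductance_eq, hH, hH]
    have hminus : ∑ v ∈ minusSet σ, conductance H β σ v * (φ (vol σ) - φ (vol (flip σ v))) =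
        -((n - vol σ) * c (vol σ) * δ (vol σ)) := by
      rw [Finset.sum_congr rfl (g := fun _ => c (vol σ) * -δ (vol σ)), Finset.sum_const,
        nsmul_eq_mul, card_minusSet_real]
      · ring
      · intro v hv
        rw [hcond, vol_flip_of_minus (mem_minusSet.mp hv), ← hφ, neg_sub]
    have hplus : (n.choose (vol σ) : ℝ) *
        ∑ v ∈ plusSet σ, conductance H β σ v * (φ (vol σ) - φ (vol (flip σ v))) =
        if vol σ ∈ Finset.Ioc M S then R⁻¹ else 0 := by
      rcases Nat.eq_zero_or_pos (vol σ) with h0 | hpos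
      · have : plusSet σ = ∅ := by rw [← Finset.card_eq_zero, card_plusSet, h0]
        rw [this, h0]; simp
      · obtain ⟨j, hj⟩ : ∃ j, vol σ = j + 1 := ⟨vol σ - 1, by omega⟩
        have hjn : j + 1 ≤ n := hj ▸ vol_le σ
        rw [Finset.sum_congr rfl (g := fun _ => c j * δ j), Finset.sum_const,
          nsmul_eq_mul, card_plusSet, hj]
        · have hrel : (n.choose (j + 1) : ℝ) * ((j + 1 : ℕ) : ℝ) = n.choose j * (n - j) := by
            have h' : ((n.choose (j + 1) * (j + 1) : ℕ) : ℝ) =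
                ((n.choose j * (n - j) : ℕ) : ℝ) := by
              rw [Nat.choose_succ_right_eq n j]
            push_cast [Nat.cast_sub (show j ≤ n by omega)] at h'
            push_cast
            exact h'
          rw [← mul_assoc, hrel, ← mul_assoc]
          change C j * δ j = _
          rw [hCδ]
          congr 1
          simp only [Finset.mem_Ico, Finset.mem_Ioc, eq_iff_iff]
          omega
        · intro v hv
          have hv' := vol_flip_of_plus (mem_plusSet.mp hv)
          have hvj : vol (flip σ v) = j := by omega
          rw [hcond, hvj, hj, ← hφ, max_comm]
    have hw := Real.exp_pos (-β * H σ)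
    have h1 : (n.choose (vol σ) : ℝ) * (Real.exp (-β * H σ) *
        ∑ v, flipRate H β σ v * (φ (vol σ) - φ (vol (flip σ v)))) = 0 := by
      have h2 : Real.exp (-β * H σ) *
          ∑ v, flipRate H β σ v * (φ (vol σ) - φ (vol (flip σ v))) =
          ∑ v, conductance H β σ v * (φ (vol σ) - φ (vol (flip σ v))) := by
        rw [Finset.mul_sum]
        exact Finset.sum_congr rfl fun v _ => by rw [conductance]; ring
      rw [h2, sum_vertices σ, mul_add, hplus, hminus]
      have h3 : (n.choose (vol σ) : ℝ) * -((n - vol σ) * c (vol σ) * δ (vol σ)) =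
          -(C (vol σ) * δ (vol σ)) := by simp only [C]; ring
      rw [h3, hCδ]
      -- Current conservation: the current from below flows for volumes in (M, S], the one to above
      -- for volumes in [M, S). They differ only at M and S, which are excluded.
      have h4 : vol σ ∈ Finset.Ioc M S ↔ vol σ ∈ Finset.Ico M S := by
        simp only [Finset.mem_Ico, Finset.mem_Ioc]
        omega
      simp only [h4, neg_add_cancel]
    rcases mul_eq_zero.mp h1 with h | h
    · exact absurd h hch.ne'
    · exact (mul_eq_zero.mp h).resolve_left hw.ne'

/-- If the Hamiltonian depends on the volume only, all starting points in a level are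
equivalent. -/
lemma hitBefore_dirac_eq {H : Config n → ℝ} {e : ℕ → ℝ} (hH : ∀ σ, H σ = e (vol σ))
    (β : ℝ) {M S : ℕ} (hMS : M < S) (hS : S ≤ n) {σ : Config n} (hσ : vol σ = M) :
    hitBefore H β (Measure.dirac σ) (level n S) (level n M) =
      hitBefore H β ((gibbs H β)[|level n M]) (level n S) (level n M) := by
  obtain ⟨φ, hφ⟩ := exists_isEquilibrium_vol hH β hMS hS
  have hν : ∀ᵐ τ ∂(Measure.dirac σ), τ ∈ level n M := by
    rw [ae_dirac_eq]
    exact mem_level.mpr hσ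
  rw [hφ.hitBefore hMS hS _ hν, hφ.hitBefore_gibbs hMS hS, integral_dirac]
  have hvol : ∀ (f : ℕ → ℝ) (τ : Config n), ∑ v, f (vol (flip τ v)) =
      (n - vol τ) * f (vol τ + 1) + vol τ * f (vol τ - 1) := by
    intro f τ
    rw [sum_vertices τ, Finset.sum_congr rfl (s₁ := minusSet τ) (g := fun _ => f (vol τ + 1)),
      Finset.sum_congr rfl (s₁ := plusSet τ) (g := fun _ => f (vol τ - 1)), Finset.sum_const,
      Finset.sum_const, nsmul_eq_mul, nsmul_eq_mul, card_minusSet_real, card_plusSet]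
    · intro v hv
      rw [vol_flip_of_plus (mem_plusSet.mp hv), Nat.add_sub_cancel]
    · intro v hv
      rw [vol_flip_of_minus (mem_minusSet.mp hv)]
  -- The one-step average depends only on the volume, so averaging it over the level changes
  -- nothing.
  have hratio : ∀ τ, vol τ = M →
      (∑ v, flipRate H β τ v * φ (vol (flip τ v))) / ∑ v, flipRate H β τ v =
      (∑ v, flipRate H β σ v * φ (vol (flip σ v))) / ∑ v, flipRate H β σ v := by
    intro τ hτ
    simp only [flipRate_of_vol hH]
    rw [hvol (fun k => Real.exp (-β * max (e k - e (vol τ)) 0) * φ k),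
      hvol (fun k => Real.exp (-β * max (e k - e (vol τ)) 0)),
      hvol (fun k => Real.exp (-β * max (e k - e (vol σ)) 0) * φ k),
      hvol (fun k => Real.exp (-β * max (e k - e (vol σ)) 0)), hτ, hσ]
  have hsum := Finset.sum_congr (s₁ := levelFinset n M) rfl fun τ hτ =>
    congrArg (Real.exp (-β * H τ) * ·) (hratio τ (mem_levelFinset.mp hτ))
  rw [hsum, ← Finset.sum_mul]
  have := (levelWeight_pos H β (k := M) (by omega)).ne'
  change _ = levelWeight H β M * _ / levelWeight H β M
  field_simp

lemma levelWeight_of_vol {H : Config n → ℝ} {e : ℕ → ℝ} (hH : ∀ σ, H σ = e (vol σ)) (β : ℝ)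
    (k : ℕ) : levelWeight H β k = n.choose k * Real.exp (-β * e k) := by
  rw [levelWeight, Finset.sum_congr rfl fun σ hσ => by rw [hH, mem_levelFinset.mp hσ],
    Finset.sum_const, card_levelFinset, nsmul_eq_mul]

lemma sum_spin (σ : Config n) : ∑ v, spin σ v = 2 * vol σ - n := by
  rw [sum_vertices σ, Finset.sum_congr rfl (s₁ := minusSet σ) (g := fun _ => -1),
    Finset.sum_congr rfl (s₁ := plusSet σ) (g := fun _ => 1), Finset.sum_const, Finset.sum_const,
    nsmul_eq_mul, nsmul_eq_mul, card_minusSet_real, card_plusSet]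
  · ring
  · intro v hv; simp [spin, mem_plusSet.mp hv]
  · intro v hv; simp [spin, mem_minusSet.mp hv]

/-- The Curie-Weiss energy of the configurations of volume `k`. -/
noncomputable def cwEnergy (p h : ℝ) (n k : ℕ) : ℝ :=
  -(p / (2 * n)) * (2 * k - n) ^ 2 - h * (2 * k - n)

lemma cwHamiltonian_eq (p h : ℝ) (σ : Config n) :
    cwHamiltonian p h σ = cwEnergy p h n (vol σ) := by
  rw [cwHamiltonian, cwEnergy, ← sum_spin, sq, Finset.sum_mul_sum]

lemma cwEnergy_succ_sub (p h : ℝ) (hn : 0 < n) (k : ℕ) :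
    cwEnergy p h n (k + 1) - cwEnergy p h n k = -2 * (p * (2 * k + 1 - n) / n + h) := by
  have : (n : ℝ) ≠ 0 := by exact_mod_cast hn.ne'
  rw [cwEnergy, cwEnergy]
  push_cast
  field_simp
  ring

/-- Flips are involutive, so upward flips suffice. -/
lemma abs_sub_flip_le {H : Config n → ℝ} {L : ℝ}
    (h : ∀ σ v, σ v = -1 → |H (flip σ v) - H σ| ≤ L) (σ : Config n) (v : Fin n) :
    |H (flip σ v) - H σ| ≤ L := by
  rcases Int.units_eq_one_or (σ v) with hv | hv
  · have := h (flip σ v) v (by rw [flip_same, hv])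
    rwa [flip_flip, abs_sub_comm] at this
  · exact h σ v hv

lemma abs_cwHamiltonian_flip {p h : ℝ} (hp0 : 0 ≤ p) (hp1 : p ≤ 1) (σ : Config n) (v : Fin n) :
    |cwHamiltonian p h (flip σ v) - cwHamiltonian p h σ| ≤ 2 * (1 + |h|) := by
  refine abs_sub_flip_le (fun σ v hv => ?_) σ v
  have hn : 0 < n := v.pos
  have hnR : (0 : ℝ) < n := by exact_mod_cast hn
  rw [cwHamiltonian_eq, cwHamiltonian_eq, vol_flip_of_minus hv, cwEnergy_succ_sub p h hn, abs_mul,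
    abs_neg, abs_two]
  have hk : vol σ + 1 ≤ n := by rw [← vol_flip_of_minus hv]; exact vol_le _
  have hkR : (vol σ : ℝ) + 1 ≤ n := by exact_mod_cast hk
  have hk0 : (0 : ℝ) ≤ vol σ := Nat.cast_nonneg _
  have h1 : |(2 * vol σ + 1 - n : ℝ)| ≤ n := abs_le.mpr ⟨by linarith, by linarith⟩
  have h2 : |p * (2 * vol σ + 1 - n) / n| ≤ 1 := by
    rw [abs_div, abs_mul, abs_of_nonneg hp0, abs_of_pos hnR, div_le_one hnR]
    nlinarith [abs_nonneg (2 * vol σ + 1 - n : ℝ)]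
  have := abs_add_le (p * (2 * vol σ + 1 - n) / n) h
  linarith

lemma abs_spin (σ : Config n) (v : Fin n) : |spin σ v| = 1 := by
  rcases Int.units_eq_one_or (σ v) with h | h <;> simp [spin, h]

lemma abs_mul_map_spin (σ : Config n) (e : Sym2 (Fin n)) : |(e.map (spin σ)).mul| = 1 := by
  induction e with
  | _ v w => simp [Sym2.mul_mk, abs_mul, abs_spin]

lemma spin_flip_of_ne {σ : Config n} {v w : Fin n} (h : w ≠ v) :
    spin (flip σ v) w = spin σ w := by simp [spin, flip, h]

/-- Only the at most n edges at v change sign, and each carries weight 1 / n. The bound is therefore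
uniform in the graph. -/
lemma abs_erHamiltonian_flip (G : SimpleGraph (Fin n)) (h : ℝ) (σ : Config n) (v : Fin n) :
    |erHamiltonian G h (flip σ v) - erHamiltonian G h σ| ≤ 2 * (1 + |h|) := by
  classical
  have hn : 0 < n := v.pos
  have hnR : (0 : ℝ) < n := by exact_mod_cast hn
  have hspin : |(∑ w, spin (flip σ v) w) - ∑ w, spin σ w| ≤ 2 := by
    rw [sum_spin, sum_spin]
    rcases Int.units_eq_one_or (σ v) with hv | hv
    · rw [vol_flip_of_plus hv]; push_cast; ring_nf; norm_num
    · rw [vol_flip_of_minus hv]; push_cast; ring_nf; norm_num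
  have hedge : ∀ E : Finset (Sym2 (Fin n)), |(∑ e ∈ E, (e.map (spin (flip σ v))).mul) -
      ∑ e ∈ E, (e.map (spin σ)).mul| ≤ 2 * n := by
    intro E
    rw [← Finset.sum_sub_distrib, ← Finset.sum_filter_add_sum_filter_not E (v ∈ ·),
      Finset.sum_eq_zero (s := E.filter (v ∉ ·)), add_zero]
    · refine (Finset.abs_sum_le_sum_abs _ _).trans ?_
      refine (Finset.sum_le_card_nsmul _ _ 2 fun e _ => ?_).trans ?_
      · refine (abs_sub _ _).trans ?_
        rw [abs_mul_map_spin, abs_mul_map_spin]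
        norm_num
      · have hsub : E.filter (v ∈ ·) ⊆ Finset.univ.image fun w => s(v, w) := by
          intro e he
          obtain ⟨w, hw⟩ := (Finset.mem_filter.mp he).2
          exact Finset.mem_image.mpr ⟨w, Finset.mem_univ _, hw.symm⟩
        have hcard := (Finset.card_le_card hsub).trans Finset.card_image_le
        rw [Finset.card_univ, Fintype.card_fin] at hcard
        have : ((E.filter (v ∈ ·)).card : ℝ) ≤ n := by exact_mod_cast hcard
        rw [nsmul_eq_mul]
        linarith
    · intro e he
      have he' := (Finset.mem_filter.mp he).2
      induction e with
      | _ a b =>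
        rw [Sym2.mem_iff, not_or] at he'
        simp [Sym2.mul_mk, spin_flip_of_ne (Ne.symm he'.1), spin_flip_of_ne (Ne.symm he'.2)]
  rw [erHamiltonian, erHamiltonian]
  have h1 := hedge (by classical exact G.edgeFinset)
  have e1 : ∀ a b c d : ℝ, -(1 / (n : ℝ)) * a - h * b - (-(1 / (n : ℝ)) * c - h * d) =
      -((a - c) / n + h * (b - d)) := fun a b c d => by ring
  rw [e1, abs_neg]
  refine (abs_add_le _ _).trans ?_
  rw [abs_div, abs_mul, abs_of_pos hnR]
  have h2 := mul_le_mul_of_nonneg_left hspin (abs_nonneg h)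
  have h3 := div_le_div_of_nonneg_right h1 hnR.le
  rw [mul_div_assoc, div_self hnR.ne'] at h3
  convert (add_le_add h3 h2) using 1
  ring

end MeanField

end ERGlauber

namespace ERGlauber

/-! ### Annealed weights and comparison of the random graph with Curie-Weiss. -/

section RandomGraph

variable {n : ℕ}

instance measurableSingletonClass_simpleGraph : MeasurableSingletonClass (SimpleGraph (Fin n)) where
  measurableSet_singleton G := by
    have h : ({G} : Set (SimpleGraph (Fin n))) = SimpleGraph.edgeSet ⁻¹' {G.edgeSet} := by
      ext G'
      simp
    rw [h]
    exact SimpleGraph.measurableEmbedding_edgeSet.measurable (measurableSet_singleton _)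

/-- The pairs of distinct vertices. -/
def pairs (n : ℕ) : Finset (Sym2 (Fin n)) := Finset.univ.filter fun e => ¬ e.IsDiag

lemma card_pairs (n : ℕ) : (pairs n).card = n.choose 2 := by
  have h := Sym2.card_subtype_not_diag (α := Fin n)
  rw [Fintype.card_subtype, Fintype.card_fin] at h
  exact h

lemma edgeFinset_subset_pairs (G : SimpleGraph (Fin n)) [Fintype G.edgeSet] :
    G.edgeFinset ⊆ pairs n := by
  intro e he
  rw [SimpleGraph.mem_edgeFinset] at he
  exact Finset.mem_filter.mpr ⟨Finset.mem_univ _, G.not_isDiag_of_mem_edgeSet he⟩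

/-- The exponential moment of a sum over the edges of a binomial random graph. -/
lemma integral_prod_edges_le (p : unitInterval) (a : Sym2 (Fin n) → ℝ) (ha : ∀ e, 0 ≤ a e) :
    ∫ G, (open Classical in ∏ e ∈ G.edgeFinset, a e) ∂(SimpleGraph.binomialRandom (Fin n) p) ≤
      ∏ e ∈ pairs n, ((p : ℝ) * a e + (1 - p)) := by
  classical
  rw [integral_fintype Integrable.of_finite, Finset.prod_add]
  have hp0 : (0 : ℝ) ≤ p := p.2.1
  have hp1 : (0 : ℝ) ≤ 1 - p := sub_nonneg.mpr p.2.2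
  set Φ : Finset (Sym2 (Fin n)) → ℝ := fun T =>
    (∏ e ∈ T, (p : ℝ) * a e) * ∏ _e ∈ pairs n \ T, (1 - (p : ℝ)) with hΦ
  have hterm : ∀ G : SimpleGraph (Fin n),
      (SimpleGraph.binomialRandom (Fin n) p).real {G} • ∏ e ∈ G.edgeFinset, a e =
        Φ G.edgeFinset := by
    intro G
    have hsub := edgeFinset_subset_pairs G
    rw [measureReal_def, SimpleGraph.binomialRandom_singleton, hΦ]
    simp only
    rw [Finset.prod_mul_distrib, Finset.prod_const, Finset.prod_const, Finset.card_sdiff_of_subset hsub,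
      card_pairs, Nat.card_eq_fintype_card, Fintype.card_fin, ← SimpleGraph.coe_edgeFinset,
      Set.ncard_coe_finset, smul_eq_mul, ENNReal.toReal_mul, ENNReal.toReal_pow, ENNReal.toReal_pow]
    simp only [ENNReal.coe_toReal, unitInterval.coe_toNNReal, unitInterval.coe_symm_eq]
    ring
  rw [Finset.sum_congr rfl fun G _ => hterm G]
  have hinj : Function.Injective fun G : SimpleGraph (Fin n) => G.edgeFinset := fun G G' h =>
    SimpleGraph.edgeFinset_inj.mp h
  refine (Finset.sum_map Finset.univ ⟨_, hinj⟩ Φ).symm.trans_le ?_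
  -- Expanding the product sums over all sets of pairs. Every graph contributes the term of its edge
  -- set, distinct graphs distinct terms, and all terms are nonnegative.
  refine Finset.sum_le_sum_of_subset_of_nonneg ?_ fun T _ _ => ?_
  · intro T hT
    obtain ⟨G, -, rfl⟩ := Finset.mem_map.mp hT
    exact Finset.mem_powerset.mpr (edgeFinset_subset_pairs G)
  · exact mul_nonneg (Finset.prod_nonneg fun e _ => mul_nonneg hp0 (ha e))
      (Finset.prod_nonneg fun _ _ => hp1)

lemma sum_pairs_mul (f : Fin n → ℝ) :
    (∑ v, f v) ^ 2 = ∑ v, f v ^ 2 + 2 * ∑ e ∈ pairs n, (e.map f).mul := by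
  have h := QuadraticMap.map_sum (QuadraticMap.sq (R := ℝ) (A := ℝ)) Finset.univ f
  simp only [QuadraticMap.sq_apply, Finset.sym2_univ] at h
  rw [sq, h, Finset.mul_sum]
  congr 1
  · exact Finset.sum_congr rfl fun v _ => (sq _).symm
  · refine Finset.sum_congr rfl fun e _ => ?_
    induction e with
    | _ a b =>
      simp only [Sym2.map_mk, QuadraticMap.polarSym2_sym2Mk, QuadraticMap.polar,
        QuadraticMap.sq_apply, Sym2.mul_mk]
      ring

/-- The quadratic error is affordable: it is used with |x| = |b| / n for fewer than n ^ 2 pairs, so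
the errors add up to at most b ^ 2. -/
lemma bernoulli_mgf_le {p x : ℝ} (hp0 : 0 ≤ p) (hp1 : p ≤ 1) (hx : |x| ≤ 1) :
    p * Real.exp x + (1 - p) ≤ Real.exp (p * x + x ^ 2) := by
  have h1 := (abs_le.mp (Real.abs_exp_sub_one_sub_id_le hx)).2
  have h2 := Real.add_one_le_exp (p * x + x ^ 2)
  nlinarith [sq_nonneg x]

/-- The annealed weight of a configuration is at most a constant times its Curie-Weiss weight. -/
lemma integral_exp_erHamiltonian_le (p : unitInterval) (h : ℝ) (σ : Config n) {b : ℝ} (hn : 0 < n)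
    (hb : |b| ≤ n) :
    ∫ G, Real.exp (-b * erHamiltonian G h σ) ∂(SimpleGraph.binomialRandom (Fin n) p) ≤
      Real.exp (b ^ 2 + |b|) * Real.exp (-b * cwHamiltonian p h σ) := by
  classical
  have hnR : (0 : ℝ) < n := by exact_mod_cast hn
  have hp0 : (0 : ℝ) ≤ p := p.2.1
  have hp1 : (p : ℝ) ≤ 1 := p.2.2
  set t := b / n with ht
  have ht1 : |t| ≤ 1 := by rw [ht, abs_div, abs_of_pos hnR, div_le_one hnR]; exact hb
  let s : Sym2 (Fin n) → ℝ := fun e => (e.map (spin σ)).mul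
  have hs : ∀ e, |s e| = 1 := abs_mul_map_spin σ
  have hs2 : ∀ e, s e ^ 2 = 1 := fun e => by rw [← sq_abs, hs, one_pow]
  have hfac : ∀ G : SimpleGraph (Fin n), Real.exp (-b * erHamiltonian G h σ) =
      (∏ e ∈ G.edgeFinset, Real.exp (t * s e)) * Real.exp (b * h * ∑ v, spin σ v) := by
    intro G
    rw [← Real.exp_sum, ← Real.exp_add, erHamiltonian, ← Finset.mul_sum, ht]
    congr 1
    simp only [s]
    ring
  simp only [hfac]
  rw [integral_mul_const]
  have h1 := integral_prod_edges_le p (fun e => Real.exp (t * s e)) fun e => (Real.exp_pos _).le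
  have h2 : ∏ e ∈ pairs n, ((p : ℝ) * Real.exp (t * s e) + (1 - p)) ≤
      Real.exp (p * t * ∑ e ∈ pairs n, s e + t ^ 2 * n.choose 2) := by
    calc ∏ e ∈ pairs n, ((p : ℝ) * Real.exp (t * s e) + (1 - p))
        ≤ ∏ e ∈ pairs n, Real.exp (p * (t * s e) + (t * s e) ^ 2) := by
          refine Finset.prod_le_prod (fun e _ => ?_) fun e _ => ?_
          · have := Real.exp_pos (t * s e)
            have := sub_nonneg.mpr hp1
            positivity
          · refine bernoulli_mgf_le hp0 hp1 ?_
            rw [abs_mul, hs, mul_one]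
            exact ht1
      _ = Real.exp (p * t * ∑ e ∈ pairs n, s e + t ^ 2 * n.choose 2) := by
          rw [← Real.exp_sum, Finset.sum_add_distrib, Finset.mul_sum]
          congr 2
          · exact Finset.sum_congr rfl fun e _ => by ring
          · simp only [mul_pow, hs2, mul_one, Finset.sum_const, card_pairs, nsmul_eq_mul]
            ring
  refine (mul_le_mul_of_nonneg_right (h1.trans h2) (Real.exp_pos _).le).trans ?_
  rw [← Real.exp_add, ← Real.exp_add, Real.exp_le_exp]
  have hpair := sum_pairs_mul (spin σ)
  have hsq : ∑ v, spin σ v ^ 2 = n := by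
    simp [← sq_abs (spin σ _), abs_spin]
  rw [hsq] at hpair
  have hcw : cwHamiltonian p h σ =
      -(p / (2 * n)) * (n + 2 * ∑ e ∈ pairs n, s e) - h * ∑ v, spin σ v := by
    rw [cwHamiltonian, ← Finset.sum_mul_sum, ← sq, hpair]
  have hch : t ^ 2 * (n.choose 2 : ℝ) ≤ b ^ 2 := by
    have h3 : (n.choose 2 : ℝ) ≤ n ^ 2 := by
      exact_mod_cast Nat.choose_le_pow n 2
    calc t ^ 2 * (n.choose 2 : ℝ) ≤ t ^ 2 * n ^ 2 := by gcongr
      _ = b ^ 2 := by rw [ht]; field_simp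
  -- This absorbs the diagonal v = w of the Curie-Weiss double sum, which has no counterpart in the
  -- graph.
  have hbp : -(b * p / 2) ≤ |b| := by
    have h4 : |b * p / 2| ≤ |b| := by
      rw [abs_div, abs_mul, abs_of_nonneg hp0, abs_two]
      nlinarith [abs_nonneg b]
    linarith [neg_abs_le (b * p / 2)]
  have e1 : -b * cwHamiltonian p h σ =
      b * p / 2 + p * t * ∑ e ∈ pairs n, s e + b * h * ∑ v, spin σ v := by
    rw [hcw, ht]; field_simp; ring
  rw [e1]
  linarith

lemma integral_levelWeight_le (p : unitInterval) (h : ℝ) {b : ℝ} (hn : 0 < n) (hb : |b| ≤ n) (k : ℕ) :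
    ∫ G, levelWeight (erHamiltonian G h) b k ∂(SimpleGraph.binomialRandom (Fin n) p) ≤
      Real.exp (b ^ 2 + |b|) * levelWeight (n := n) (cwHamiltonian p h) b k := by
  simp only [levelWeight]
  rw [integral_finsetSum _ fun _ _ => Integrable.of_finite, Finset.mul_sum]
  exact Finset.sum_le_sum fun σ _ => integral_exp_erHamiltonian_le p h σ hn hb

lemma markov_real {Ω : Type*} [MeasurableSpace Ω] [Finite Ω] [MeasurableSingletonClass Ω]
    {P : Measure Ω} [IsFiniteMeasure P] {X : Ω → ℝ} (hX : ∀ x, 0 ≤ X x) {m A : ℝ} (hm : 0 < m)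
    (hA : 0 < A) (hE : ∫ x, X x ∂P ≤ m) : P.real {x | A * m ≤ X x} ≤ 1 / A := by
  have h := mul_meas_ge_le_integral_of_nonneg (μ := P) (ae_of_all _ hX) Integrable.of_finite (A * m)
  rw [le_div_iff₀ hA]
  have h' := h.trans hE
  have : P.real {x | A * m ≤ X x} * A * m ≤ 1 * m := by linarith
  exact le_of_mul_le_mul_right this hm

/-- Cauchy-Schwarz for the weights at opposite temperatures. -/
lemma sq_choose_le (H : Config n → ℝ) (β : ℝ) (k : ℕ) :
    (n.choose k : ℝ) ^ 2 ≤ levelWeight H β k * levelWeight H (-β) k := by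
  have h := Finset.sum_sq_le_sum_mul_sum_of_sq_le_mul (levelFinset n k) (r := fun _ => (1 : ℝ))
    (f := fun σ => Real.exp (-β * H σ)) (g := fun σ => Real.exp (- -β * H σ))
    (fun _ _ => (Real.exp_pos _).le) (fun _ _ => (Real.exp_pos _).le)
    (fun σ _ => by rw [← Real.exp_add]; simp)
  simp only [Finset.sum_const, card_levelFinset, nsmul_eq_mul, mul_one] at h
  exact h

/-- The equality case of `sq_choose_le`. Because of it the upper and lower capacity bounds coincide,
up to constants, in the mean-field model. -/
lemma levelWeight_neg_of_vol {H : Config n → ℝ} {e : ℕ → ℝ} (hH : ∀ σ, H σ = e (vol σ)) (β : ℝ)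
    {k : ℕ} (hk : k ≤ n) :
    levelWeight H (-β) k / (n.choose k : ℝ) ^ 2 = (levelWeight H β k)⁻¹ := by
  have hc : (0 : ℝ) < n.choose k := by exact_mod_cast Nat.choose_pos hk
  rw [levelWeight_of_vol hH, levelWeight_of_vol hH, neg_neg, mul_inv, ← Real.exp_neg, neg_mul,
    neg_neg]
  field_simp

/-- The Curie-Weiss escape time `W_M ∑_{M ≤ k < S} 1 / W_k` from the level `M` to the level `S`. -/
noncomputable def escapeSum (p β h : ℝ) (n M S : ℕ) : ℝ :=
  levelWeight (n := n) (cwHamiltonian p h) β M *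
    ∑ k ∈ Finset.Ico M S, (levelWeight (n := n) (cwHamiltonian p h) β k)⁻¹

lemma escapeSum_pos (p β h : ℝ) {M S : ℕ} (hMS : M < S) (hS : S ≤ n) :
    0 < escapeSum p β h n M S :=
  mul_pos (levelWeight_pos _ _ (by omega)) (Finset.sum_pos (fun k hk =>
    inv_pos.mpr (levelWeight_pos _ _ (by have := Finset.mem_Ico.mp hk; omega)))
    (Finset.nonempty_Ico.mpr hMS))

/-- With high probability the random graph is comparable to the Curie-Weiss model. -/
theorem measure_hitBefore_bounds (p : unitInterval) (h : ℝ) {β η A : ℝ} (hβ : 0 ≤ β) (hβn : β ≤ n)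
    {M S : ℕ} (hMS : M < S) (hSn : S ≤ n) (hη : 0 < η) (hS : (S : ℝ) ≤ (1 - η) * n)
    (hA : 0 < A) :
    1 - 4 / A ≤ (SimpleGraph.binomialRandom (Fin n) p).real {G |
      η * Real.exp (-(β * (2 * (1 + |h|)))) /
          ((A * Real.exp (β ^ 2 + β)) ^ 2 * escapeSum p β h n M S) ≤
        hitBefore (erHamiltonian G h) β ((gibbs (erHamiltonian G h) β)[|level n M])
          (level n S) (level n M) ∧
      hitBefore (erHamiltonian G h) β ((gibbs (erHamiltonian G h) β)[|level n M])
          (level n S) (level n M) ≤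
        Real.exp (β * (2 * (1 + |h|))) * (A * Real.exp (β ^ 2 + β)) ^ 2 /
          escapeSum p β h n M S} := by
  set P := SimpleGraph.binomialRandom (Fin n) p with hP
  set C := Real.exp (β ^ 2 + β) with hC
  have hCpos : 0 < C := Real.exp_pos _
  have hn : 0 < n := by omega
  let W : ℕ → ℝ := fun k => levelWeight (n := n) (cwHamiltonian p h) β k
  have hW : ∀ k, k ≤ n → 0 < W k := fun k hk => levelWeight_pos _ _ hk
  set R := ∑ k ∈ Finset.Ico M S, (W k)⁻¹ with hR
  have hIco : ∀ k ∈ Finset.Ico M S, k ≤ n := fun k hk => by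
    have := Finset.mem_Ico.mp hk; omega
  have hRpos : 0 < R := Finset.sum_pos (fun k hk => inv_pos.mpr (hW k (hIco k hk)))
    (Finset.nonempty_Ico.mpr hMS)
  have hF : escapeSum p β h n M S = W M * R := rfl
  have hWM := hW M (by omega)
  have hE1 : ∀ k, ∫ G, levelWeight (erHamiltonian G h) β k ∂P ≤ C * W k := fun k => by
    have := integral_levelWeight_le p h (b := β) hn (by rwa [abs_of_nonneg hβ]) k
    rwa [abs_of_nonneg hβ] at this
  have hE2 : ∀ k, k ≤ n →
      ∫ G, levelWeight (erHamiltonian G h) (-β) k / (n.choose k : ℝ) ^ 2 ∂P ≤ C * (W k)⁻¹ := by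
    intro k hk
    have := integral_levelWeight_le p h (b := -β) hn (by rwa [abs_neg, abs_of_nonneg hβ]) k
    rw [abs_neg, abs_of_nonneg hβ, neg_sq] at this
    rw [integral_div, ← levelWeight_neg_of_vol (cwHamiltonian_eq p h) β hk, ← mul_div_assoc]
    exact div_le_div_of_nonneg_right this (by positivity)
  -- Four quantities whose means are at most `C` times their Curie-Weiss values. Upper bounds on
  -- `X₁` and `X₃` give the lower bound on the escape probability; upper bounds on `X₂` and `X₄`
  -- give the upper one.
  let X₁ : SimpleGraph (Fin n) → ℝ := fun G => levelWeight (erHamiltonian G h) β M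
  let X₂ : SimpleGraph (Fin n) → ℝ := fun G =>
    levelWeight (erHamiltonian G h) (-β) M / (n.choose M : ℝ) ^ 2
  let X₃ : SimpleGraph (Fin n) → ℝ := fun G =>
    ∑ k ∈ Finset.Ico M S, levelWeight (erHamiltonian G h) (-β) k / (n.choose k : ℝ) ^ 2
  let X₄ : SimpleGraph (Fin n) → ℝ := fun G =>
    ∑ k ∈ Finset.Ico M S, levelWeight (erHamiltonian G h) β k / W k ^ 2
  have hlw : ∀ (G : SimpleGraph (Fin n)) (b : ℝ) (k : ℕ),
      0 ≤ levelWeight (erHamiltonian G h) b k := fun G b k =>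
    Finset.sum_nonneg fun _ _ => (Real.exp_pos _).le
  have m1 := markov_real (P := P) (X := X₁) (fun G => hlw G _ _) (m := C * W M) (by positivity) hA
    (hE1 M)
  have m2 := markov_real (P := P) (X := X₂) (fun G => div_nonneg (hlw G _ _) (sq_nonneg _))
    (m := C * (W M)⁻¹) (by positivity) hA (hE2 M (by omega))
  have m3 := markov_real (P := P) (X := X₃) (fun G => Finset.sum_nonneg fun k _ =>
    div_nonneg (hlw G _ _) (sq_nonneg _)) (m := C * R) (by positivity) hA (by
      simp only [X₃]
      rw [integral_finsetSum _ fun _ _ => Integrable.of_finite, hR, Finset.mul_sum]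
      exact Finset.sum_le_sum fun k hk => hE2 k (hIco k hk))
  have m4 := markov_real (P := P) (X := X₄) (fun G => Finset.sum_nonneg fun k _ =>
    div_nonneg (hlw G _ _) (sq_nonneg _)) (m := C * R) (by positivity) hA (by
      simp only [X₄]
      rw [integral_finsetSum _ fun _ _ => Integrable.of_finite, hR, Finset.mul_sum]
      refine Finset.sum_le_sum fun k hk => ?_
      have hk' := hW k (hIco k hk)
      rw [integral_div]
      refine (div_le_div_of_nonneg_right (hE1 k) (sq_nonneg _)).trans_eq ?_
      field_simp)
  set bad : Set (SimpleGraph (Fin n)) := {G | A * (C * W M) ≤ X₁ G} ∪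
    {G | A * (C * (W M)⁻¹) ≤ X₂ G} ∪ {G | A * (C * R) ≤ X₃ G} ∪ {G | A * (C * R) ≤ X₄ G} with hbad
  have hbadP : P.real bad ≤ 4 / A := by
    have u1 := measureReal_union_le (μ := P) ({G | A * (C * W M) ≤ X₁ G} ∪
      {G | A * (C * (W M)⁻¹) ≤ X₂ G} ∪ {G | A * (C * R) ≤ X₃ G}) {G | A * (C * R) ≤ X₄ G}
    have u2 := measureReal_union_le (μ := P) ({G | A * (C * W M) ≤ X₁ G} ∪
      {G | A * (C * (W M)⁻¹) ≤ X₂ G}) {G | A * (C * R) ≤ X₃ G}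
    have u3 := measureReal_union_le (μ := P) {G | A * (C * W M) ≤ X₁ G}
      {G | A * (C * (W M)⁻¹) ≤ X₂ G}
    have e : (4 : ℝ) / A = 1 / A + 1 / A + 1 / A + 1 / A := by ring
    rw [e]
    linarith
  have hcompl : P.real badᶜ = 1 - P.real bad := by
    rw [measureReal_compl (Set.toFinite bad).measurableSet, probReal_univ]
  refine le_trans (by linarith) (measureReal_mono (μ := P) (s₁ := badᶜ) fun G hG => ?_)
  simp only [hbad, Set.mem_compl_iff, Set.mem_union, Set.mem_ofPred_eq, not_or, not_le] at hG
  obtain ⟨⟨⟨g1, g2⟩, g3⟩, g4⟩ := hG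
  have hWG : ∀ k, k ≤ n → 0 < levelWeight (erHamiltonian G h) β k := fun k hk =>
    levelWeight_pos _ _ hk
  have hRG : 0 < ∑ k ∈ Finset.Ico M S, (levelWeight (erHamiltonian G h) β k)⁻¹ :=
    Finset.sum_pos (fun k hk => inv_pos.mpr (hWG k (hIco k hk))) (Finset.nonempty_Ico.mpr hMS)
  have hX3pos : 0 < X₃ G := by
    refine Finset.sum_pos (fun k hk => ?_) (Finset.nonempty_Ico.mpr hMS)
    have hc : (0 : ℝ) < n.choose k := by exact_mod_cast Nat.choose_pos (hIco k hk)
    have := levelWeight_pos (erHamiltonian G h) (-β) (hIco k hk)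
    positivity
  constructor
  · refine le_trans ?_ (le_hitBefore_gibbs hβ (abs_erHamiltonian_flip G h) hMS hη hSn hS)
    refine div_le_div_of_nonneg_left (by positivity) (mul_pos (hWG M (by omega)) hX3pos) ?_
    rw [hF]
    calc _ ≤ A * (C * W M) * (A * (C * R)) :=
          mul_le_mul g1.le g3.le hX3pos.le (by positivity)
      _ = _ := by ring
  · refine (hitBefore_gibbs_le hβ (abs_erHamiltonian_flip G h) hMS hSn).trans ?_
    -- By `sq_choose_le`, an upper bound on the weight at -β is a lower bound on the weight at β.
    have hM' : W M / (A * C) ≤ levelWeight (erHamiltonian G h) β M := by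
      have hc : (0 : ℝ) < n.choose M := by exact_mod_cast Nat.choose_pos (by omega)
      have hcs := sq_choose_le (erHamiltonian G h) β M
      have hwp := levelWeight_pos (erHamiltonian G h) (-β) (k := M) (by omega)
      have g2' : levelWeight (erHamiltonian G h) (-β) M / (n.choose M : ℝ) ^ 2 <
        A * (C * (W M)⁻¹) := g2
      rw [div_lt_iff₀ (by positivity)] at g2'
      have h5 := hcs.trans (mul_le_mul_of_nonneg_left g2'.le (hWG M (by omega)).le)
      have h6 : 1 * (n.choose M : ℝ) ^ 2 ≤
          (levelWeight (erHamiltonian G h) β M * (A * (C * (W M)⁻¹))) * (n.choose M : ℝ) ^ 2 := by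
        linarith
      have h7 := le_of_mul_le_mul_right h6 (by positivity)
      rw [div_le_iff₀ (by positivity)]
      have h8 := mul_le_mul_of_nonneg_right h7 hWM.le
      have h9 : levelWeight (erHamiltonian G h) β M * (A * (C * (W M)⁻¹)) * W M =
          levelWeight (erHamiltonian G h) β M * (A * C) := by field_simp
      linarith
    -- Cauchy-Schwarz bounds `R ^ 2` by the sum of inverse weights times `X₄`, and `X₄` is at most a
    -- multiple of `R`. One factor `R` cancels, and no union bound over k is needed.
    have hR' : R / (A * C) ≤ ∑ k ∈ Finset.Ico M S, (levelWeight (erHamiltonian G h) β k)⁻¹ := by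
      have hcs := Finset.sum_sq_le_sum_mul_sum_of_sq_le_mul (Finset.Ico M S)
        (r := fun k => (W k)⁻¹) (f := fun k => (levelWeight (erHamiltonian G h) β k)⁻¹)
        (g := fun k => levelWeight (erHamiltonian G h) β k / W k ^ 2)
        (fun k hk => (inv_pos.mpr (hWG k (hIco k hk))).le)
        (fun k hk => div_nonneg (hlw G _ _) (sq_nonneg _))
        (fun k hk => by
          have := (hWG k (hIco k hk)).ne'
          have := (hW k (hIco k hk)).ne'
          apply le_of_eq
          field_simp)
      have h5 := hcs.trans (mul_le_mul_of_nonneg_left g4.le hRG.le)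
      rw [← hR] at h5
      rw [div_le_iff₀ (by positivity)]
      have h6 : R * R ≤ ((∑ k ∈ Finset.Ico M S, (levelWeight (erHamiltonian G h) β k)⁻¹) *
        (A * C)) * R := by linarith
      exact le_of_mul_le_mul_right h6 hRpos
    have h10 : W M / (A * C) * (R / (A * C)) ≤ levelWeight (erHamiltonian G h) β M *
        ∑ k ∈ Finset.Ico M S, (levelWeight (erHamiltonian G h) β k)⁻¹ :=
      mul_le_mul hM' hR' (by positivity) (hWG M (by omega)).le
    refine (div_le_div_of_nonneg_left (Real.exp_pos _).le (by positivity) h10).trans_eq ?_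
    rw [hF]
    field_simp

/-- The escape probability of the Curie-Weiss model, up to constants. -/
theorem cw_hitBefore_bounds {p h β η : ℝ} (hp0 : 0 ≤ p) (hp1 : p ≤ 1) (hβ : 0 ≤ β)
    {M S : ℕ} (hMS : M < S) (hSn : S ≤ n) (hη : 0 < η) (hS : (S : ℝ) ≤ (1 - η) * n)
    {σ : Config n} (hσ : vol σ = M) :
    η * Real.exp (-(β * (2 * (1 + |h|)))) / escapeSum p β h n M S ≤
        hitBefore (cwHamiltonian p h) β (Measure.dirac σ) (level n S) (level n M) ∧
      hitBefore (cwHamiltonian p h) β (Measure.dirac σ) (level n S) (level n M) ≤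
        Real.exp (β * (2 * (1 + |h|))) / escapeSum p β h n M S := by
  rw [hitBefore_dirac_eq (cwHamiltonian_eq p h) β hMS hSn hσ]
  refine ⟨?_, hitBefore_gibbs_le hβ (abs_cwHamiltonian_flip hp0 hp1) hMS hSn⟩
  refine le_trans (le_of_eq ?_)
    (le_hitBefore_gibbs hβ (abs_cwHamiltonian_flip hp0 hp1) hMS hη hSn hS)
  rw [escapeSum]
  congr 2
  refine Finset.sum_congr rfl fun k hk => (levelWeight_neg_of_vol (cwHamiltonian_eq p h) β ?_).symm
  have := Finset.mem_Ico.mp hk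
  omega

end RandomGraph

end ERGlauber

namespace ERGlauber

/-! ### The drift J_n on the lattice and the critical volumes. -/

section Drift

/-- The value of `J_n` at the magnetization of the volume `k`. -/
noncomputable def drift (p β h : ℝ) (n k : ℕ) : ℝ :=
  2 * β * (p * (2 * k / n - 1) + h) + (harmonic (n - k) - harmonic k : ℝ)

lemma hasDerivAt_Gamma_natCast_add_one (m : ℕ) :
    HasDerivAt Real.Gamma (m.factorial * (-Real.eulerMascheroniConstant + harmonic m))
      ((m : ℝ) + 1) := by
  rw [← Real.deriv_Gamma_nat]
  refine (Real.differentiableAt_Gamma fun j => ?_).hasDerivAt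
  have h1 : (0 : ℝ) ≤ j := Nat.cast_nonneg j
  have h2 : (0 : ℝ) ≤ m := Nat.cast_nonneg m
  linarith

/-- At positive integers the logarithmic derivative of Gamma is a harmonic number minus Euler's
constant, and the two constants cancel. This covers k = 0 and k = n, where the Gamma arguments are
still positive. -/
lemma driftFn_eq (p β h : ℝ) {n k : ℕ} (hn : 0 < n) (hk : k ≤ n) :
    driftFn p β h n (-1 + 2 * k / n) = drift p β h n k := by
  have hnR : (n : ℝ) ≠ 0 := by exact_mod_cast hn.ne'
  set a : ℝ := -1 + 2 * k / n with ha
  set γ := Real.eulerMascheroniConstant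
  have e1 : (1 + a) / 2 * n + 1 = (k : ℝ) + 1 := by rw [ha]; field_simp; ring
  have e2 : (1 - a) / 2 * n + 1 = ((n - k : ℕ) : ℝ) + 1 := by
    rw [ha, Nat.cast_sub hk]; field_simp; ring
  have d1 : HasDerivAt (fun x : ℝ => (1 + x) / 2 * n + 1) (n / 2) a := by
    have := (((hasDerivAt_id a).const_add 1).div_const 2).mul_const (n : ℝ) |>.add_const 1
    exact this.congr_deriv (by ring)
  have d2 : HasDerivAt (fun x : ℝ => (1 - x) / 2 * n + 1) (-(n / 2)) a := by
    have := (((hasDerivAt_id a).const_sub 1).div_const 2).mul_const (n : ℝ) |>.add_const 1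
    exact this.congr_deriv (by ring)
  have g1 := hasDerivAt_Gamma_natCast_add_one k
  rw [← e1] at g1
  have g2 := hasDerivAt_Gamma_natCast_add_one (n - k)
  rw [← e2] at g2
  have f1 := g1.comp a d1
  have f2 := g2.comp a d2
  have v1 : Real.Gamma ((1 + a) / 2 * n + 1) = k.factorial := by
    rw [e1, Real.Gamma_nat_eq_factorial]
  have v2 : Real.Gamma ((1 - a) / 2 * n + 1) = (n - k).factorial := by
    rw [e2, Real.Gamma_nat_eq_factorial]
  have p1 : (k.factorial : ℝ) ≠ 0 := by exact_mod_cast k.factorial_ne_zero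
  have p2 : ((n - k).factorial : ℝ) ≠ 0 := by exact_mod_cast (n - k).factorial_ne_zero
  have p3 : (n.factorial : ℝ) ≠ 0 := by exact_mod_cast n.factorial_ne_zero
  have hprod := f1.mul f2
  have hval : (Real.Gamma ∘ fun x : ℝ => (1 + x) / 2 * n + 1) a *
      (Real.Gamma ∘ fun x : ℝ => (1 - x) / 2 * n + 1) a = k.factorial * (n - k).factorial := by
    rw [Function.comp_apply, Function.comp_apply, v1, v2]
  have hquot := (hasDerivAt_const a (Real.Gamma (n + 1))).div hprod (by
    rw [Pi.mul_apply, hval]; positivity)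
  have hlog := (hquot.log (by
    rw [Pi.div_apply, Pi.mul_apply, hval, Real.Gamma_nat_eq_factorial]
    positivity)).const_mul (-(1 / (n : ℝ)))
  have hder : deriv (entropyFn n) a = (harmonic k - harmonic (n - k) : ℝ) / 2 := by
    refine HasDerivAt.deriv (f := entropyFn n) (hlog.congr_deriv ?_)
    rw [Pi.div_apply, Pi.mul_apply, hval, Function.comp_apply, Function.comp_apply, v1, v2,
      Real.Gamma_nat_eq_factorial]
    field_simp
    ring
  rw [driftFn, hder, drift, ha]
  ring

/-- The metastable, top and stable volumes. -/
structure IsMetastable (p β h : ℝ) (n M T S : ℕ) : Prop where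
  drift_M : drift p β h n M ≤ 0
  pos_of_lt_M : ∀ k < M, 0 < drift p β h n k
  M_lt_T : M < T
  drift_T : 0 ≤ drift p β h n T
  neg_of_lt_T : ∀ k, M < k → k < T → drift p β h n k < 0
  T_lt_S : T < S
  S_le : S ≤ n
  drift_S : drift p β h n S ≤ 0
  pos_of_lt_S : ∀ k, T < k → k < S → 0 < drift p β h n k

/-- Each minimum is over natural numbers, so one witness of the right sign makes it exist and bounds
it. -/
lemma exists_isMetastable {p β h : ℝ} {n k₀ k₁ k₂ : ℕ} (h01 : k₀ < k₁) (h12 : k₁ < k₂)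
    (h2 : k₂ ≤ n) (d0 : drift p β h n k₀ ≤ 0) (d1 : 0 ≤ drift p β h n k₁)
    (d2 : drift p β h n k₂ ≤ 0) :
    ∃ M T S, IsMetastable p β h n M T S ∧ M ≤ k₀ ∧ T ≤ k₁ ∧ S ≤ k₂ := by
  classical
  have hM : ∃ k, drift p β h n k ≤ 0 := ⟨k₀, d0⟩
  have hM0 : Nat.find hM ≤ k₀ := Nat.find_min' hM d0
  have hT : ∃ k, Nat.find hM < k ∧ 0 ≤ drift p β h n k := ⟨k₁, by omega, d1⟩
  have hT1 : Nat.find hT ≤ k₁ := Nat.find_min' hT ⟨by omega, d1⟩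
  have hS : ∃ k, Nat.find hT < k ∧ drift p β h n k ≤ 0 := ⟨k₂, by omega, d2⟩
  have hS2 : Nat.find hS ≤ k₂ := Nat.find_min' hS ⟨by omega, d2⟩
  refine ⟨Nat.find hM, Nat.find hT, Nat.find hS, ⟨Nat.find_spec hM, fun k hk => ?_,
    (Nat.find_spec hT).1, (Nat.find_spec hT).2, fun k hk hk' => ?_, (Nat.find_spec hS).1,
    hS2.trans h2, (Nat.find_spec hS).2, fun k hk hk' => ?_⟩, hM0, hT1, hS2⟩
  · exact not_le.mp (Nat.find_min hM hk)
  · by_contra hcon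
    exact Nat.find_min hT hk' ⟨hk, not_lt.mp hcon⟩
  · by_contra hcon
    exact Nat.find_min hS hk' ⟨hk, not_lt.mp hcon⟩

lemma mag_le_mag_iff {n : ℕ} (hn : 0 < n) {j k : ℕ} :
    (-1 + 2 * j / n : ℝ) ≤ -1 + 2 * k / n ↔ j ≤ k := by
  have hnR : (0 : ℝ) < n := by exact_mod_cast hn
  rw [add_le_add_iff_left, div_le_div_iff_of_pos_right hnR,
    mul_le_mul_iff_right₀ (two_pos : (0 : ℝ) < 2), Nat.cast_le]

lemma mag_lt_mag_iff {n : ℕ} (hn : 0 < n) {j k : ℕ} :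
    (-1 + 2 * j / n : ℝ) < -1 + 2 * k / n ↔ j < k := by
  rw [← not_le, mag_le_mag_iff hn, not_le]

lemma IsMetastable.isLeast {p β h : ℝ} {n M T S : ℕ} (hm : IsMetastable p β h n M T S) :
    WellDefined p β h n ∧ metaMag p β h n = -1 + 2 * M / n ∧
      stableMag p β h n = -1 + 2 * S / n := by
  have h1 := hm.M_lt_T
  have h2 := hm.T_lt_S
  have h3 := hm.S_le
  have hn : 0 < n := by omega
  have lM : IsLeast (metaSet p β h n) (-1 + 2 * M / n) := by
    refine ⟨⟨⟨M, by omega, rfl⟩, ?_⟩, ?_⟩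
    · rw [driftFn_eq p β h hn (by omega)]; exact hm.drift_M
    · rintro _ ⟨⟨k, hk, rfl⟩, hd⟩
      rw [driftFn_eq p β h hn hk] at hd
      rw [mag_le_mag_iff hn]
      by_contra hlt
      exact absurd hd (not_le.mpr (hm.pos_of_lt_M k (not_le.mp hlt)))
  have eM : metaMag p β h n = -1 + 2 * M / n := lM.csInf_eq
  have lT : IsLeast (topSet p β h n) (-1 + 2 * T / n) := by
    refine ⟨⟨⟨T, by omega, rfl⟩, ?_, ?_⟩, ?_⟩
    · rw [eM, mag_lt_mag_iff hn]; exact h1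
    · rw [driftFn_eq p β h hn (by omega)]; exact hm.drift_T
    · rintro _ ⟨⟨k, hk, rfl⟩, hlt, hd⟩
      rw [driftFn_eq p β h hn hk] at hd
      rw [eM, mag_lt_mag_iff hn] at hlt
      rw [mag_le_mag_iff hn]
      by_contra hcon
      exact absurd hd (not_le.mpr (hm.neg_of_lt_T k hlt (not_le.mp hcon)))
  have eT : topMag p β h n = -1 + 2 * T / n := lT.csInf_eq
  have lS : IsLeast (stableSet p β h n) (-1 + 2 * S / n) := by
    refine ⟨⟨⟨S, by omega, rfl⟩, ?_, ?_⟩, ?_⟩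
    · rw [eT, mag_lt_mag_iff hn]; exact h2
    · rw [driftFn_eq p β h hn (by omega)]; exact hm.drift_S
    · rintro _ ⟨⟨k, hk, rfl⟩, hlt, hd⟩
      rw [driftFn_eq p β h hn hk] at hd
      rw [eT, mag_lt_mag_iff hn] at hlt
      rw [mag_le_mag_iff hn]
      by_contra hcon
      exact absurd hd (not_le.mpr (hm.pos_of_lt_S k hlt (not_le.mp hcon)))
  have eS : stableMag p β h n = -1 + 2 * S / n := lS.csInf_eq
  refine ⟨⟨?_, ?_, ?_⟩, eM, eS⟩
  · rw [eM]; exact lM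
  · rw [eT]; exact lT
  · rw [eS]; exact lS

lemma IsMetastable.setM_eq {p β h : ℝ} {n M T S : ℕ} (hm : IsMetastable p β h n M T S) :
    setM p β h n = level n M := by
  have hn : (n : ℝ) ≠ 0 := by
    have := hm.S_le; have := hm.T_lt_S
    exact_mod_cast (by omega : n ≠ 0)
  rw [setM, hm.isLeast.2.1]
  congr 1
  field_simp
  ring

lemma IsMetastable.setS_eq {p β h : ℝ} {n M T S : ℕ} (hm : IsMetastable p β h n M T S) :
    setS p β h n = level n S := by
  have hn : (n : ℝ) ≠ 0 := by
    have := hm.S_le; have := hm.T_lt_S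
    exact_mod_cast (by omega : n ≠ 0)
  rw [setS, hm.isLeast.2.2]
  congr 1
  field_simp
  ring

/-! ### Shape of the drift -/

lemma drift_succ_sub {p β h : ℝ} {n k : ℕ} (hk : k < n) :
    drift p β h n (k + 1) - drift p β h n k =
      4 * β * p / n - 1 / (k + 1) - 1 / (n - k) := by
  obtain ⟨m, rfl⟩ : ∃ m, n = k + 1 + m := ⟨n - (k + 1), by omega⟩
  have e1 : k + 1 + m - (k + 1) = m := by omega
  have e2 : k + 1 + m - k = m + 1 := by omega
  rw [drift, drift, e1, e2, harmonic_succ, harmonic_succ]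
  have h1 : ((k + 1 + m : ℕ) : ℝ) ≠ 0 := by positivity
  have h2 : ((k + 1 + m : ℕ) : ℝ) - k = m + 1 := by push_cast; ring
  rw [h2]
  push_cast at h1 ⊢
  field_simp
  ring

/-- Strict convexity below n / 2. By `drift_succ_sub` an increment is a constant minus (n + 1) / ((k
+ 1)(n - k)), and this product grows with k there. -/
lemma drift_step_lt {p β h : ℝ} {n k : ℕ} (hk : 2 * k + 2 < n) :
    drift p β h n (k + 1) - drift p β h n k <
      drift p β h n (k + 1 + 1) - drift p β h n (k + 1) := by
  rw [drift_succ_sub (by omega), drift_succ_sub (by omega)]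
  have hkR : (2 * k + 2 : ℝ) < n := by exact_mod_cast hk
  have hk0 : (0 : ℝ) ≤ k := Nat.cast_nonneg k
  have key : 1 / (((k + 1 : ℕ) : ℝ) + 1) + 1 / (n - ((k + 1 : ℕ) : ℝ)) <
      1 / ((k : ℝ) + 1) + 1 / (n - k) := by
    push_cast
    have a1 : (0 : ℝ) < k + 1 := by positivity
    have a2 : (0 : ℝ) < n - k := by linarith
    have a3 : (0 : ℝ) < k + 1 + 1 := by positivity
    have a4 : (0 : ℝ) < n - (k + 1) := by linarith
    rw [div_add_div _ _ a3.ne' a4.ne', div_add_div _ _ a1.ne' a2.ne',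
      div_lt_div_iff₀ (by positivity) (by positivity)]
    have hnum : (1 * (n - (k + 1)) + (k + 1 + 1) * 1 : ℝ) = n + 1 := by ring
    have hnum' : (1 * (n - k) + (k + 1) * 1 : ℝ) = n + 1 := by ring
    rw [hnum, hnum']
    have : (k + 1) * (n - k) < (k + 1 + 1) * (n - (k + 1) : ℝ) := by linarith
    exact mul_lt_mul_of_pos_left this (by linarith)
  linarith

/-- By convexity, after one nondecreasing step all later steps below n / 2 are increasing. -/
lemma drift_step_pos {p β h : ℝ} {n j i : ℕ}
    (hj : drift p β h n j ≤ drift p β h n (j + 1)) (hji : j < i) (hi : 2 * i < n) :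
    drift p β h n i < drift p β h n (i + 1) := by
  obtain ⟨d, rfl⟩ : ∃ d, i = j + 1 + d := ⟨i - (j + 1), by omega⟩
  induction d with
  | zero =>
    have := drift_step_lt (p := p) (β := β) (h := h) (n := n) (k := j) (by omega)
    simp only [add_zero]
    linarith
  | succ d ih =>
    have h1 := ih (by omega) (by omega)
    have := drift_step_lt (p := p) (β := β) (h := h) (n := n) (k := j + 1 + d) (by omega)
    rw [← add_assoc]
    linarith

lemma drift_lt_of_step {p β h : ℝ} {n j a b : ℕ}
    (hj : drift p β h n j ≤ drift p β h n (j + 1)) (hja : j < a) (hab : a < b) (hb : 2 * b ≤ n) :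
    drift p β h n a < drift p β h n b := by
  obtain ⟨d, rfl⟩ : ∃ d, b = a + 1 + d := ⟨b - (a + 1), by omega⟩
  induction d with
  | zero => exact drift_step_pos hj hja (by omega)
  | succ d ih =>
    exact (ih (by omega) (by omega)).trans
      (drift_step_pos (i := a + 1 + d) hj (by omega) (by omega))

lemma exists_step_of_le (f : ℕ → ℝ) {a b : ℕ} (hab : a < b) (h : f a ≤ f b) :
    ∃ j, a ≤ j ∧ j < b ∧ f j ≤ f (j + 1) := by
  by_contra! hcon
  have key : ∀ d, a + d ≤ b → 0 < d → f (a + d) < f a := by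
    intro d
    induction d with
    | zero => intro _ h0; omega
    | succ d ih =>
      intro hd _
      have hs := hcon (a + d) (by omega) (by omega)
      rcases Nat.eq_zero_or_pos d with h0 | h0
      · subst h0; simpa using hs
      · exact hs.trans (ih (by omega) h0)
  have := key (b - a) (by omega) (by omega)
  rw [show a + (b - a) = b by omega] at this
  linarith

/-- A nonnegative value at i would need a nondecreasing step between M and i. The drift would then
keep increasing up to K and could not be negative there. -/
lemma IsMetastable.neg_of_le {p β h : ℝ} {n M T S : ℕ} (hm : IsMetastable p β h n M T S)
    {K : ℕ} (hK : 2 * K ≤ n) (hd : drift p β h n K < 0) {i : ℕ} (hMi : M < i) (hiK : i ≤ K) :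
    drift p β h n i < 0 := by
  by_contra hcon
  obtain ⟨j, hj1, hj2, hj3⟩ := exists_step_of_le (drift p β h n) hMi
    (hm.drift_M.trans (not_lt.mp hcon))
  rcases hiK.eq_or_lt with h | h
  · subst h; exact hcon hd
  · have := drift_lt_of_step hj3 hj2 h hK
    linarith [not_lt.mp hcon]

/-- The drift does not decrease overall from M to T, so some step in between is nondecreasing, and
beyond T the drift increases strictly up to n / 2. -/
lemma IsMetastable.pos_of_gt {p β h : ℝ} {n M T S : ℕ} (hm : IsMetastable p β h n M T S)
    {i : ℕ} (hTi : T < i) (hi : 2 * i ≤ n) : 0 < drift p β h n i := by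
  obtain ⟨j, hj1, hj2, hj3⟩ := exists_step_of_le (drift p β h n) hm.M_lt_T
    (hm.drift_M.trans hm.drift_T)
  exact lt_of_le_of_lt hm.drift_T (drift_lt_of_step hj3 hj2 hTi hi)

/-! ### Size of the drift -/

lemma harmonic_bounds {m : ℕ} (hm : 0 < m) :
    Real.log m + Real.eulerMascheroniConstant ≤ harmonic m ∧
      (harmonic m : ℝ) ≤ Real.log m + Real.eulerMascheroniConstant + 1 / m := by
  have hmR : (0 : ℝ) < m := by exact_mod_cast hm
  constructor
  · have h := (Real.eulerMascheroniConstant_lt_eulerMascheroniSeq' m).le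
    rw [Real.eulerMascheroniSeq', if_neg hm.ne'] at h
    linarith
  · have h := (Real.eulerMascheroniSeq_lt_eulerMascheroniConstant m).le
    rw [Real.eulerMascheroniSeq] at h
    have h2 : Real.log (m + 1) ≤ Real.log m + 1 / m := by
      have h3 := Real.log_le_sub_one_of_pos (x := ((m : ℝ) + 1) / m) (by positivity)
      rw [Real.log_div (by positivity) hmR.ne'] at h3
      have h4 : ((m : ℝ) + 1) / m - 1 = 1 / m := by field_simp; ring
      linarith
    linarith

/-- The macroscopic drift at the volume fraction `x`. -/
noncomputable def limitDrift (p β h x : ℝ) : ℝ :=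
  2 * β * (p * (2 * x - 1) + h) + Real.log ((1 - x) / x)

lemma abs_drift_sub_limitDrift_le (p β h : ℝ) {n k : ℕ} (hk : 0 < k) (hkn : k < n) :
    |drift p β h n k - limitDrift p β h (k / n)| ≤ 1 / k + 1 / (n - k) := by
  have hkR : (0 : ℝ) < k := by exact_mod_cast hk
  have hnR : (0 : ℝ) < n := by exact_mod_cast hk.trans hkn
  have hcast : ((n - k : ℕ) : ℝ) = n - k := Nat.cast_sub hkn.le
  have hnk : (0 : ℝ) < n - k := by rw [← hcast]; exact_mod_cast Nat.sub_pos_of_lt hkn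
  obtain ⟨l1, u1⟩ := harmonic_bounds hk
  obtain ⟨l2, u2⟩ := harmonic_bounds (Nat.sub_pos_of_lt hkn)
  rw [hcast] at l2 u2
  have e : (1 - (k : ℝ) / n) / (k / n) = (n - k) / k := by field_simp
  rw [drift, limitDrift, e, Real.log_div hnk.ne' hkR.ne', mul_div_assoc, abs_le]
  have p1 : (0 : ℝ) < 1 / k := by positivity
  have p2 : (0 : ℝ) < 1 / (n - k) := by positivity
  constructor <;> linarith

lemma drift_field (p β h h' : ℝ) (n k : ℕ) :
    drift p β h' n k = drift p β h n k + 2 * β * (h' - h) := by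
  rw [drift, drift]; ring

/-- The crude bounds log (m + 1) ≤ H_m ≤ 1 + log m cost the -1. Unlike the comparison with
`limitDrift` they remain usable down to k = 0. -/
lemma harmonic_sub_lower {η : ℝ} (hη : 0 < η) (hη1 : η < 1) {n k : ℕ} (hn : 1 ≤ η * n)
    (hk : (k : ℝ) ≤ η * n) (hkn : k ≤ n) :
    Real.log ((1 - η) / η) - 1 ≤ (harmonic (n - k) - harmonic k : ℝ) := by
  have hnR : (0 : ℝ) < n := by
    by_contra hcon
    have : (n : ℝ) = 0 := le_antisymm (not_lt.mp hcon) (Nat.cast_nonneg n)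
    rw [this, mul_zero] at hn
    linarith
  have hcast : ((n - k : ℕ) : ℝ) = n - k := Nat.cast_sub hkn
  have h1 : Real.log ((1 - η) * n) ≤ harmonic (n - k) := by
    refine le_trans (Real.log_le_log (mul_pos (by linarith) hnR) ?_) (log_add_one_le_harmonic _)
    push_cast [hcast]
    linarith
  have h2 : (harmonic k : ℝ) ≤ 1 + Real.log (η * n) := by
    rcases Nat.eq_zero_or_pos k with h0 | h0
    · subst h0
      have := Real.log_nonneg hn
      simp only [harmonic_zero, Rat.cast_zero]
      linarith
    · refine (harmonic_le_one_add_log k).trans ?_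
      have : Real.log k ≤ Real.log (η * n) := Real.log_le_log (by exact_mod_cast h0) hk
      linarith
  have h1η : (1 - η) ≠ 0 := by linarith
  rw [Real.log_mul h1η hnR.ne'] at h1
  rw [Real.log_mul hη.ne' hnR.ne'] at h2
  rw [Real.log_div h1η hη.ne']
  linarith

/-- Below a positive fraction of `n` the drift is positive, and near `n` it is negative. -/
lemma exists_drift_boundary (p β h : ℝ) (hβ : 0 < β) :
    ∃ η : ℝ, 0 < η ∧ η < 1 ∧ ∀ n : ℕ, 1 ≤ η * n → ∀ h' : ℝ, |h' - h| ≤ 1 → ∀ k : ℕ, k ≤ n →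
      ((k : ℝ) ≤ η * n → 0 < drift p β h' n k) ∧
      ((1 - η) * n ≤ k → drift p β h' n k < 0) := by
  -- With η = 1 / (1 + exp K), log ((1 - η) / η) equals `K`, which exceeds the largest possible
  -- linear part of the drift by 2; the lemma on harmonic numbers loses 1 of this.
  set K := 2 + 2 * β * (|p| + |h| + 1) with hK
  refine ⟨1 / (1 + Real.exp K), by positivity, ?_, ?_⟩
  · rw [div_lt_one (by positivity)]
    linarith [Real.exp_pos K]
  intro n hn h' hh' k hkn
  set η := 1 / (1 + Real.exp K) with hηdef
  have hη : 0 < η := by positivity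
  have hη1 : η < 1 := by
    rw [hηdef, div_lt_one (by positivity)]
    linarith [Real.exp_pos K]
  have hlog : Real.log ((1 - η) / η) = K := by
    have : (1 - η) / η = Real.exp K := by
      rw [hηdef]; field_simp; ring
    rw [this, Real.log_exp]
  have hnR : (0 : ℝ) < n := by
    by_contra hcon
    have : (n : ℝ) = 0 := le_antisymm (not_lt.mp hcon) (Nat.cast_nonneg n)
    rw [this, mul_zero] at hn
    linarith
  have hkR : (k : ℝ) ≤ n := by exact_mod_cast hkn
  have hk0 : (0 : ℝ) ≤ k := Nat.cast_nonneg k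
  have hmag : |(2 * k / n - 1 : ℝ)| ≤ 1 := by
    rw [abs_le]
    constructor
    · have : (0 : ℝ) ≤ 2 * k / n := by positivity
      linarith
    · have : (2 * k / n : ℝ) ≤ 2 := by rw [div_le_iff₀ hnR]; linarith
      linarith
  have hlin : |p * (2 * k / n - 1) + h'| ≤ |p| + |h| + 1 := by
    have a1 := abs_add_le (p * (2 * k / n - 1)) h'
    have a2 : |p * (2 * k / n - 1)| ≤ |p| := by
      rw [abs_mul]; exact mul_le_of_le_one_right (abs_nonneg _) hmag
    have a3 : |h'| ≤ |h| + 1 := by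
      have := abs_add_le (h' - h) h
      rw [sub_add_cancel] at this
      linarith
    linarith
  obtain ⟨b1, b2⟩ := abs_le.mp hlin
  have c1 := mul_le_mul_of_nonneg_left b1 (by linarith : 0 ≤ 2 * β)
  have c2 := mul_le_mul_of_nonneg_left b2 (by linarith : 0 ≤ 2 * β)
  constructor
  · intro hk
    have := harmonic_sub_lower hη hη1 hn hk hkn
    rw [drift]
    linarith
  · intro hk
    have hcast : ((n - k : ℕ) : ℝ) = n - k := Nat.cast_sub hkn
    -- Exchanging k and n - k reverses the sign of the entropic part.
    have := harmonic_sub_lower hη hη1 hn (k := n - k) (by rw [hcast]; linarith) (Nat.sub_le _ _)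
    rw [Nat.sub_sub_self hkn] at this
    rw [drift]
    linarith

/-- The witness x = (1 - s) / 2, with s = √(1 - 1 / (βp)), is the critical point of the limiting
drift below 1 / 2, where 4βp = 1 / (x(1 - x)). The drift at x is 2β(h - pχ(βp)), so the bound on h
is exactly its negativity. -/
lemma exists_limitDrift_neg {p β h : ℝ} (hp0 : 0 < p) (hβ : 1 / p < β)
    (hh1 : h < p * threshold (β * p)) :
    ∃ x, 0 < x ∧ x < 1 / 2 ∧ limitDrift p β h x < 0 := by
  have hβ0 : 0 < β := lt_trans (by positivity) hβ
  set l := β * p with hl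
  have hl1 : 1 < l := by rwa [div_lt_iff₀ hp0] at hβ
  have hl0 : 0 < l := by linarith
  set s := √(1 - 1 / l) with hs
  have hin : 0 < 1 - 1 / l := by
    rw [sub_pos, div_lt_one hl0]; exact hl1
  have hs0 : 0 < s := Real.sqrt_pos.mpr hin
  have hs2 : s ^ 2 = 1 - 1 / l := Real.sq_sqrt hin.le
  have hs1 : s < 1 := by
    have : s ^ 2 < 1 := by
      rw [hs2]
      have : 0 < 1 / l := by positivity
      linarith
    nlinarith
  refine ⟨(1 - s) / 2, by linarith, by linarith, ?_⟩
  have hratio : (1 - (1 - s) / 2) / ((1 - s) / 2) = l * (1 + s) ^ 2 := by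
    have h1s : 0 < 1 - s := by linarith
    rw [div_eq_iff (by positivity)]
    have : l * ((1 - s) * (1 + s)) = 1 := by
      have : (1 - s) * (1 + s) = 1 / l := by nlinarith
      rw [this]; field_simp
    calc 1 - (1 - s) / 2 = (1 + s) / 2 * 1 := by ring
      _ = (1 + s) / 2 * (l * ((1 - s) * (1 + s))) := by rw [this]
      _ = _ := by ring
  rw [limitDrift, hratio]
  rw [threshold, ← hs] at hh1
  have h2 : 2 * β * h < 2 * β * (p * (s - 1 / (2 * l) * Real.log (l * (1 + s) ^ 2))) :=
    mul_lt_mul_of_pos_left hh1 (by linarith)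
  have h3 : 2 * β * (p * (s - 1 / (2 * l) * Real.log (l * (1 + s) ^ 2))) =
      2 * β * p * s - Real.log (l * (1 + s) ^ 2) := by
    rw [hl]; field_simp
  rw [h3] at h2
  linarith

lemma continuousAt_limitDrift (p β h : ℝ) {x : ℝ} (h0 : 0 < x) (h1 : x < 1) :
    ContinuousAt (limitDrift p β h) x := by
  unfold limitDrift
  refine ContinuousAt.add (by fun_prop) (ContinuousAt.log ?_ ?_)
  · exact ContinuousAt.div (by fun_prop) (by fun_prop) h0.ne'
  · exact (div_pos (by linarith) h0).ne'

end Drift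

end ERGlauber

namespace ERGlauber

/-! ### Level weights as exponentials of the summed drift. -/

section Weights

variable {n : ℕ}

lemma log_levelWeight_succ_sub (p β h : ℝ) {k : ℕ} (hk : k < n) :
    Real.log (levelWeight (n := n) (cwHamiltonian p h) β (k + 1)) -
      Real.log (levelWeight (n := n) (cwHamiltonian p h) β k) =
      Real.log (n - k) - Real.log (k + 1) + 2 * β * (p * (2 * k + 1 - n) / n + h) := by
  have hc : (0 : ℝ) < n.choose k := by exact_mod_cast Nat.choose_pos hk.le
  have hc' : (0 : ℝ) < n.choose (k + 1) := by exact_mod_cast Nat.choose_pos hk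
  have hkR : (k : ℝ) < n := by exact_mod_cast hk
  have hnk : (0 : ℝ) < n - k := by linarith
  have hk1 : (0 : ℝ) < k + 1 := by positivity
  have hrel : (n.choose (k + 1) : ℝ) * (k + 1) = n.choose k * (n - k) := by
    have h' : ((n.choose (k + 1) * (k + 1) : ℕ) : ℝ) = ((n.choose k * (n - k) : ℕ) : ℝ) := by
      rw [Nat.choose_succ_right_eq n k]
    push_cast [Nat.cast_sub hk.le] at h'
    exact h'
  have hlog := congrArg Real.log hrel
  rw [Real.log_mul hc'.ne' hk1.ne', Real.log_mul hc.ne' hnk.ne'] at hlog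
  have hE := cwEnergy_succ_sub p h (by omega : 0 < n) k
  rw [levelWeight_of_vol (cwHamiltonian_eq p h), levelWeight_of_vol (cwHamiltonian_eq p h),
    Real.log_mul hc'.ne' (Real.exp_pos _).ne', Real.log_mul hc.ne' (Real.exp_pos _).ne',
    Real.log_exp, Real.log_exp]
  have : -β * cwEnergy p h n (k + 1) - -β * cwEnergy p h n k =
      2 * β * (p * (2 * k + 1 - n) / n + h) := by
    rw [← mul_sub, hE]; ring
  linarith

/-- The three errors come from evaluating the magnetization at the midpoint of the step and from
replacing the two logarithms by harmonic numbers. Applying the harmonic bound at k + 1 admits k = 0.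
-/
lemma abs_log_levelWeight_succ_sub_drift_le {p β : ℝ} (hp : 0 ≤ p) (hβ : 0 ≤ β) (h : ℝ) {k : ℕ}
    (hk : k < n) :
    |Real.log (levelWeight (n := n) (cwHamiltonian p h) β (k + 1)) -
      Real.log (levelWeight (n := n) (cwHamiltonian p h) β k) - drift p β h n k| ≤
      2 * β * p / n + 1 / (k + 1) + 1 / (n - k) := by
  have hnR : (0 : ℝ) < n := by exact_mod_cast (by omega : 0 < n)
  have hcast : ((n - k : ℕ) : ℝ) = n - k := Nat.cast_sub hk.le
  have hnk : (0 : ℝ) < n - k := by rw [← hcast]; exact_mod_cast Nat.sub_pos_of_lt hk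
  obtain ⟨l1, u1⟩ := harmonic_bounds (Nat.succ_pos k)
  obtain ⟨l2, u2⟩ := harmonic_bounds (Nat.sub_pos_of_lt hk)
  rw [Nat.succ_eq_add_one, harmonic_succ] at l1 u1
  rw [hcast] at l2 u2
  push_cast at l1 u1
  rw [log_levelWeight_succ_sub p β h hk, drift]
  have e : 2 * β * (p * (2 * k + 1 - n) / n + h) =
      2 * β * (p * (2 * k / n - 1) + h) + 2 * β * p / n := by field_simp; ring
  rw [e]
  have p1 : (0 : ℝ) < 1 / (k + 1) := by positivity
  have p2 : (0 : ℝ) < 1 / (n - k) := by positivity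
  have p3 : (0 : ℝ) ≤ 2 * β * p / n := by positivity
  rw [one_div ((k : ℝ) + 1)] at *
  rw [abs_le]
  constructor <;> linarith

/-- Away from the two ends each step errs by O(1 / n), and there are at most n steps. -/
lemma abs_log_levelWeight_sub_sum_drift_le {p β η : ℝ} (hp : 0 ≤ p) (hβ : 0 ≤ β) (h : ℝ)
    (hη : 0 < η) {a b : ℕ} (hab : a ≤ b) (hbn : b ≤ n) (ha : η * n ≤ a)
    (hb : ∀ k < b, (k : ℝ) ≤ (1 - η) * n) :
    |Real.log (levelWeight (n := n) (cwHamiltonian p h) β b) -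
      Real.log (levelWeight (n := n) (cwHamiltonian p h) β a) -
      ∑ k ∈ Finset.Ico a b, drift p β h n k| ≤ 2 * β * p + 2 / η := by
  have hpos : 0 ≤ 2 * β * p + 2 / η := by positivity
  rcases Nat.eq_zero_or_pos n with h0 | h0
  · obtain rfl : a = b := by omega
    simpa using hpos
  have hnR : (0 : ℝ) < n := by exact_mod_cast h0
  rw [← Finset.sum_Ico_sub (fun k => Real.log (levelWeight (n := n) (cwHamiltonian p h) β k)) hab,
    ← Finset.sum_sub_distrib]
  refine (Finset.abs_sum_le_sum_abs _ _).trans ?_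
  refine (Finset.sum_le_card_nsmul _ _ ((2 * β * p + 2 / η) / n) fun k hk => ?_).trans ?_
  · have hk' := Finset.mem_Ico.mp hk
    refine (abs_log_levelWeight_succ_sub_drift_le hp hβ h (by omega)).trans ?_
    have hkR : (a : ℝ) ≤ k := by exact_mod_cast hk'.1
    have hkb := hb k hk'.2
    have h1 : 1 / ((k : ℝ) + 1) ≤ 1 / (η * n) :=
      one_div_le_one_div_of_le (by positivity) (by linarith)
    have h2 : 1 / ((n : ℝ) - k) ≤ 1 / (η * n) :=
      one_div_le_one_div_of_le (by positivity) (by linarith)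
    have e : (2 * β * p + 2 / η) / n = 2 * β * p / n + 1 / (η * n) + 1 / (η * n) := by
      field_simp; ring
    rw [e]
    linarith
  · rw [Nat.card_Ico, nsmul_eq_mul]
    have : ((b - a : ℕ) : ℝ) ≤ n := by exact_mod_cast (by omega : b - a ≤ n)
    rw [mul_div_assoc', div_le_iff₀ hnR, mul_comm]
    exact mul_le_mul_of_nonneg_left this hpos

lemma levelWeight_field (p β h h' : ℝ) (k : ℕ) :
    levelWeight (n := n) (cwHamiltonian p h') β k =
      levelWeight (n := n) (cwHamiltonian p h) β k *
        Real.exp (β * (h' - h) * (2 * k - n)) := by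
  rw [levelWeight_of_vol (cwHamiltonian_eq p h), levelWeight_of_vol (cwHamiltonian_eq p h'),
    mul_assoc, ← Real.exp_add]
  congr 2
  rw [cwEnergy, cwEnergy]
  ring

lemma levelWeight_ratio_field (p β h h' : ℝ) {a b : ℕ} (hb : b ≤ n) :
    levelWeight (n := n) (cwHamiltonian p h') β a / levelWeight (n := n) (cwHamiltonian p h') β b =
      levelWeight (n := n) (cwHamiltonian p h) β a / levelWeight (n := n) (cwHamiltonian p h) β b *
        Real.exp (-(2 * β * (h' - h) * (b - a))) := by
  have hW := (levelWeight_pos (n := n) (cwHamiltonian p h) β hb).ne'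
  rw [levelWeight_field p β h h' a, levelWeight_field p β h h' b, mul_div_mul_comm, ← Real.exp_sub]
  congr 2
  ring

end Weights

/-! ### Effect of the field on the escape sum. -/

section Comparison

/-- The macroscopic features of the drift: it is positive up to `η n`, at most `-c` on `[a, b]`,
at least `c` on `[q, r]`, and negative at `s`. -/
structure DriftProfile (p β h : ℝ) (n : ℕ) (c η : ℝ) (a b q r s : ℕ) : Prop where
  left : ∀ k : ℕ, k ≤ n → (k : ℝ) ≤ η * n → 0 < drift p β h n k
  neg : ∀ k, a ≤ k → k ≤ b → drift p β h n k ≤ -c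
  pos : ∀ k, q ≤ k → k ≤ r → c ≤ drift p β h n k
  right : drift p β h n s < 0
  a_le_b : a ≤ b
  b_lt_q : b < q
  q_le_r : q ≤ r
  r_le : 2 * r ≤ n
  r_lt_s : r < s
  s_le : s ≤ n
  lt_s : ∀ k < s, (k : ℝ) ≤ (1 - η) * n

variable {p β h c η : ℝ} {n a b q r s M T S : ℕ}

lemma DriftProfile.exists_isMetastable (hd : DriftProfile p β h n c η a b q r s) (hc : 0 < c) :
    ∃ M T S, IsMetastable p β h n M T S ∧ M ≤ a ∧ T ≤ q ∧ S ≤ s := by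
  have := hd.a_le_b
  have := hd.b_lt_q
  have := hd.q_le_r
  have := hd.r_lt_s
  have h1 := hd.neg a le_rfl hd.a_le_b
  have h2 := hd.pos q le_rfl hd.q_le_r
  exact ERGlauber.exists_isMetastable (k₀ := a) (k₁ := q) (k₂ := s) (by omega) (by omega) hd.s_le
    (by linarith) (by linarith) hd.right.le

/-- The profile fixes the signs of the drift only on a few windows. Convexity fills the gaps below n
/ 2, which puts M before the negative window, T between the two windows, and S beyond the positive
one. -/
lemma IsMetastable.location (hm : IsMetastable p β h n M T S)
    (hd : DriftProfile p β h n c η a b q r s) (hc : 0 < c) :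
    η * n ≤ M ∧ M ≤ a ∧ b < T ∧ T ≤ q ∧ r < S ∧ S ≤ s ∧
      (∀ k, M ≤ k → k ≤ b → drift p β h n k ≤ 0) := by
  have o1 := hd.a_le_b
  have o2 := hd.b_lt_q
  have o3 := hd.q_le_r
  have o4 := hd.r_lt_s
  have o5 := hd.r_le
  have o6 := hm.M_lt_T
  have o7 := hm.T_lt_S
  have o8 := hm.S_le
  have hMa : M ≤ a := by
    by_contra hcon
    have h1 := hm.pos_of_lt_M a (not_le.mp hcon)
    have h2 := hd.neg a le_rfl hd.a_le_b
    linarith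
  have hneg : ∀ k, M < k → k ≤ b → drift p β h n k < 0 := fun k h1 h2 =>
    hm.neg_of_le (K := b) (by omega) (by linarith [hd.neg b hd.a_le_b le_rfl]) h1 h2
  have hTq : T ≤ q := by
    by_contra hcon
    have h1 := hm.neg_of_lt_T q (by omega) (not_le.mp hcon)
    have h2 := hd.pos q le_rfl hd.q_le_r
    linarith
  refine ⟨?_, hMa, ?_, hTq, ?_, ?_, fun k h1 h2 => ?_⟩
  · by_contra hcon
    have := hd.left M (by omega) (not_le.mp hcon).le
    linarith [hm.drift_M]
  · by_contra hcon
    have := hneg T hm.M_lt_T (not_lt.mp hcon)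
    linarith [hm.drift_T]
  · by_contra hcon
    have := hm.pos_of_gt hm.T_lt_S (by omega)
    linarith [hm.drift_S]
  · by_contra hcon
    have := hm.pos_of_lt_S s (by omega) (not_le.mp hcon)
    linarith [hd.right]
  · rcases h1.eq_or_lt with h | h
    · rw [← h]; exact hm.drift_M
    · exact (hneg k h h2).le

lemma div_le_of_log_sub_le {x y K : ℝ} (hx : 0 < x) (hy : 0 < y)
    (h : Real.log x - Real.log y ≤ K) : x / y ≤ Real.exp K := by
  rw [← Real.log_div hx.ne' hy.ne'] at h
  exact (Real.log_le_iff_le_exp (div_pos hx hy)).mp h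

/-- Raising the field shortens the Curie-Weiss escape time. -/
theorem escapeSum_le_of_field_le {h' : ℝ} {m M' T' S' : ℕ} (hp : 0 ≤ p) (hβ : 0 ≤ β) (hc : 0 < c)
    (hη : 0 < η) (hhh' : h ≤ h') (hd : DriftProfile p β h n c η a b q r s)
    (hd' : DriftProfile p β h' n c η a b q r s) (ham : a ≤ m) (hmb : m ≤ b)
    (hm : IsMetastable p β h n M T S) (hm' : IsMetastable p β h' n M' T' S') :
    escapeSum p β h' n M' S' ≤
      Real.exp (2 * (2 * β * p + 2 / η)) * (Real.exp (-(2 * β * (h' - h) * (m - a))) +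
        n * Real.exp (-(c * (b - m))) + n * Real.exp (-(c * (r - q)))) *
        escapeSum p β h n M S := by
  set K := 2 * β * p + 2 / η with hK
  have hKpos : 0 ≤ K := by positivity
  have o1 := hd.a_le_b
  have o2 := hd.b_lt_q
  have o3 := hd.q_le_r
  have o4 := hd.r_lt_s
  have o5 := hd.r_le
  have o6 := hd.s_le
  obtain ⟨l1, l2, l3, l4, l5, l6, l7⟩ := hm.location hd hc
  obtain ⟨l1', l2', l3', l4', l5', l6', l7'⟩ := hm'.location hd' hc
  let W : ℕ → ℝ := fun k => levelWeight (n := n) (cwHamiltonian p h) β k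
  let W' : ℕ → ℝ := fun k => levelWeight (n := n) (cwHamiltonian p h') β k
  have hW : ∀ k, k ≤ n → 0 < W k := fun k hk => levelWeight_pos _ _ hk
  have hW' : ∀ k, k ≤ n → 0 < W' k := fun k hk => levelWeight_pos _ _ hk
  have hsum : ∀ x y, x ≤ y → y ≤ s → η * n ≤ x →
      |Real.log (W y) - Real.log (W x) - ∑ k ∈ Finset.Ico x y, drift p β h n k| ≤ K :=
    fun x y hxy hys hx => abs_log_levelWeight_sub_sum_drift_le hp hβ h hη hxy (hys.trans o6) hx
      fun k hk => hd.lt_s k (lt_of_lt_of_le hk hys)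
  have hsum' : ∀ x y, x ≤ y → y ≤ s → η * n ≤ x →
      |Real.log (W' y) - Real.log (W' x) - ∑ k ∈ Finset.Ico x y, drift p β h' n k| ≤ K :=
    fun x y hxy hys hx => abs_log_levelWeight_sub_sum_drift_le hp hβ h' hη hxy (hys.trans o6) hx
      fun k hk => hd.lt_s k (lt_of_lt_of_le hk hys)
  have hMM' : M ≤ M' := by
    by_contra hcon
    have h1 := hm.pos_of_lt_M M' (not_le.mp hcon)
    have h2 := drift_field p β h h' n M'
    have h3 : 0 ≤ 2 * β * (h' - h) := mul_nonneg (by linarith) (by linarith)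
    linarith [hm'.drift_M]
  -- For the lower field the drift is nonpositive from M to M', so the weights decrease there up to
  -- a constant.
  have hWM : W M' / W M ≤ Real.exp K := by
    refine div_le_of_log_sub_le (hW M' (by omega)) (hW M (by omega)) ?_
    have h1 := (abs_le.mp (hsum M M' hMM' (by omega) l1)).2
    have h2 : ∑ k ∈ Finset.Ico M M', drift p β h n k ≤ 0 := Finset.sum_nonpos fun k hk => by
      have := Finset.mem_Ico.mp hk
      exact l7 k this.1 (by omega)
    linarith
  have hE : ∀ k, M ≤ k → k < S → W M / W k ≤ escapeSum p β h n M S := by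
    intro k h1 h2
    rw [div_eq_mul_inv]
    refine mul_le_mul_of_nonneg_left ?_ (hW M (by omega)).le
    exact Finset.single_le_sum (f := fun k => (W k)⁻¹)
      (fun j hj => (inv_pos.mpr (hW j (by have := Finset.mem_Ico.mp hj; omega))).le)
      (Finset.mem_Ico.mpr ⟨h1, h2⟩)
  have hEpos := escapeSum_pos p β h (hm.M_lt_T.trans hm.T_lt_S) hm.S_le
  -- comparison of a single term for the two fields
  have hone : ∀ k, M' ≤ k → k < S → W' M' / W' k ≤ Real.exp K *
      Real.exp (-(2 * β * (h' - h) * (k - M'))) * (W M / W k) := by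
    intro k h1 h2
    have hWk := hW k (by omega)
    have hWMpos := hW M (by omega)
    have e : W' M' / W' k = W M' / W k * Real.exp (-(2 * β * (h' - h) * (k - M'))) :=
      levelWeight_ratio_field p β h h' (by omega)
    have e2 : W M' / W k = W M' / W M * (W M / W k) := by field_simp
    rw [e, e2]
    have := mul_le_mul_of_nonneg_right hWM (div_pos hWMpos hWk).le
    have := mul_le_mul_of_nonneg_right this
      (Real.exp_pos (-(2 * β * (h' - h) * (k - M')))).le
    linarith
  have hone' : ∀ k, M' ≤ k → k < S →
      W' M' / W' k ≤ Real.exp K * escapeSum p β h n M S := by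
    intro k h1 h2
    refine (hone k h1 h2).trans ?_
    rw [mul_assoc]
    refine mul_le_mul_of_nonneg_left ?_ (Real.exp_pos _).le
    have hkM : (M' : ℝ) ≤ k := by exact_mod_cast h1
    have h3 : Real.exp (-(2 * β * (h' - h) * (k - M'))) ≤ 1 := by
      rw [Real.exp_le_one_iff, neg_nonpos]
      exact mul_nonneg (mul_nonneg (by linarith) (by linarith)) (by linarith)
    have h4 : 0 ≤ W M / W k := (div_pos (hW M (by omega)) (hW k (by omega))).le
    exact (mul_le_of_le_one_left h4 h3).trans (hE k (by omega) h2)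
  set E := escapeSum p β h n M S with hEdef
  set α₁ := Real.exp (-(2 * β * (h' - h) * (m - a))) with hα₁
  set α₂ := Real.exp (-(c * (b - m))) with hα₂
  set α₃ := Real.exp (-(c * (r - q))) with hα₃
  have hα₁p : 0 < α₁ := Real.exp_pos _
  have hα₂p : 0 < α₂ := Real.exp_pos _
  have hα₃p : 0 < α₃ := Real.exp_pos _
  have hK1 : Real.exp K ≤ Real.exp (2 * K) := Real.exp_le_exp.mpr (by linarith)
  have hK2 : Real.exp K * Real.exp K = Real.exp (2 * K) := by rw [← Real.exp_add]; ring_nf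
  -- the three ranges of volumes
  have hmid : ∀ k, m ≤ k → k < S → W' M' / W' k ≤ Real.exp (2 * K) * α₁ * (W M / W k) := by
    intro k h1 h2
    refine (hone k (by omega) h2).trans ?_
    refine mul_le_mul_of_nonneg_right ?_ (div_pos (hW M (by omega)) (hW k (by omega))).le
    refine mul_le_mul hK1 ?_ (Real.exp_pos _).le (Real.exp_pos _).le
    rw [hα₁, Real.exp_le_exp, neg_le_neg_iff]
    refine mul_le_mul_of_nonneg_left ?_ (mul_nonneg (by linarith) (by linarith))
    have e1 : (m : ℝ) ≤ k := by exact_mod_cast h1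
    have e2 : (M' : ℝ) ≤ a := by exact_mod_cast l2'
    linarith
  -- Too close to M' for the tilt to help. Passing through level b gives the factor `α₂` instead,
  -- since the weights fall exponentially across [m, b].
  have hleft : ∀ k, M' ≤ k → k < m → W' M' / W' k ≤ Real.exp (2 * K) * α₂ * E := by
    intro k h1 h2
    have hWk := hW' k (by omega)
    have hWb := hW' b (by omega)
    have hkM : (M' : ℝ) ≤ k := by exact_mod_cast h1
    have hratio : W' b / W' k ≤ Real.exp K * α₂ := by
      rw [hα₂, ← Real.exp_add]
      refine div_le_of_log_sub_le hWb hWk ?_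
      have h3 := (abs_le.mp (hsum' k b (by omega) (by omega) (by linarith))).2
      have h4 : ∑ j ∈ Finset.Ico k b, drift p β h' n j ≤ -(c * (b - m)) := by
        rw [← Finset.sum_Ico_consecutive _ h2.le hmb]
        have h5 : ∑ j ∈ Finset.Ico k m, drift p β h' n j ≤ 0 := Finset.sum_nonpos fun j hj => by
          have := Finset.mem_Ico.mp hj
          exact l7' j (by omega) (by omega)
        have h6 : ∑ j ∈ Finset.Ico m b, drift p β h' n j ≤ (Finset.Ico m b).card • (-c) :=
          Finset.sum_le_card_nsmul _ _ _ fun j hj => by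
            have := Finset.mem_Ico.mp hj
            exact hd'.neg j (by omega) (by omega)
        rw [Nat.card_Ico, nsmul_eq_mul, Nat.cast_sub hmb] at h6
        linarith
      linarith
    have e : W' M' / W' k = W' b / W' k * (W' M' / W' b) := by field_simp
    rw [e]
    refine (mul_le_mul hratio (hone' b (by omega) (by omega))
      (div_pos (hW' M' (by omega)) hWb).le (by positivity)).trans_eq ?_
    rw [← hK2]; ring
  -- These terms may have no counterpart in the sum for h. The weights rise exponentially from q to
  -- r and do not fall again before S' except by a constant, so comparison with level q suffices.
  have hright : ∀ k, S ≤ k → k < S' → W' M' / W' k ≤ Real.exp (2 * K) * α₃ * E := by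
    intro k h1 h2
    have hWk := hW' k (by omega)
    have hWq := hW' q (by omega)
    have hqM : (M' : ℝ) ≤ q := by exact_mod_cast (by omega : M' ≤ q)
    have hratio : W' q / W' k ≤ Real.exp K * α₃ := by
      rw [hα₃, ← Real.exp_add]
      refine div_le_of_log_sub_le hWq hWk ?_
      have h3 := (abs_le.mp (hsum' q k (by omega) (by omega) (by linarith))).1
      have h4 : c * (r - q) ≤ ∑ j ∈ Finset.Ico q k, drift p β h' n j := by
        rw [← Finset.sum_Ico_consecutive _ o3 (by omega : r ≤ k)]
        have h5 : 0 ≤ ∑ j ∈ Finset.Ico r k, drift p β h' n j := Finset.sum_nonneg fun j hj => by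
          have hj' := Finset.mem_Ico.mp hj
          rcases (l4'.trans (o3.trans hj'.1)).eq_or_lt with h | h
          · rw [← h]; exact hm'.drift_T
          · exact (hm'.pos_of_lt_S j h (by omega)).le
        have h6 : (Finset.Ico q r).card • c ≤ ∑ j ∈ Finset.Ico q r, drift p β h' n j :=
          Finset.card_nsmul_le_sum _ _ _ fun j hj => by
            have := Finset.mem_Ico.mp hj
            exact hd'.pos j (by omega) (by omega)
        rw [Nat.card_Ico, nsmul_eq_mul, Nat.cast_sub o3] at h6
        linarith
      linarith
    have e : W' M' / W' k = W' q / W' k * (W' M' / W' q) := by field_simp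
    rw [e]
    refine (mul_le_mul hratio (hone' q (by omega) (by omega))
      (div_pos (hW' M' (by omega)) hWq).le (by positivity)).trans_eq ?_
    rw [← hK2]; ring
  -- summation
  have hterm : ∀ k ∈ Finset.Ico M' S', W' M' / W' k ≤
      Real.exp (2 * K) * α₁ * (if k ∈ Finset.Ico M S then W M / W k else 0) +
        (Real.exp (2 * K) * α₂ * E + Real.exp (2 * K) * α₃ * E) := by
    intro k hk
    have hk' := Finset.mem_Ico.mp hk
    have p2 : 0 < Real.exp (2 * K) * α₂ * E := by positivity
    have p3 : 0 < Real.exp (2 * K) * α₃ * E := by positivity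
    have p1 : 0 ≤ Real.exp (2 * K) * α₁ * (if k ∈ Finset.Ico M S then W M / W k else 0) := by
      refine mul_nonneg (by positivity) ?_
      split_ifs with hkS
      · exact (div_pos (hW M (by omega)) (hW k (by have := Finset.mem_Ico.mp hkS; omega))).le
      · exact le_rfl
    rcases Nat.lt_or_ge k m with h1 | h1
    · linarith [hleft k hk'.1 h1]
    · rcases Nat.lt_or_ge k S with h2 | h2
      · have := hmid k h1 h2
        rw [if_pos (Finset.mem_Ico.mpr ⟨by omega, h2⟩)]
        linarith
      · linarith [hright k h2 hk'.2]
  have hES : ∑ k ∈ Finset.Ico M' S', (if k ∈ Finset.Ico M S then W M / W k else 0) ≤ E := by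
    have hES' : E = ∑ k ∈ Finset.Ico M S, W M / W k := by
      rw [hEdef, escapeSum, Finset.mul_sum]
      exact Finset.sum_congr rfl fun k _ => (div_eq_mul_inv _ _).symm
    rw [← Finset.sum_filter, hES']
    refine Finset.sum_le_sum_of_subset_of_nonneg (fun k hk => (Finset.mem_filter.mp hk).2)
      fun k hk _ => ?_
    exact (div_pos (hW M (by omega)) (hW k (by have := Finset.mem_Ico.mp hk; omega))).le
  have hcard : ((Finset.Ico M' S').card : ℝ) ≤ n := by
    rw [Nat.card_Ico]
    have := hm'.S_le
    exact_mod_cast (by omega : S' - M' ≤ n)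
  have hE' : escapeSum p β h' n M' S' = ∑ k ∈ Finset.Ico M' S', W' M' / W' k := by
    rw [escapeSum, Finset.mul_sum]
    exact Finset.sum_congr rfl fun k _ => (div_eq_mul_inv _ _).symm
  rw [hE']
  refine (Finset.sum_le_sum hterm).trans ?_
  rw [Finset.sum_add_distrib, ← Finset.mul_sum, Finset.sum_const, nsmul_eq_mul]
  have f1 := mul_le_mul_of_nonneg_left hES (by positivity : 0 ≤ Real.exp (2 * K) * α₁)
  have f2 := mul_le_mul_of_nonneg_right hcard
    (by positivity : 0 ≤ Real.exp (2 * K) * α₂ * E + Real.exp (2 * K) * α₃ * E)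
  linarith

end Comparison

/-! ### The macroscopic profile of the drift for large n. -/

section Existence

/-- For large `n` and fields close to `h` the drift has the signs of the macroscopic drift. -/
lemma exists_drift_signs {p β h : ℝ} (hp0 : 0 < p) (hβ : 1 / p < β) (hh0 : 0 < h)
    (hh1 : h < p * threshold (β * p)) :
    ∃ c η x₀ ρ θ : ℝ, 0 < c ∧ 0 < η ∧ 0 < ρ ∧ 0 < θ ∧ 0 < x₀ ∧ η ≤ x₀ / 4 ∧ ρ ≤ x₀ / 2 ∧
      ρ ≤ (1 / 2 - x₀) / 4 ∧ ∀ᶠ n : ℕ in atTop, ∀ h', |h' - h| ≤ θ →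
        (∀ k : ℕ, k ≤ n → (k : ℝ) ≤ η * n → 0 < drift p β h' n k) ∧
        (∀ k : ℕ, k ≤ n → (1 - η) * n ≤ k → drift p β h' n k < 0) ∧
        (∀ k : ℕ, (x₀ - ρ) * n ≤ k → (k : ℝ) ≤ (x₀ + ρ) * n → drift p β h' n k ≤ -c) ∧
        ∀ k : ℕ, (1 / 2 - ρ) * n ≤ k → (k : ℝ) ≤ n / 2 → c ≤ drift p β h' n k := by
  have hβ0 : 0 < β := lt_trans (by positivity) hβ
  obtain ⟨x₀, hx0, hx1, hneg⟩ := exists_limitDrift_neg hp0 hβ hh1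
  -- At volume fraction 1 / 2 interaction and entropy vanish, and only the positive field is left.
  have hpos : 0 < limitDrift p β h (1 / 2) := by
    have : limitDrift p β h (1 / 2) = 2 * β * h := by
      rw [limitDrift]; norm_num
    rw [this]; positivity
  obtain ⟨η₀, hη0, hη1, hbdry⟩ := exists_drift_boundary p β h hβ0
  obtain ⟨r₀, hr0, hball0⟩ := Metric.eventually_nhds_iff.mp
    ((continuousAt_limitDrift p β h hx0 (by linarith)).eventually_lt_const
      (show limitDrift p β h x₀ < limitDrift p β h x₀ / 2 by linarith))
  obtain ⟨r₁, hr1, hball1⟩ := Metric.eventually_nhds_iff.mp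
    ((continuousAt_limitDrift p β h (by norm_num : (0 : ℝ) < 1 / 2) (by norm_num)).eventually_const_lt
      (show limitDrift p β h (1 / 2) / 2 < limitDrift p β h (1 / 2) by linarith))
  set ρ := min (min (r₀ / 2) (r₁ / 2)) (min (x₀ / 2) ((1 / 2 - x₀) / 4)) with hρ
  have hρ0 : 0 < ρ := by
    refine lt_min (lt_min (by linarith) (by linarith)) (lt_min (by linarith) (by linarith))
  have ρ1 : ρ ≤ r₀ / 2 := (min_le_left _ _).trans (min_le_left _ _)
  have ρ2 : ρ ≤ r₁ / 2 := (min_le_left _ _).trans (min_le_right _ _)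
  have ρ3 : ρ ≤ x₀ / 2 := (min_le_right _ _).trans (min_le_left _ _)
  have ρ4 : ρ ≤ (1 / 2 - x₀) / 4 := (min_le_right _ _).trans (min_le_right _ _)
  -- On both windows the limiting drift has size at least 2c. Discretisation and the change of field
  -- take at most c / 2 each, the latter by the choice of `θ`.
  set c := min (-limitDrift p β h x₀ / 2) (limitDrift p β h (1 / 2) / 2) / 2 with hc
  have hc0 : 0 < c := by
    have : 0 < min (-limitDrift p β h x₀ / 2) (limitDrift p β h (1 / 2) / 2) :=
      lt_min (by linarith) (by linarith)
    linarith
  have c1 : 2 * c ≤ -limitDrift p β h x₀ / 2 := by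
    have := min_le_left (-limitDrift p β h x₀ / 2) (limitDrift p β h (1 / 2) / 2)
    linarith
  have c2 : 2 * c ≤ limitDrift p β h (1 / 2) / 2 := by
    have := min_le_right (-limitDrift p β h x₀ / 2) (limitDrift p β h (1 / 2) / 2)
    linarith
  set η := min η₀ (x₀ / 4) with hη
  have hηpos : 0 < η := lt_min hη0 (by linarith)
  have hηle : η ≤ η₀ := min_le_left _ _
  have hηx : η ≤ x₀ / 4 := min_le_right _ _
  set θ := min 1 (c / (4 * β)) with hθ
  have hθ0 : 0 < θ := lt_min one_pos (by positivity)
  refine ⟨c, η, x₀, ρ, θ, hc0, hηpos, hρ0, hθ0, hx0, hηx, ρ3, ρ4, ?_⟩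
  have hlarge : ∀ᶠ n : ℕ in atTop, max (4 / (x₀ / 4 * c)) (1 / η) ≤ (n : ℝ) :=
    tendsto_natCast_atTop_atTop.eventually_ge_atTop _
  filter_upwards [hlarge] with n hn
  have n1 : 4 / (x₀ / 4 * c) ≤ n := (le_max_left _ _).trans hn
  have n2 : 1 / η ≤ n := (le_max_right _ _).trans hn
  have hnR : (0 : ℝ) < n := lt_of_lt_of_le (by positivity) n2
  rw [div_le_iff₀ (by positivity)] at n1 n2
  have q1 : ρ * n ≤ x₀ / 2 * n := mul_le_mul_of_nonneg_right ρ3 hnR.le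
  have q2 : ρ * n ≤ (1 / 2 - x₀) / 4 * n := mul_le_mul_of_nonneg_right ρ4 hnR.le
  have q3 : η * n ≤ x₀ / 4 * n := mul_le_mul_of_nonneg_right hηx hnR.le
  have q4 : 0 < x₀ * n := by positivity
  have q5 : ρ * n ≤ r₀ / 2 * n := mul_le_mul_of_nonneg_right ρ1 hnR.le
  have q6 : ρ * n ≤ r₁ / 2 * n := mul_le_mul_of_nonneg_right ρ2 hnR.le
  have q7 : η * n ≤ η₀ * n := mul_le_mul_of_nonneg_right hηle hnR.le
  have q8 : 0 < ρ * n := by positivity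
  -- approximation of the drift
  have happrox : ∀ h', |h' - h| ≤ θ → ∀ k : ℕ, x₀ / 4 * n ≤ k → (k : ℝ) ≤ n / 2 →
      |drift p β h' n k - limitDrift p β h (k / n)| ≤ c := by
    intro h' hh' k hk1 hk2
    have hkpos : (0 : ℝ) < k := lt_of_lt_of_le (by positivity) hk1
    have hkn : (k : ℝ) < n := by linarith
    have a1 := abs_drift_sub_limitDrift_le p β h (n := n) (k := k) (by exact_mod_cast hkpos)
      (by exact_mod_cast hkn)
    have a2 : 1 / (k : ℝ) ≤ 1 / (x₀ / 4 * n) := one_div_le_one_div_of_le (by positivity) hk1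
    have a3 : 1 / ((n : ℝ) - k) ≤ 1 / (x₀ / 4 * n) := by
      refine one_div_le_one_div_of_le (by positivity) ?_
      linarith
    have a4 : 1 / (x₀ / 4 * n) ≤ c / 4 := by
      rw [div_le_iff₀ (by positivity)]; linarith
    have a5 : |2 * β * (h' - h)| ≤ c / 2 := by
      rw [abs_mul, abs_of_pos (by linarith : 0 < 2 * β)]
      have : |h' - h| ≤ c / (4 * β) := hh'.trans (min_le_right _ _)
      calc 2 * β * |h' - h| ≤ 2 * β * (c / (4 * β)) := by gcongr
        _ = c / 2 := by field_simp; ring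
    rw [drift_field p β h h']
    have e : drift p β h n k + 2 * β * (h' - h) - limitDrift p β h (k / n) =
        (drift p β h n k - limitDrift p β h (k / n)) + 2 * β * (h' - h) := by ring
    rw [e]
    refine (abs_add_le _ _).trans ?_
    linarith
  have h1n : 1 ≤ η₀ * n := by linarith
  intro h' hh'
  have hh1' : |h' - h| ≤ 1 := hh'.trans (min_le_left _ _)
  refine ⟨fun k hkn hk => ?_, fun k hkn hk => ?_, fun k hk1 hk2 => ?_, fun k hk1 hk2 => ?_⟩
  · refine (hbdry n h1n h' hh1' k hkn).1 (hk.trans ?_)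
    exact mul_le_mul_of_nonneg_right hηle hnR.le
  · refine (hbdry n h1n h' hh1' k hkn).2 (le_trans ?_ hk)
    exact mul_le_mul_of_nonneg_right (by linarith) hnR.le
  · have happ := (abs_le.mp (happrox h' hh' k (by linarith) (by linarith))).2
    have hdist : dist ((k : ℝ) / n) x₀ < r₀ := by
      rw [Real.dist_eq, abs_lt]
      constructor
      · rw [lt_sub_iff_add_lt, lt_div_iff₀ hnR]; linarith
      · rw [sub_lt_iff_lt_add, div_lt_iff₀ hnR]; linarith
    have := hball0 hdist
    linarith
  · have happ := (abs_le.mp (happrox h' hh' k (by linarith) (by linarith))).1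
    have hdist : dist ((k : ℝ) / n) (1 / 2) < r₁ := by
      rw [Real.dist_eq, abs_lt]
      constructor
      · rw [lt_sub_iff_add_lt, lt_div_iff₀ hnR]; linarith
      · rw [sub_lt_iff_lt_add, div_lt_iff₀ hnR]; linarith
    have := hball1 hdist
    linarith

/-- For large `n` and fields close to `h` the drift has the shape of the macroscopic drift. -/
theorem exists_driftProfile {p β h : ℝ} (hp0 : 0 < p) (hβ : 1 / p < β) (hh0 : 0 < h)
    (hh1 : h < p * threshold (β * p)) :
    ∃ c η κ θ : ℝ, 0 < c ∧ 0 < η ∧ 0 < κ ∧ 0 < θ ∧ ∀ᶠ n : ℕ in atTop,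
      ∃ a m b q r s : ℕ, a ≤ m ∧ m ≤ b ∧ κ * n ≤ m - a ∧ κ * n ≤ b - m ∧ κ * n ≤ r - q ∧
        (s : ℝ) ≤ (1 - η / 2) * n ∧
        ∀ h', |h' - h| ≤ θ → DriftProfile p β h' n c η a b q r s := by
  obtain ⟨c, η, x₀, ρ, θ, hc0, hηpos, hρ0, hθ0, hx0, hηx, ρ3, ρ4, hev⟩ :=
    exists_drift_signs hp0 hβ hh0 hh1
  -- The windows have width about ρ n. Rounding costs at most 2, which ρ n ≥ 4 absorbs by halving;
  -- likewise η n ≥ 2 leaves room for s below (1 - η / 2) n.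
  refine ⟨c, η, ρ / 2, θ, hc0, hηpos, by linarith, hθ0, ?_⟩
  have hlarge : ∀ᶠ n : ℕ in atTop, max (2 / η) (4 / ρ) ≤ (n : ℝ) :=
    tendsto_natCast_atTop_atTop.eventually_ge_atTop _
  filter_upwards [hlarge, hev] with n hn hsigns
  have n2 : 2 / η ≤ n := (le_max_left _ _).trans hn
  have n3 : 4 / ρ ≤ n := (le_max_right _ _).trans hn
  have hnR : (0 : ℝ) < n := lt_of_lt_of_le (by positivity) n2
  rw [div_le_iff₀ (by positivity)] at n2 n3
  have q1 : ρ * n ≤ x₀ / 2 * n := mul_le_mul_of_nonneg_right ρ3 hnR.le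
  have q2 : ρ * n ≤ (1 / 2 - x₀) / 4 * n := mul_le_mul_of_nonneg_right ρ4 hnR.le
  have q3 : η * n ≤ x₀ / 4 * n := mul_le_mul_of_nonneg_right hηx hnR.le
  have q4 : 0 < x₀ * n := by positivity
  have hρn : 4 ≤ ρ * n := by linarith
  set a := ⌈(x₀ - ρ) * n⌉₊ with ha
  set m := ⌈x₀ * n⌉₊ with hm
  set b := ⌊(x₀ + ρ) * n⌋₊ with hb
  set q := ⌈(1 / 2 - ρ) * n⌉₊ with hq
  set r := n / 2 with hr
  set s := ⌈(1 - η) * n⌉₊ with hs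
  have ha1 : (x₀ - ρ) * n ≤ a := Nat.le_ceil _
  have ha2 : (a : ℝ) < (x₀ - ρ) * n + 1 := Nat.ceil_lt_add_one (by linarith)
  have hm1 : x₀ * n ≤ m := Nat.le_ceil _
  have hm2 : (m : ℝ) < x₀ * n + 1 := Nat.ceil_lt_add_one q4.le
  have hb1 : (b : ℝ) ≤ (x₀ + ρ) * n := Nat.floor_le (by positivity)
  have hb2 : (x₀ + ρ) * n < b + 1 := Nat.lt_floor_add_one _
  have hq1 : (1 / 2 - ρ) * n ≤ q := Nat.le_ceil _
  have hq2 : (q : ℝ) < (1 / 2 - ρ) * n + 1 := Nat.ceil_lt_add_one (by linarith)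
  have hr1 : (r : ℝ) ≤ n / 2 := Nat.cast_div_le
  have hr2 : (n : ℝ) / 2 < r + 1 := by
    have : n < 2 * (r + 1) := by omega
    have : (n : ℝ) < 2 * (r + 1) := by exact_mod_cast this
    linarith
  have hs1 : (1 - η) * n ≤ s := Nat.le_ceil _
  have hs2 : (s : ℝ) < (1 - η) * n + 1 := Nat.ceil_lt_add_one (by linarith)
  have ham : a ≤ m := Nat.ceil_mono (by linarith)
  have hmb : m ≤ b := by
    have : (m : ℝ) < b := by linarith
    exact (by exact_mod_cast this : m < b).le
  have hbq : b < q := by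
    have : (b : ℝ) < q := by linarith
    exact_mod_cast this
  have hqr : q ≤ r := by
    have : (q : ℝ) < r := by linarith
    exact (by exact_mod_cast this : q < r).le
  have hrs : r < s := by
    have : (r : ℝ) < s := by linarith
    exact_mod_cast this
  have hsn : s ≤ n := Nat.ceil_le.mpr (by linarith)
  refine ⟨a, m, b, q, r, s, ham, hmb, by linarith, by linarith, by linarith, by linarith,
    fun h' hh' => ⟨(hsigns h' hh').1, fun k hk1 hk2 => ?_, fun k hk1 hk2 => ?_,
      (hsigns h' hh').2.1 s hsn hs1, ham.trans hmb, hbq, hqr, by omega, hrs, hsn,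
      fun k hk => (Nat.lt_ceil.mp hk).le⟩⟩
  · have k1 : (a : ℝ) ≤ k := by exact_mod_cast hk1
    have k2 : (k : ℝ) ≤ b := by exact_mod_cast hk2
    exact (hsigns h' hh').2.2.1 k (by linarith) (by linarith)
  · have k1 : (q : ℝ) ≤ k := by exact_mod_cast hk1
    have k2 : (k : ℝ) ≤ r := by exact_mod_cast hk2
    exact (hsigns h' hh').2.2.2 k (by linarith) (by linarith)

end Existence

end ERGlauber

/-! ### Choice of scales and conclusion. -/

namespace ERGlauber

/-- The contraction factor of the escape time decays faster than a power of `n`. -/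
lemma tendsto_rpow_mul_escape_factor {δ κ : ℝ} (hδ : 0 < δ) (hκ : 0 < κ) :
    Tendsto (fun n : ℕ => ((n : ℝ) ^ (δ / 4)) ^ 2 *
      ((n : ℝ) ^ (-δ) + 2 * (n * Real.exp (-κ * n)))) atTop (𝓝 0) := by
  have h1 : Tendsto (fun x : ℝ => x ^ (-(δ / 2)) + 2 * (x ^ (δ / 2 + 1) * Real.exp (-κ * x)))
      atTop (𝓝 0) := by
    have h2 := (tendsto_rpow_neg_atTop (by linarith : 0 < δ / 2)).add
      ((tendsto_rpow_mul_exp_neg_mul_atTop_nhds_zero (δ / 2 + 1) κ hκ).const_mul 2)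
    simpa using h2
  refine (h1.comp tendsto_natCast_atTop_atTop).congr' ?_
  filter_upwards [eventually_gt_atTop 0] with n hn
  have hnR : (0 : ℝ) < n := by exact_mod_cast hn
  have e0 : ((n : ℝ) ^ (δ / 4)) ^ 2 = (n : ℝ) ^ (δ / 2) := by
    rw [← Real.rpow_natCast, ← Real.rpow_mul hnR.le]
    congr 1
    push_cast
    ring
  have e1 : (n : ℝ) ^ (-(δ / 2)) = (n : ℝ) ^ (δ / 2) * (n : ℝ) ^ (-δ) := by
    rw [← Real.rpow_add hnR]
    congr 1
    ring
  rw [Function.comp_apply, e0, e1, Real.rpow_add hnR, Real.rpow_one]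
  ring

lemma IsMetastable.nonempty_setM {p β h : ℝ} {n M T S : ℕ} (hm : IsMetastable p β h n M T S) :
    Nonempty (setM p β h n) := by
  have h1 := hm.M_lt_T
  have h2 := hm.T_lt_S
  have h3 := hm.S_le
  obtain ⟨σ, hσ⟩ := exists_vol_eq (n := n) (k := M) (by omega)
  exact ⟨⟨σ, by rw [hm.setM_eq]; exact mem_level.mpr hσ⟩⟩

lemma IsMetastable.cwEscape_bounds {p β h η : ℝ} {n M T S : ℕ} (hm : IsMetastable p β h n M T S)
    (hp0 : 0 ≤ p) (hp1 : p ≤ 1) (hβ : 0 ≤ β) (hη : 0 < η) (hS : (S : ℝ) ≤ (1 - η) * n)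
    (σ : setM p β h n) :
    η * Real.exp (-(β * (2 * (1 + |h|)))) / escapeSum p β h n M S ≤
        cwEscape p β h (σ : Config n) ∧
      cwEscape p β h (σ : Config n) ≤
        Real.exp (β * (2 * (1 + |h|))) / escapeSum p β h n M S := by
  have hσ : (σ : Config n) ∈ level n M := hm.setM_eq ▸ σ.2
  rw [mem_level] at hσ
  generalize (σ : Config n) = ξ at hσ
  rw [cwEscape, hm.setM_eq, hm.setS_eq]
  exact cw_hitBefore_bounds hp0 hp1 hβ (hm.M_lt_T.trans hm.T_lt_S) hm.S_le hη hS hσ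

/-- If the ratio of two escape sums beats the constants, the corresponding bounds are ordered. -/
lemma bounds_ordered {E E' L L' η B ρ : ℝ} (hE : 0 < E) (hE' : 0 < E') (hB : 0 < B)
    (hEE' : E' ≤ ρ * E)
    (hρ : Real.exp (L + L') * B ^ 2 * ρ ≤ η) :
    Real.exp L * B ^ 2 / E ≤ η * Real.exp (-L') / E' ∧
      Real.exp L / E ≤ η * Real.exp (-L') / (B ^ 2 * E') := by
  have hL := Real.exp_pos L
  have key : Real.exp L * B ^ 2 * E' ≤ η * Real.exp (-L') * E := by
    calc Real.exp L * B ^ 2 * E' ≤ Real.exp L * B ^ 2 * (ρ * E) := by gcongr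
      _ = Real.exp (L + L') * B ^ 2 * ρ * (Real.exp (-L') * E) := by
          rw [Real.exp_add, Real.exp_neg]; field_simp
      _ ≤ η * (Real.exp (-L') * E) := by gcongr
      _ = _ := by ring
  constructor
  · rw [div_le_div_iff₀ hE hE']; exact key
  · rw [div_le_div_iff₀ hE (by positivity)]; linarith

/-- The escape probabilities are ordered with probability tending to one. -/
theorem rank_ordering (p : ℝ) (hp0 : 0 < p) (hp1 : p < 1) (β h : ℝ) (hβ : 1 / p < β)
    (hh0 : 0 < h) (hh1 : h < p * ERGlauber.threshold (β * p)) (ε : ℝ) (hε : 0 < ε) :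
    (∀ᶠ n : ℕ in atTop,
      ERGlauber.WellDefined p β h n ∧
      ERGlauber.WellDefined p β (ERGlauber.fieldL h ε n) n ∧
      ERGlauber.WellDefined p β (ERGlauber.fieldU h ε n) n) ∧
    Tendsto
      (fun n : ℕ => (SimpleGraph.binomialRandom (Fin n) ⟨p, hp0.le, hp1.le⟩).real
        {G : SimpleGraph (Fin n) |
          (⨆ ξ : ERGlauber.setM p β (ERGlauber.fieldL h ε n) n,
            ERGlauber.cwEscape p β (ERGlauber.fieldL h ε n) (ξ : ERGlauber.Config n))
            ≤ ERGlauber.erEscape p β h G ∧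
          ERGlauber.erEscape p β h G ≤
            (⨅ σ : ERGlauber.setM p β (ERGlauber.fieldU h ε n) n,
              ERGlauber.cwEscape p β (ERGlauber.fieldU h ε n) (σ : ERGlauber.Config n))})
      atTop (𝓝 1) := by
  have hβ0 : 0 < β := lt_trans (by positivity) hβ
  obtain ⟨c, η, κ, θ, hc, hη, hκ, hθ, hprof⟩ := exists_driftProfile hp0 hβ hh0 hh1
  -- Chosen so that a field shift Δ acting over a distance κ n gives 2βΔκn = δ log n.
  set δ : ℝ := 2 * β * κ * ((1 + ε) * (11 / 6)) with hδ
  have hδ0 : 0 < δ := by positivity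
  set K : ℝ := 2 * (2 * β * p + 2 / η) with hK
  set C : ℝ := Real.exp (β ^ 2 + β) with hC
  -- Bounds the cost of one flip for all three fields, since the shifts are eventually at most 1.
  set L : ℝ := β * (2 * (2 + |h|)) with hL
  let Δ : ℕ → ℝ := fun n => (1 + ε) * Real.log ((n : ℝ) ^ (11 / 6 : ℝ)) / n
  -- The loss A ^ 2 = n ^ (δ / 2) is beaten by the gain n ^ (-δ), while the exceptional probability
  -- 4 / A still tends to 0.
  let A : ℕ → ℝ := fun n => (n : ℝ) ^ (δ / 4)
  let ρ : ℕ → ℝ := fun n => (n : ℝ) ^ (-δ) + 2 * (n * Real.exp (-(c * κ) * n))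
  have hΔeq : ∀ n : ℕ, 0 < n → Δ n = (1 + ε) * (11 / 6) * Real.log n / n := by
    intro n hn
    simp only [Δ]
    rw [Real.log_rpow (by exact_mod_cast hn)]
    ring
  have hΔlim : Tendsto Δ atTop (𝓝 0) := by
    have h1 : Tendsto (fun x : ℝ => (1 + ε) * (11 / 6) * (Real.log x / x)) atTop (𝓝 0) := by
      simpa using (Real.isLittleO_log_id_atTop.tendsto_div_nhds_zero).const_mul
        ((1 + ε) * (11 / 6))
    refine (h1.comp tendsto_natCast_atTop_atTop).congr' ?_
    filter_upwards [eventually_gt_atTop 0] with n hn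
    rw [Function.comp_apply, hΔeq n hn]
    ring
  have hΔev : ∀ᶠ n in atTop, Δ n ≤ min θ 1 :=
    (hΔlim.eventually_lt_const (lt_min hθ one_pos)).mono fun n hn => hn.le
  have hρlim : Tendsto (fun n => Real.exp (L + L) * C ^ 2 * Real.exp K * (A n ^ 2 * ρ n)) atTop
      (𝓝 0) := by
    have h1 := (tendsto_rpow_mul_escape_factor hδ0 (mul_pos hc hκ)).const_mul
      (Real.exp (L + L) * C ^ 2 * Real.exp K)
    rw [mul_zero] at h1
    exact h1
  have hρev : ∀ᶠ n in atTop, Real.exp (L + L) * C ^ 2 * Real.exp K * (A n ^ 2 * ρ n) ≤ η / 2 :=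
    (hρlim.eventually_lt_const (by linarith)).mono fun n hn => hn.le
  have hnβ : ∀ᶠ n : ℕ in atTop, β ≤ n := tendsto_natCast_atTop_atTop.eventually_ge_atTop β
  -- the metastable volumes for the three fields and the comparison of their escape times
  have hmain : ∀ᶠ n : ℕ in atTop, ∃ M T S Ml Tl Sl Mu Tu Su : ℕ,
      IsMetastable p β h n M T S ∧ IsMetastable p β (fieldL h ε n) n Ml Tl Sl ∧
      IsMetastable p β (fieldU h ε n) n Mu Tu Su ∧
      (S : ℝ) ≤ (1 - η / 2) * n ∧ (Sl : ℝ) ≤ (1 - η / 2) * n ∧ (Su : ℝ) ≤ (1 - η / 2) * n ∧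
      escapeSum p β h n M S ≤
        Real.exp K * ρ n * escapeSum p β (fieldL h ε n) n Ml Sl ∧
      escapeSum p β (fieldU h ε n) n Mu Su ≤ Real.exp K * ρ n * escapeSum p β h n M S := by
    filter_upwards [hprof, hΔev, eventually_gt_atTop 0] with n hn hΔn hn0
    obtain ⟨a, m, b, q, r, s, ham, hmb, d1, d2, d3, hs, hd⟩ := hn
    have hnR : (0 : ℝ) < n := by exact_mod_cast hn0
    have hn1 : (1 : ℝ) ≤ n := by exact_mod_cast hn0
    have hΔ0 : 0 ≤ Δ n := by
      rw [hΔeq n hn0]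
      have := Real.log_nonneg hn1
      positivity
    have hΔθ : Δ n ≤ θ := hΔn.trans (min_le_left _ _)
    have hU : fieldU h ε n = h + Δ n := rfl
    have hLf : fieldL h ε n = h - Δ n := rfl
    have hp := hd h (by simpa using hθ.le)
    have hpl := hd (fieldL h ε n) (by rw [hLf, abs_le]; constructor <;> linarith)
    have hpu := hd (fieldU h ε n) (by rw [hU, abs_le]; constructor <;> linarith)
    obtain ⟨M, T, S, hm, -, -, hS⟩ := hp.exists_isMetastable hc
    obtain ⟨Ml, Tl, Sl, hml, -, -, hSl⟩ := hpl.exists_isMetastable hc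
    obtain ⟨Mu, Tu, Su, hmu, -, -, hSu⟩ := hpu.exists_isMetastable hc
    have hfactor : Real.exp (-(2 * β * Δ n * (m - a))) + n * Real.exp (-(c * (b - m))) +
        n * Real.exp (-(c * (r - q))) ≤ ρ n := by
      have f1 : Real.exp (-(2 * β * Δ n * (m - a))) ≤ (n : ℝ) ^ (-δ) := by
        rw [Real.rpow_def_of_pos hnR, Real.exp_le_exp]
        have : 2 * β * Δ n * (κ * n) ≤ 2 * β * Δ n * (m - a) :=
          mul_le_mul_of_nonneg_left d1 (by positivity)
        have e : 2 * β * Δ n * (κ * n) = Real.log n * δ := by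
          rw [hΔeq n hn0, hδ]; field_simp
        linarith
      have f2 : ∀ x : ℝ, κ * n ≤ x → Real.exp (-(c * x)) ≤ Real.exp (-(c * κ) * n) := by
        intro x hx
        rw [Real.exp_le_exp]
        have := mul_le_mul_of_nonneg_left hx hc.le
        linarith
      have g2 := mul_le_mul_of_nonneg_left (f2 _ d2) hnR.le
      have g3 := mul_le_mul_of_nonneg_left (f2 _ d3) hnR.le
      simp only [ρ]
      linarith
    refine ⟨M, T, S, Ml, Tl, Sl, Mu, Tu, Su, hm, hml, hmu, ?_, ?_, ?_, ?_, ?_⟩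
    · exact le_trans (by exact_mod_cast hS) hs
    · exact le_trans (by exact_mod_cast hSl) hs
    · exact le_trans (by exact_mod_cast hSu) hs
    · have := escapeSum_le_of_field_le hp0.le hβ0.le hc hη (by rw [hLf]; linarith) hpl hp ham hmb
        hml hm
      have e : h - fieldL h ε n = Δ n := by rw [hLf]; ring
      rw [e] at this
      refine this.trans (mul_le_mul_of_nonneg_right (mul_le_mul_of_nonneg_left hfactor
        (Real.exp_pos _).le) (escapeSum_pos p β _ (hml.M_lt_T.trans hml.T_lt_S) hml.S_le).le)
    · have := escapeSum_le_of_field_le hp0.le hβ0.le hc hη (by rw [hU]; linarith) hp hpu ham hmb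
        hm hmu
      have e : fieldU h ε n - h = Δ n := by rw [hU]; ring
      rw [e] at this
      refine this.trans (mul_le_mul_of_nonneg_right (mul_le_mul_of_nonneg_left hfactor
        (Real.exp_pos _).le) (escapeSum_pos p β _ (hm.M_lt_T.trans hm.T_lt_S) hm.S_le).le)
  refine ⟨hmain.mono fun n hn => ?_, ?_⟩
  · obtain ⟨M, T, S, Ml, Tl, Sl, Mu, Tu, Su, hm, hml, hmu, -⟩ := hn
    exact ⟨hm.isLeast.1, hml.isLeast.1, hmu.isLeast.1⟩
  have hlower : Tendsto (fun n => 1 - 4 / A n) atTop (𝓝 1) := by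
    have h1 : Tendsto (fun n => 4 / A n) atTop (𝓝 0) :=
      ((tendsto_rpow_atTop (by linarith : 0 < δ / 4)).comp
        tendsto_natCast_atTop_atTop).const_div_atTop 4
    simpa using h1.const_sub 1
  refine tendsto_of_tendsto_of_tendsto_of_le_of_le' hlower tendsto_const_nhds ?_
    (Eventually.of_forall fun n => measureReal_le_one)
  filter_upwards [hmain, hρev, hnβ, hΔev, eventually_gt_atTop 0] with n hn hρn hβn hΔn hn0
  obtain ⟨M, T, S, Ml, Tl, Sl, Mu, Tu, Su, hm, hml, hmu, hS, hSl, hSu, hEl, hEu⟩ := hn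
  have hnR : (0 : ℝ) < n := by exact_mod_cast hn0
  have hn1 : (1 : ℝ) ≤ n := by exact_mod_cast hn0
  have hΔ0 : 0 ≤ Δ n := by
    rw [hΔeq n hn0]
    have := Real.log_nonneg hn1
    positivity
  have hΔ1 : Δ n ≤ 1 := hΔn.trans (min_le_right _ _)
  have hA : 0 < A n := Real.rpow_pos_of_pos hnR _
  have hη2 : 0 < η / 2 := by linarith
  have hcost : ∀ h' : ℝ, |h' - h| ≤ 1 → β * (2 * (1 + |h'|)) ≤ L := by
    intro h' hh'
    have := abs_add_le (h' - h) h
    rw [sub_add_cancel] at this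
    rw [hL]
    refine mul_le_mul_of_nonneg_left ?_ hβ0.le
    linarith
  have cost := hcost h (by simp)
  have costL := hcost (fieldL h ε n) (by
    have : fieldL h ε n - h = -Δ n := by
      change h - Δ n - h = _
      ring
    rw [this, abs_neg, abs_of_nonneg hΔ0]; exact hΔ1)
  have costU := hcost (fieldU h ε n) (by
    have : fieldU h ε n - h = Δ n := by
      change h + Δ n - h = _
      ring
    rw [this, abs_of_nonneg hΔ0]; exact hΔ1)
  have E0 := escapeSum_pos p β h (hm.M_lt_T.trans hm.T_lt_S) hm.S_le
  have El := escapeSum_pos p β (fieldL h ε n) (hml.M_lt_T.trans hml.T_lt_S) hml.S_le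
  have Eu := escapeSum_pos p β (fieldU h ε n) (hmu.M_lt_T.trans hmu.T_lt_S) hmu.S_le
  have hB : 0 < A n * C := mul_pos hA (Real.exp_pos _)
  have hρn0 : 0 ≤ ρ n := by
    simp only [ρ]
    positivity
  have hρ' : ∀ x y : ℝ, x ≤ L → y ≤ L →
      Real.exp (x + y) * (A n * C) ^ 2 * (Real.exp K * ρ n) ≤ η / 2 := by
    intro x y hx hy
    refine le_trans ?_ hρn
    have h1 : Real.exp (x + y) ≤ Real.exp (L + L) := Real.exp_le_exp.mpr (by linarith)
    calc Real.exp (x + y) * (A n * C) ^ 2 * (Real.exp K * ρ n)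
        ≤ Real.exp (L + L) * (A n * C) ^ 2 * (Real.exp K * ρ n) := by gcongr
      _ = _ := by ring
  have hprob := measure_hitBefore_bounds (n := n) ⟨p, hp0.le, hp1.le⟩ h hβ0.le hβn
    (hm.M_lt_T.trans hm.T_lt_S) hm.S_le hη2 hS hA
  refine hprob.trans (measureReal_mono fun G hG => ?_)
  obtain ⟨hG1, hG2⟩ := hG
  -- Nonempty index sets make the supremum and the infimum of reals meaningful instead of a default
  -- value.
  have hne1 := hml.nonempty_setM
  have hne2 := hmu.nonempty_setM
  have her : erEscape p β h G = hitBefore (erHamiltonian G h) β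
      ((gibbs (erHamiltonian G h) β)[|level n M]) (level n S) (level n M) := by
    rw [erEscape, hm.setM_eq, hm.setS_eq]
  constructor
  · refine ciSup_le fun ξ => ?_
    rw [her]
    refine ((hml.cwEscape_bounds hp0.le hp1.le hβ0.le hη2 hSl ξ).2.trans ?_).trans hG1
    exact (bounds_ordered El E0 hB hEl (hρ' _ _ costL cost)).2
  · refine le_ciInf fun σ => ?_
    rw [her]
    refine (hG2.trans ?_).trans (hmu.cwEscape_bounds hp0.le hp1.le hβ0.le hη2 hSu σ).1
    exact (bounds_ordered E0 Eu hB hEu (hρ' _ _ cost costU)).1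

end ERGlauber

theorem mainTheorem4 (p : ℝ) (hp0 : 0 < p) (hp1 : p < 1) (β h : ℝ) (hβ : 1 / p < β)
    (hh0 : 0 < h) (hh1 : h < p * ERGlauber.threshold (β * p)) (ε : ℝ) (hε : 0 < ε) :
    (∀ᶠ n : ℕ in atTop,
      ERGlauber.WellDefined p β h n ∧
      ERGlauber.WellDefined p β (ERGlauber.fieldL h ε n) n ∧
      ERGlauber.WellDefined p β (ERGlauber.fieldU h ε n) n) ∧
    Tendsto
      (fun n : ℕ => (SimpleGraph.binomialRandom (Fin n) ⟨p, hp0.le, hp1.le⟩).real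
        {G : SimpleGraph (Fin n) |
          (⨆ ξ : ERGlauber.setM p β (ERGlauber.fieldL h ε n) n,
            ERGlauber.cwEscape p β (ERGlauber.fieldL h ε n) (ξ : ERGlauber.Config n))
            ≤ ERGlauber.erEscape p β h G ∧
          ERGlauber.erEscape p β h G ≤
            (⨅ σ : ERGlauber.setM p β (ERGlauber.fieldU h ε n) n,
              ERGlauber.cwEscape p β (ERGlauber.fieldU h ε n) (σ : ERGlauber.Config n))})
      atTop (𝓝 1) :=
  ERGlauber.rank_ordering p hp0 hp1 β h hβ hh0 hh1 ε hε
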